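/- Let $d\in\mathbb N$ and let $\Gamma:\mathbb R^d\to\mathbb R$ be an even $C^3$ function whose derivatives of orders $1$, $2$ and $3$ are bounded. Write $z=(x,v)\in\mathbb R^d\times\mathbb R^d=\mathbb R^{2d}$, and consider for complex-valued $\alpha(t,x,v)$ the Hamiltonian Vlasov equation $$\partial_t\alpha=-v\cdot\nabla_x\alpha+\bigl(\nabla\Gamma*|\alpha|^2\bigr)(x)\cdot\nabla_v\alpha-K_\alpha(t,x)\,\alpha,\tag{HVl}$$ where $$(\nabla\Gamma*|\alpha|^2)(x)=\int_{\mathbb R^{2d}}\nabla\Gamma(x-y)\,|\alpha(t,y,w)|^2\,dy\,dw,\qquad K_\alpha(t,x)=\int_{\mathbb R^{2d}}\nabla\Gamma(x-y)\cdot\bar\alpha(t,y,w)\,\nabla_v\alpha(t,y,w)\,dy\,dw .$$ (Here $K_\alpha=\Gamma*[\bar\alpha,\alpha]$, integrated by parts, with the Poisson bracket $[f,g]=\nabla_xf\cdot\nabla_vg-\nabla_vf\cdot\nabla_xg$ and the convolution taken in $x$ after integrating over $v$.) A *global solution* with initial datum $\mathring\alpha\in W^{1,2}(\mathbb R^{2d})$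 is a map $\alpha:[0,\infty)\to W^{1,2}(\mathbb R^{2d})$ with $\alpha(0)=\mathring\alpha$ which is continuous into $L^2(\mathbb R^{2d})$, Bochner integrable into $W^{1,2}(\mathbb R^{2d})$ on every $[0,T]$, and satisfies (HVl) in the distributional sense: for every $\varphi\in C_c^\infty(\mathbb R^{2d};\mathbb R)$ and every $t\ge0$, $$\int\varphi\,\alpha(t)\,dz=\int\varphi\,\mathring\alpha\,dz+\int_0^t\!\int\varphi\,\bigl(-v\cdot\nabla_x\alpha+(\nabla\Gamma*|\alpha|^2)\cdot\nabla_v\alpha-K_\alpha\,\alpha\bigr)(s,z)\,dz\,ds .$$ Then: 1. For every $\mathring\alpha\in W^{1,2}(\mathbb R^{2d})$ there is exactly one global solution $\alpha$ of (HVl) with initial datum $\mathring\alpha$. 2. For every $T\in(0,\infty)$ the solution map $W^{1,2}(\mathbb R^{2d})\to L^\infty([0,T];L^2(\mathbb R^{2d}))$, $\mathring\alpha\mapsto\alpha|_{[0,T]}$, is well defined and locally Lipschitz continuous. 3. Every global solution lies in $L^\infty([0,\infty);L^2(\mathbb R^{2d}))$ and, for every $T\in(0,\infty)$, in $L^\infty([0,T];W^{1,2}(\mathbb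 R^{2d}))$. -/

import Mathlib

open MeasureTheory
open scoped ComplexConjugate

noncomputable section

/-- The one-particle phase space `ℝ^d × ℝ^d` of pairs `z = (x, v)`, with Lebesgue measure. -/
abbrev PhaseSpace (d : ℕ) : Type :=
  EuclideanSpace ℝ (Fin d) × EuclideanSpace ℝ (Fin d)

/-- The complex Lebesgue space `L²(ℝ^{2d})`. -/
abbrev L2 (d : ℕ) : Type := Lp ℂ 2 (volume : Measure (PhaseSpace d))

/-- Smooth compactly supported real test functions on phase space. -/
structure IsTestFunction {d : ℕ} (φ : PhaseSpace d → ℝ) : Prop where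
  smooth : ContDiff ℝ ((⊤ : ℕ∞) : WithTop ℕ∞) φ
  compact : HasCompactSupport φ

/-- The coordinate unit vectors of phase space: `Sum.inl i` is the direction of `x_i` and
`Sum.inr i` is the direction of `v_i`. -/
def coordDir (d : ℕ) : Fin d ⊕ Fin d → PhaseSpace d
  | Sum.inl i => (EuclideanSpace.single i 1, 0)
  | Sum.inr i => (0, EuclideanSpace.single i 1)

/-- `g` is the weak (distributional) derivative of `f` in the direction `u`. -/
def HasWeakDeriv {d : ℕ} (u : PhaseSpace d) (f g : L2 d) : Prop :=
  ∀ φ : PhaseSpace d → ℝ, IsTestFunction φ →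
    ∫ z, fderiv ℝ φ z u • f z = - ∫ z, φ z • g z

theorem integrable_smul_L2 {d : ℕ} {φ : PhaseSpace d → ℝ} (hφ : Continuous φ)
    (hc : HasCompactSupport φ) (f : L2 d) : Integrable (fun z => φ z • f z) :=
  ((Lp.memLp f).locallyIntegrable (by norm_num)).integrable_smul_left_of_hasCompactSupport hφ hc

theorem IsTestFunction.integrable_smul {d : ℕ} {φ : PhaseSpace d → ℝ} (h : IsTestFunction φ)
    (f : L2 d) : Integrable (fun z => φ z • f z) :=
  integrable_smul_L2 h.smooth.continuous h.compact f

theorem IsTestFunction.integrable_fderiv_smul {d : ℕ} {φ : PhaseSpace d → ℝ}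
    (h : IsTestFunction φ) (u : PhaseSpace d) (f : L2 d) :
    Integrable (fun z => fderiv ℝ φ z u • f z) :=
  integrable_smul_L2 ((h.smooth.continuous_fderiv (by simp)).clm_apply continuous_const)
    (h.compact.fderiv_apply (𝕜 := ℝ) u) f

theorem HasWeakDeriv.zero {d : ℕ} (u : PhaseSpace d) : HasWeakDeriv u (0 : L2 d) 0 := by
  intro φ _
  have h0 : ((0 : L2 d) : PhaseSpace d → ℂ) =ᵐ[volume] 0 := Lp.coeFn_zero _ _ _
  have h1 : ∫ z, fderiv ℝ φ z u • (0 : L2 d) z = 0 :=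
    integral_eq_zero_of_ae (by filter_upwards [h0] with z hz; rw [hz, Pi.zero_apply, smul_zero])
  have h2 : ∫ z, φ z • (0 : L2 d) z = 0 :=
    integral_eq_zero_of_ae (by filter_upwards [h0] with z hz; rw [hz, Pi.zero_apply, smul_zero])
  rw [h1, h2, neg_zero]

theorem HasWeakDeriv.add {d : ℕ} {u : PhaseSpace d} {f g f' g' : L2 d}
    (h : HasWeakDeriv u f g) (h' : HasWeakDeriv u f' g') :
    HasWeakDeriv u (f + f') (g + g') := by
  intro φ hφ
  have e1 : ∫ z, fderiv ℝ φ z u • (f + f') z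
      = ∫ z, (fderiv ℝ φ z u • f z + fderiv ℝ φ z u • f' z) :=
    integral_congr_ae (by
      filter_upwards [Lp.coeFn_add f f'] with z hz
      rw [hz, Pi.add_apply, smul_add])
  have e2 : ∫ z, φ z • (g + g') z = ∫ z, (φ z • g z + φ z • g' z) :=
    integral_congr_ae (by
      filter_upwards [Lp.coeFn_add g g'] with z hz
      rw [hz, Pi.add_apply, smul_add])
  rw [e1, e2, integral_add (hφ.integrable_fderiv_smul u f) (hφ.integrable_fderiv_smul u f'),
    integral_add (hφ.integrable_smul g) (hφ.integrable_smul g'), h φ hφ, h' φ hφ]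
  ring

theorem HasWeakDeriv.smul {d : ℕ} {u : PhaseSpace d} {f g : L2 d} (c : ℂ)
    (h : HasWeakDeriv u f g) : HasWeakDeriv u (c • f) (c • g) := by
  intro φ hφ
  have e1 : ∫ z, fderiv ℝ φ z u • (c • f) z = ∫ z, c • (fderiv ℝ φ z u • f z) :=
    integral_congr_ae (by
      filter_upwards [Lp.coeFn_smul c f] with z hz
      rw [hz, Pi.smul_apply, smul_comm])
  have e2 : ∫ z, φ z • (c • g) z = ∫ z, c • (φ z • g z) :=
    integral_congr_ae (by
      filter_upwards [Lp.coeFn_smul c g] with z hz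
      rw [hz, Pi.smul_apply, smul_comm])
  rw [e1, e2, integral_smul, integral_smul, h φ hφ, smul_neg]

/-- The Sobolev space `W^{1,2}(ℝ^{2d})` as the space of pairs `(f, (∂_j f)_j)` of an `L²` function
and its (uniquely determined) weak partial derivatives in `L²`. -/
def sobolevGraph (d : ℕ) :
    Submodule ℂ (WithLp 2 (L2 d × PiLp 2 fun _ : Fin d ⊕ Fin d => L2 d)) where
  carrier := {p | ∀ j, HasWeakDeriv (coordDir d j) p.fst (p.snd j)}
  zero_mem' := fun _ => HasWeakDeriv.zero _
  add_mem' := fun ha hb j => (ha j).add (hb j)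
  smul_mem' := fun c _ ha j => (ha j).smul c

/-- The Sobolev space `W^{1,2}(ℝ^{2d})` with the norm `(‖f‖² + ∑_j ‖∂_j f‖²)^{1/2}`, which is the
one inherited from the ambient `ℓ²`-product. -/
abbrev W12 (d : ℕ) : Type := sobolevGraph d

namespace W12

variable {d : ℕ}

/-- The underlying `L²` function. -/
def toL2 (a : W12 d) : L2 d := a.1.fst

/-- The weak derivative `∂_{x_i} a`. -/
def dx (a : W12 d) (i : Fin d) : L2 d := a.1.snd (Sum.inl i)

/-- The weak derivative `∂_{v_i} a`. -/
def dv (a : W12 d) (i : Fin d) : L2 d := a.1.snd (Sum.inr i)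

end W12

/-- The partial derivative `∂_i Γ (x)`. -/
def partialDeriv {d : ℕ} (Γ : EuclideanSpace ℝ (Fin d) → ℝ) (i : Fin d)
    (x : EuclideanSpace ℝ (Fin d)) : ℝ :=
  fderiv ℝ Γ x (EuclideanSpace.single i 1)

/-- The `i`-th component of `(∇Γ * |a|²)(x) = ∫∫ ∇Γ(x - y) |a(y,w)|² dy dw`. -/
def fieldConv {d : ℕ} (Γ : EuclideanSpace ℝ (Fin d) → ℝ) (a : W12 d) (i : Fin d)
    (x : EuclideanSpace ℝ (Fin d)) : ℝ :=
  ∫ w : PhaseSpace d, partialDeriv Γ i (x - w.1) * ‖a.toL2 w‖ ^ 2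

/-- The term `Γ * [ā, a]`, where `[ā, a]` is the Poisson bracket
`∇_x ā · ∇_v a - ∇_v ā · ∇_x a = div_x (ā ∇_v a) - div_v (ā ∇_x a)`, in the form
`(∇Γ * ∫ ā ∇_v a dv)(x) = ∫∫ ∇Γ(x - y) · ā(y,w) ∇_v a(y,w) dy dw`,
which converges absolutely for every `a ∈ W^{1,2}` as soon as `∇Γ` is bounded
(while `Γ` itself may be unbounded). -/
def bracketConv {d : ℕ} (Γ : EuclideanSpace ℝ (Fin d) → ℝ) (a : W12 d)
    (x : EuclideanSpace ℝ (Fin d)) : ℂ :=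
  ∑ i, ∫ w : PhaseSpace d,
    (partialDeriv Γ i (x - w.1) : ℂ) * (conj (a.toL2 w) * a.dv i w)

/-- The right-hand side of the Hamiltonian Vlasov equation,
`-v · ∇_x a + (∇Γ * |a|²)(x) · ∇_v a - (Γ * [ā, a])(x) a`. -/
def hvlRHS {d : ℕ} (Γ : EuclideanSpace ℝ (Fin d) → ℝ) (a : W12 d) (z : PhaseSpace d) : ℂ :=
  ∑ i, (-(z.2 i : ℂ) * a.dx i z + (fieldConv Γ a i z.1 : ℂ) * a.dv i z)
    - bracketConv Γ a z.1 * a.toL2 z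

/-- `α : [0,∞) → W^{1,2}` is a global solution of the Hamiltonian Vlasov equation with initial
datum `a`: it is continuous into `L²`, locally Bochner integrable into `W^{1,2}`, and
`∂_t α = hvlRHS Γ α` holds in the sense of distributions, integrated in time.
Values at negative times are irrelevant. -/
structure IsHVlSolution {d : ℕ} (Γ : EuclideanSpace ℝ (Fin d) → ℝ) (a : W12 d)
    (α : ℝ → W12 d) : Prop where
  initial : α 0 = a
  continuous_L2 : ContinuousOn (fun t => (α t).toL2) (Set.Ici 0)
  integrable_W12 : ∀ T : ℝ, IntegrableOn α (Set.Icc 0 T)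
  equation : ∀ φ : PhaseSpace d → ℝ, IsTestFunction φ → ∀ t : ℝ, 0 ≤ t →
    ∫ z, φ z • (α t).toL2 z
      = (∫ z, φ z • a.toL2 z) + ∫ s in (0 : ℝ)..t, ∫ z, φ z • hvlRHS Γ (α s) z

/-- The interaction potentials: even, three times continuously differentiable, with bounded
derivatives of orders one, two and three. -/
structure IsRegularPotential {d : ℕ} (Γ : EuclideanSpace ℝ (Fin d) → ℝ) : Prop where
  contDiff : ContDiff ℝ 3 Γ
  even : ∀ x, Γ (-x) = Γ x
  bounded : ∃ C : ℝ, ∀ k ∈ Finset.Icc 1 3, ∀ x, ‖iteratedFDeriv ℝ k Γ x‖ ≤ C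

end

noncomputable section

open Filter Topology

/-! Everything rests on an L² stability estimate in which derivatives never fall on the difference γ
= α − β of two solutions. The difference satisfies a transport equation along a divergence-free
field, so that -v·∇_x γ + E_α·∇_v γ contributes nothing to d/dt ‖γ‖². The source (E_α − E_β)·∇_v β
is bounded by ‖γ‖ times Sobolev norms, since E depends on |α|² only. In K_α − K_β the term conj(β)
∇_v γ is integrated by parts in v, which moves the derivative onto β (`norm_bracketConv_sub_le`).
Hence the right-hand side is one-sided Lipschitz in L² with a constant linear in ‖α‖ + ‖β‖ in
W^{1,2}, and Grönwall applies.

Two difficulties stand in the way of this computation. The field v is unbounded, so v·∇_x α need not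
be in L², and α solves the equation only in the distributional sense. A cutoff in v cures the first:
it commutes with v·∇_x, and its commutator with E·∇_v is O(1/R) (`exists_re_inner_cutRHS_le`). The
localized equation then holds in L², and an energy identity for primitives of Bochner integrable
functions (`norm_sq_add_integral_eq`) replaces differentiation in time. The resulting estimate
`exists_stability` allows a defect ε in the equation. With ε = 0 it gives uniqueness, where the
kernel is merely integrable in time (`gronwall_zero`), and the local Lipschitz bound.

Existence uses a splitting scheme. During a step the mean fields are frozen: a velocity kick and a
multiplication by exp(-sK) are followed by free transport. The two shears preserve volume and K is
purely imaginary (`bracketConv_re`), so the L² norm does not grow; the W^{1,2} norm grows at most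
exponentially, at a rate depending only on the L² norm (`exists_splitStep`). For data of bounded
velocity support, which the scheme preserves up to linear growth, the defect is of first order in
the time step (`exists_splitStep_bounds`, `exists_schemeCurve_isApproxSolution`). The stability
estimate makes the scheme Cauchy in C([0,T]; L²).

Limits are identified by two facts: W^{1,2} bounds survive L² convergence (`W12.exists_of_tendsto`),
and the tested right-hand side is L²-Lipschitz on bounded sets of W^{1,2}
(`exists_norm_integral_hvlRHS_sub_le`). Together they give `exists_isHVlSolution_of_approx`, used
once for the scheme and once more to pass from velocity cutoffs of the datum to a general datum. The
a priori bounds of the scheme pass to the solution and give the last claim. -/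

instance PhaseSpace.instIsAddHaarMeasure (d : ℕ) :
    (volume : Measure (PhaseSpace d)).IsAddHaarMeasure := by
  rw [Measure.volume_eq_prod]; infer_instance

instance PhaseSpace.instIsNegInvariant (d : ℕ) :
    (volume : Measure (PhaseSpace d)).IsNegInvariant :=
  Measure.IsAddHaarMeasure.isNegInvariant_of_regular _

/-! ### Duality of L² with test functions. -/

theorem IsTestFunction.memLp {d : ℕ} {φ : PhaseSpace d → ℝ} (h : IsTestFunction φ) :
    MemLp φ 2 volume :=
  h.smooth.continuous.memLp_of_hasCompactSupport h.compact

/-- The `L²` norm of a real function, as a real number. -/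
def l2norm {d : ℕ} (φ : PhaseSpace d → ℝ) : ℝ := (eLpNorm φ 2 volume).toReal

theorem l2norm_nonneg {d : ℕ} (φ : PhaseSpace d → ℝ) : 0 ≤ l2norm φ := ENNReal.toReal_nonneg

theorem l2norm_le_norm {d : ℕ} {φ : PhaseSpace d → ℝ} {f : L2 d}
    (h : ∀ᵐ z, |φ z| ≤ ‖f z‖) : l2norm φ ≤ ‖f‖ := by
  rw [l2norm, Lp.norm_def]
  exact ENNReal.toReal_mono (Lp.memLp f).eLpNorm_ne_top (eLpNorm_mono_ae h)

theorem l2norm_mono {d : ℕ} {φ ψ : PhaseSpace d → ℝ} (hψ : MemLp ψ 2 volume)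
    (h : ∀ᵐ z, |φ z| ≤ |ψ z|) : l2norm φ ≤ l2norm ψ :=
  ENNReal.toReal_mono hψ.eLpNorm_ne_top (eLpNorm_mono_ae h)

theorem norm_integral_smul_le {d : ℕ} {φ : PhaseSpace d → ℝ} (h : MemLp φ 2 volume) (f : L2 d) :
    ‖∫ z, φ z • f z‖ ≤ l2norm φ * ‖f‖ := by
  have hc : MemLp (fun z => (φ z : ℂ)) 2 volume := h.ofReal
  have e : ∫ z, φ z • f z = inner ℂ (hc.toLp _) f := by
    rw [MeasureTheory.L2.inner_def]
    refine integral_congr_ae ?_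
    filter_upwards [hc.coeFn_toLp] with z hz
    rw [hz, RCLike.inner_apply, Complex.real_smul]
    simp [mul_comm]
  have e2 : ‖hc.toLp _‖ = l2norm φ := by
    rw [Lp.norm_toLp, l2norm]
    congr 1
    exact eLpNorm_congr_norm_ae (Eventually.of_forall fun z => by simp)
  rw [e, ← e2]
  exact norm_inner_le_norm _ _

theorem exists_smooth_near {d : ℕ} (f : L2 d) {δ : ℝ} (hδ : 0 < δ) :
    ∃ (g : L2 d) (G : PhaseSpace d → ℂ), g =ᵐ[volume] G ∧ HasCompactSupport G ∧
      ContDiff ℝ ((⊤ : ℕ∞) : WithTop ℕ∞) G ∧ ‖f - g‖ < δ := by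
  obtain ⟨g, hg, G, h1, h2, h3⟩ := (Metric.dense_iff.1
    (MeasureTheory.Lp.dense_hasCompactSupport_contDiff (E := PhaseSpace d) (F := ℂ)
      (μ := volume) (p := 2) (by norm_num))) f δ hδ
  refine ⟨g, G, h1, h2, h3, ?_⟩
  rw [← dist_eq_norm, dist_comm]
  exact hg

theorem IsTestFunction.re {d : ℕ} {G : PhaseSpace d → ℂ} (hG : HasCompactSupport G)
    (hG' : ContDiff ℝ ((⊤ : ℕ∞) : WithTop ℕ∞) G) : IsTestFunction fun z => (G z).re where
  smooth := Complex.reCLM.contDiff.comp hG'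
  compact := hG.comp_left (g := Complex.re) rfl

theorem IsTestFunction.im {d : ℕ} {G : PhaseSpace d → ℂ} (hG : HasCompactSupport G)
    (hG' : ContDiff ℝ ((⊤ : ℕ∞) : WithTop ℕ∞) G) : IsTestFunction fun z => (G z).im where
  smooth := Complex.imCLM.contDiff.comp hG'
  compact := hG.comp_left (g := Complex.im) rfl

/-- A bound on the pairings with all real test functions bounds the `L²` norm. -/
theorem norm_le_of_test {d : ℕ} {f : L2 d} {C : ℝ} (hC : 0 ≤ C)
    (h : ∀ φ : PhaseSpace d → ℝ, IsTestFunction φ → ‖∫ z, φ z • f z‖ ≤ C * l2norm φ) :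
    ‖f‖ ≤ 2 * C := by
  -- Pair f with a smooth complex approximation g of itself. The real and imaginary parts of g are
  -- separate real test functions, which is where the factor 2 comes from.
  have key : ∀ δ : ℝ, 0 < δ → ‖f‖ * ‖f‖ ≤ 2 * C * (‖f‖ + δ) + δ * ‖f‖ := by
    intro δ hδ
    obtain ⟨g, G, hgG, hG, hG', hfg⟩ := exists_smooth_near f hδ
    have t1 := IsTestFunction.re hG hG'
    have t2 := IsTestFunction.im hG hG'
    have e : inner ℂ g f = (∫ z, (G z).re • f z) - Complex.I * ∫ z, (G z).im • f z := by
      rw [MeasureTheory.L2.inner_def, ← integral_const_mul,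
        ← integral_sub (t1.integrable_smul f) ((t2.integrable_smul f).const_mul _)]
      refine integral_congr_ae ?_
      filter_upwards [hgG] with z hz
      rw [hz, RCLike.inner_apply, Complex.real_smul, Complex.real_smul]
      have : conj (G z) = (G z).re - (G z).im * Complex.I := by
        apply Complex.ext <;> simp
      rw [this]
      ring
    have n1 : l2norm (fun z => (G z).re) ≤ ‖g‖ := l2norm_le_norm (by
      filter_upwards [hgG] with z hz
      rw [hz]; exact Complex.abs_re_le_norm _)
    have n2 : l2norm (fun z => (G z).im) ≤ ‖g‖ := l2norm_le_norm (by
      filter_upwards [hgG] with z hz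
      rw [hz]; exact Complex.abs_im_le_norm _)
    have b : ‖inner ℂ g f‖ ≤ 2 * C * ‖g‖ := by
      rw [e]
      refine (norm_sub_le _ _).trans ?_
      rw [norm_mul, Complex.norm_I, one_mul]
      have := h _ t1
      have := h _ t2
      nlinarith [mul_le_mul_of_nonneg_left n1 hC, mul_le_mul_of_nonneg_left n2 hC]
    have hg : ‖g‖ ≤ ‖f‖ + δ := by
      have := norm_sub_norm_le g f
      rw [norm_sub_rev] at this
      linarith
    have e3 : inner ℂ f f = inner ℂ g f + inner ℂ (f - g) f := by
      rw [← inner_add_left]; congr 1; abel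
    have e4 : ‖f‖ * ‖f‖ = ‖inner ℂ f f‖ := by
      rw [inner_self_eq_norm_sq_to_K]; simp [sq]
    rw [e4, e3]
    refine (norm_add_le _ _).trans (add_le_add (b.trans ?_) ((norm_inner_le_norm _ _).trans ?_))
    · exact mul_le_mul_of_nonneg_left hg (by positivity)
    · exact mul_le_mul_of_nonneg_right hfg.le (norm_nonneg _)
  have lim : ‖f‖ * ‖f‖ ≤ 2 * C * ‖f‖ := by
    have ht : Tendsto (fun δ : ℝ => 2 * C * (‖f‖ + δ) + δ * ‖f‖) (𝓝[>] 0)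
        (𝓝 (2 * C * (‖f‖ + 0) + 0 * ‖f‖)) :=
      Tendsto.mono_left (Continuous.tendsto (by fun_prop) 0) nhdsWithin_le_nhds
    have := ge_of_tendsto ht (eventually_mem_nhdsWithin.mono fun δ hδ => key δ hδ)
    simpa using this
  rcases (norm_nonneg f).eq_or_lt with h0 | h0
  · rw [← h0]; positivity
  · exact le_of_mul_le_mul_right lim h0

theorem eq_zero_of_test {d : ℕ} {f : L2 d}
    (h : ∀ φ : PhaseSpace d → ℝ, IsTestFunction φ → ∫ z, φ z • f z = 0) : f = 0 := by
  have := norm_le_of_test (f := f) le_rfl fun φ hφ => by rw [h φ hφ]; simp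
  simpa using this

theorem integral_smul_sub {d : ℕ} {φ : PhaseSpace d → ℝ} (hφ : Continuous φ)
    (hc : HasCompactSupport φ) (f g : L2 d) :
    ∫ z, φ z • (f - g) z = (∫ z, φ z • f z) - ∫ z, φ z • g z := by
  rw [← integral_sub (integrable_smul_L2 hφ hc f) (integrable_smul_L2 hφ hc g)]
  refine integral_congr_ae ?_
  filter_upwards [Lp.coeFn_sub f g] with z hz
  rw [hz, Pi.sub_apply, smul_sub]

theorem eq_of_test {d : ℕ} {f g : L2 d}
    (h : ∀ φ : PhaseSpace d → ℝ, IsTestFunction φ → ∫ z, φ z • f z = ∫ z, φ z • g z) :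
    f = g := by
  rw [← sub_eq_zero]
  refine eq_zero_of_test fun φ hφ => ?_
  rw [integral_smul_sub hφ.smooth.continuous hφ.compact, h φ hφ, sub_self]

/-! ### Weak derivatives against C¹ test functions. -/

/-- Weak derivatives are unique. -/
theorem HasWeakDeriv.unique {d : ℕ} {u : PhaseSpace d} {f g g' : L2 d}
    (h : HasWeakDeriv u f g) (h' : HasWeakDeriv u f g') : g = g' :=
  eq_of_test fun φ hφ => by
    have := (h φ hφ).symm.trans (h' φ hφ)
    simpa using this

/-- The pairing of `L²` with a continuous compactly supported complex function. -/
theorem integrable_mul_L2 {d : ℕ} {φ : PhaseSpace d → ℂ} (hφ : Continuous φ)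
    (hc : HasCompactSupport φ) (f : L2 d) : Integrable (fun z => φ z * f z) :=
  ((Lp.memLp f).locallyIntegrable (by norm_num)).integrable_smul_left_of_hasCompactSupport hφ hc

/-- Pairings of `L²` functions with uniformly convergent functions supported in a common compact
set converge. -/
theorem tendsto_integral_smul_of_uniform {d : ℕ} {φ : ℕ → PhaseSpace d → ℝ}
    {φ₀ : PhaseSpace d → ℝ} {K : Set (PhaseSpace d)} (hK : IsCompact K)
    (hφ : ∀ n, Continuous (φ n)) (hs : ∀ n, ∀ z, z ∉ K → φ n z = 0)
    (hlim : ∀ z, Tendsto (fun n => φ n z) atTop (𝓝 (φ₀ z))) {C : ℝ} (hC : ∀ n z, |φ n z| ≤ C)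
    (f : L2 d) :
    Tendsto (fun n => ∫ z, φ n z • f z) atTop (𝓝 (∫ z, φ₀ z • f z)) := by
  have hf : IntegrableOn (fun z => f z) K :=
    ((Lp.memLp f).locallyIntegrable (by norm_num)).integrableOn_isCompact hK
  refine tendsto_integral_of_dominated_convergence (K.indicator fun z => C * ‖f z‖)
    (fun n => ((hφ n).aestronglyMeasurable).smul (Lp.aestronglyMeasurable f))
    ((integrable_indicator_iff hK.measurableSet).2 (hf.norm.const_mul C)) ?_ ?_
  · intro n
    filter_upwards with z
    by_cases hz : z ∈ K
    · rw [Set.indicator_of_mem hz, norm_smul]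
      exact mul_le_mul_of_nonneg_right (hC n z) (norm_nonneg _)
    · rw [hs n z hz, Set.indicator_of_notMem hz]; simp
  · filter_upwards with z
    exact (hlim z).smul_const _

open scoped Convolution in
/-- The defining identity of weak derivatives extends to `C¹` test functions. -/
theorem HasWeakDeriv.integral_C1_real {d : ℕ} {u : PhaseSpace d} {f g : L2 d}
    (h : HasWeakDeriv u f g) {φ : PhaseSpace d → ℝ} (hφ : ContDiff ℝ 1 φ)
    (hc : HasCompactSupport φ) :
    ∫ z, fderiv ℝ φ z u • f z = - ∫ z, φ z • g z := by
  -- Mollify φ with bumps of radius 1/(n+1). The radii are at most 1, so all mollified functions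
  -- live in one compact set, the 1-thickening of the support of φ.
  let η : ℕ → ContDiffBump (0 : PhaseSpace d) := fun n =>
    { rIn := 1 / (n + 2), rOut := 1 / (n + 1), rIn_pos := by positivity,
      rIn_lt_rOut := by gcongr; norm_num }
  have hη : Tendsto (fun n => (η n).rOut) atTop (𝓝 0) := tendsto_one_div_add_atTop_nhds_zero_nat
  have hη1 : ∀ n, (η n).rOut ≤ 1 := fun n => by
    change 1 / ((n : ℝ) + 1) ≤ 1
    rw [div_le_one (by positivity)]; linarith [Nat.cast_nonneg (α := ℝ) n]
  let φn : ℕ → PhaseSpace d → ℝ := fun n => (η n).normed volume ⋆[ContinuousLinearMap.lsmul ℝ ℝ, volume] φ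
  let K : Set (PhaseSpace d) := Metric.cthickening 1 (tsupport φ)
  have hK : IsCompact K := hc.isCompact.cthickening
  have hzero : ∀ {F : Type} [NormedAddCommGroup F] [NormedSpace ℝ F] (ψ : PhaseSpace d → F), (tsupport ψ ⊆ tsupport φ) →
      ∀ n z, z ∉ K → ((η n).normed volume ⋆[ContinuousLinearMap.lsmul ℝ ℝ, volume] ψ) z = 0 := by
    intro F _ _ ψ hψ n z hz
    rw [convolution_def]
    refine integral_eq_zero_of_ae (Eventually.of_forall fun w => ?_)
    by_cases hw : w ∈ Metric.ball (0 : PhaseSpace d) (η n).rOut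
    · have : ψ (z - w) = 0 := by
        by_contra hne
        refine hz (Metric.mem_cthickening_of_dist_le z (z - w) 1 _ (hψ (subset_tsupport _ hne)) ?_)
        rw [dist_eq_norm]; simp only [sub_sub_cancel]
        rw [mem_ball_zero_iff] at hw
        exact hw.le.trans (hη1 n)
      simp [this]
    · have : (η n).normed volume w = 0 := by
        have := (η n).support_normed_eq (μ := volume)
        rw [← this] at hw
        simpa using hw
      simp [this]
  have hnb : ∀ {F : Type} [NormedAddCommGroup F] [NormedSpace ℝ F] [CompleteSpace F] (ψ : PhaseSpace d → F) (C : ℝ), 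
      (∀ z, ‖ψ z‖ ≤ C) → Continuous ψ →
      ∀ n z, ‖((η n).normed volume ⋆[ContinuousLinearMap.lsmul ℝ ℝ, volume] ψ) z‖ ≤ 3 * C := by
    intro F _ _ _ ψ C hψ hcont n z
    -- The mollification is an average of ψ, so it differs from ψ z by at most the oscillation 2C.
    -- The resulting bound 3C is crude but uniform in n, which is all that dominated convergence
    -- asks.
    have h1 : dist (((η n).normed volume ⋆[ContinuousLinearMap.lsmul ℝ ℝ, volume] ψ) z) (ψ z) ≤ 2 * C :=
      (η n).dist_normed_convolution_le (μ := volume) hcont.aestronglyMeasurable fun y _ => by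
        rw [dist_eq_norm]
        refine (norm_sub_le _ _).trans ?_
        linarith [hψ y, hψ z]
    rw [dist_eq_norm] at h1
    have h2 := norm_sub_norm_le (((η n).normed volume ⋆[ContinuousLinearMap.lsmul ℝ ℝ, volume] ψ) z) (ψ z)
    linarith [hψ z]
  have hli : LocallyIntegrable φ volume := hφ.continuous.locallyIntegrable
  have hsm : ∀ n, ContDiff ℝ ((⊤ : ℕ∞) : WithTop ℕ∞) (φn n) := fun n =>
    (η n).hasCompactSupport_normed.contDiff_convolution_left _ ((η n).contDiff_normed) hli
  have htest : ∀ n, IsTestFunction (φn n) := fun n =>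
    ⟨hsm n, HasCompactSupport.intro hK (hzero φ subset_rfl n)⟩
  have hfd : ∀ n z, fderiv ℝ (φn n) z =
      ((η n).normed volume ⋆[ContinuousLinearMap.lsmul ℝ ℝ, volume] (fderiv ℝ φ)) z := by
    intro n z
    have := (hc.hasFDerivAt_convolution_right (ContinuousLinearMap.lsmul ℝ ℝ)
      (((η n).continuous_normed (μ := volume)).locallyIntegrable (μ := volume)) hφ z).fderiv
    rw [this]
    rfl
  obtain ⟨C, hC⟩ := hφ.continuous.bounded_above_of_compact_support hc
  have hcd : Continuous (fderiv ℝ φ) := hφ.continuous_fderiv one_ne_zero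
  obtain ⟨C', hC'⟩ := hcd.bounded_above_of_compact_support (hc.fderiv (𝕜 := ℝ))
  have l1 : Tendsto (fun n => ∫ z, φn n z • g z) atTop (𝓝 (∫ z, φ z • g z)) :=
    tendsto_integral_smul_of_uniform hK (fun n => (hsm n).continuous)
      (fun n z hz => hzero φ subset_rfl n z hz)
      (fun z => ContDiffBump.convolution_tendsto_right_of_continuous hη hφ.continuous z)
      (hnb φ C hC hφ.continuous) g
  have l2 : Tendsto (fun n => ∫ z, fderiv ℝ (φn n) z u • f z) atTop
      (𝓝 (∫ z, fderiv ℝ φ z u • f z)) := by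
    refine tendsto_integral_smul_of_uniform (C := 3 * C' * ‖u‖) hK
      (fun n => ((hsm n).continuous_fderiv (by simp)).clm_apply continuous_const) ?_ ?_ ?_ f
    · intro n z hz
      rw [hfd, hzero (fderiv ℝ φ) (tsupport_fderiv_subset ℝ) n z hz]; rfl
    · intro z
      simp_rw [hfd]
      exact ((ContinuousLinearMap.apply ℝ ℝ u).continuous.tendsto _).comp
        (ContDiffBump.convolution_tendsto_right_of_continuous hη hcd z)
    · intro n z
      rw [hfd, ← Real.norm_eq_abs]
      refine (ContinuousLinearMap.le_opNorm _ _).trans ?_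
      exact mul_le_mul_of_nonneg_right (hnb _ C' hC' hcd n z) (norm_nonneg _)
  have l3 := l1.neg
  simp_rw [h _ (htest _)] at l2
  exact tendsto_nhds_unique l2 l3

/-- The defining identity of weak derivatives for complex `C¹` test functions. -/
theorem HasWeakDeriv.integral_C1 {d : ℕ} {u : PhaseSpace d} {f g : L2 d}
    (h : HasWeakDeriv u f g) {φ : PhaseSpace d → ℂ} (hφ : ContDiff ℝ 1 φ)
    (hc : HasCompactSupport φ) :
    ∫ z, fderiv ℝ φ z u * f z = - ∫ z, φ z * g z := by
  have c1 : ContDiff ℝ 1 fun z => (φ z).re := Complex.reCLM.contDiff.comp hφ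
  have c2 : ContDiff ℝ 1 fun z => (φ z).im := Complex.imCLM.contDiff.comp hφ
  have s1 : HasCompactSupport fun z => (φ z).re := hc.comp_left (g := Complex.re) rfl
  have s2 : HasCompactSupport fun z => (φ z).im := hc.comp_left (g := Complex.im) rfl
  have d1 : ∀ z, fderiv ℝ (fun z => (φ z).re) z u = (fderiv ℝ φ z u).re := fun z => by
    have := (Complex.reCLM.hasFDerivAt.comp z (hφ.differentiable one_ne_zero z).hasFDerivAt).fderiv
    exact (congrArg (fun L => L u) this).trans rfl
  have d2 : ∀ z, fderiv ℝ (fun z => (φ z).im) z u = (fderiv ℝ φ z u).im := fun z => by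
    have := (Complex.imCLM.hasFDerivAt.comp z (hφ.differentiable one_ne_zero z).hasFDerivAt).fderiv
    exact (congrArg (fun L => L u) this).trans rfl
  have r1 := h.integral_C1_real c1 s1
  have r2 := h.integral_C1_real c2 s2
  have i1 := integrable_smul_L2 ((c1.continuous_fderiv one_ne_zero).clm_apply continuous_const)
    (s1.fderiv_apply (𝕜 := ℝ) u) f
  have i2 := integrable_smul_L2 ((c2.continuous_fderiv one_ne_zero).clm_apply continuous_const)
    (s2.fderiv_apply (𝕜 := ℝ) u) f
  have e1 : ∫ z, fderiv ℝ φ z u * f z = (∫ z, fderiv ℝ (fun z => (φ z).re) z u • f z)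
      + Complex.I * ∫ z, fderiv ℝ (fun z => (φ z).im) z u • f z := by
    rw [← integral_const_mul, ← integral_add i1 (i2.const_mul _)]
    congr 1; ext z
    rw [d1, d2, Complex.real_smul, Complex.real_smul]
    conv_lhs => rw [← Complex.re_add_im (fderiv ℝ φ z u)]
    ring
  have e2 : ∫ z, φ z * g z = (∫ z, (φ z).re • g z) + Complex.I * ∫ z, (φ z).im • g z := by
    rw [← integral_const_mul, ← integral_add (integrable_smul_L2 c1.continuous s1 g)
      ((integrable_smul_L2 c2.continuous s2 g).const_mul _)]
    congr 1; ext z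
    rw [Complex.real_smul, Complex.real_smul]
    conv_lhs => rw [← Complex.re_add_im (φ z)]
    ring
  rw [e1, e2, r1, r2]; ring

/-- Integration against a test function, as a continuous linear map. -/
def testPairing {d : ℕ} {φ : PhaseSpace d → ℝ} (hφ : IsTestFunction φ) : L2 d →L[ℝ] ℂ :=
  LinearMap.mkContinuous
    ⟨⟨fun f : L2 d => ∫ z, φ z • f z, fun f g => by
      rw [← integral_add (hφ.integrable_smul f) (hφ.integrable_smul g)]
      refine integral_congr_ae ?_
      filter_upwards [Lp.coeFn_add f g] with z hz
      rw [hz, Pi.add_apply, smul_add]⟩, fun c f => by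
      simp only [RingHom.id_apply]
      rw [← integral_smul]
      refine integral_congr_ae ?_
      filter_upwards [Lp.coeFn_smul c f] with z hz
      rw [hz, Pi.smul_apply, smul_comm]⟩ (l2norm φ) (fun f => norm_integral_smul_le hφ.memLp f)

theorem testPairing_apply {d : ℕ} {φ : PhaseSpace d → ℝ} (hφ : IsTestFunction φ) (f : L2 d) :
    testPairing hφ f = ∫ z, φ z • f z := rfl

theorem tendsto_integral_smul {d : ℕ} {ι : Type*} {l : Filter ι} {φ : PhaseSpace d → ℝ}
    (hφ : Continuous φ) (hc : HasCompactSupport φ) {f : ι → L2 d} {g : L2 d}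
    (h : Tendsto f l (𝓝 g)) :
    Tendsto (fun i => ∫ z, φ z • f i z) l (𝓝 (∫ z, φ z • g z)) := by
  rw [tendsto_iff_norm_sub_tendsto_zero] at h ⊢
  have hm : MemLp φ 2 volume := hφ.memLp_of_hasCompactSupport hc
  refine squeeze_zero (fun _ => norm_nonneg _) (fun i => ?_)
    (by simpa using h.const_mul (l2norm φ))
  rw [← integral_smul_sub hφ hc]
  exact norm_integral_smul_le hm _

theorem continuous_integral_smul {d : ℕ} {φ : PhaseSpace d → ℝ}
    (hφ : Continuous φ) (hc : HasCompactSupport φ) :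
    Continuous fun f : L2 d => ∫ z, φ z • f z :=
  continuous_iff_continuousAt.2 fun _ => tendsto_integral_smul hφ hc tendsto_id

/-! ### The Sobolev space: completeness, measurability, weak compactness. -/

/-- Each instance of the weak derivative identity equates two functionals continuous on the ambient
product, so the graph is an intersection of closed sets. -/
theorem isClosed_sobolevGraph (d : ℕ) : IsClosed (sobolevGraph d : Set
    (WithLp 2 (L2 d × PiLp 2 fun _ : Fin d ⊕ Fin d => L2 d))) := by
  have : (sobolevGraph d : Set (WithLp 2 (L2 d × PiLp 2 fun _ : Fin d ⊕ Fin d => L2 d))) =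
      ⋂ (j) (φ : PhaseSpace d → ℝ) (_ : IsTestFunction φ),
        {p | ∫ z, fderiv ℝ φ z (coordDir d j) • p.fst z = - ∫ z, φ z • (p.snd j) z} := by
    ext p
    simp only [Set.mem_iInter, Set.mem_ofPred_eq]
    rfl
  rw [this]
  refine isClosed_iInter fun j => isClosed_iInter fun φ => isClosed_iInter fun hφ => ?_
  refine isClosed_eq ?_ ?_
  · exact (continuous_integral_smul ((hφ.smooth.continuous_fderiv (by simp)).clm_apply
      continuous_const) (hφ.compact.fderiv_apply (𝕜 := ℝ) _)).comp
      (continuous_fst.comp (WithLp.prod_continuous_ofLp 2 _ _))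
  · refine ((continuous_integral_smul hφ.smooth.continuous hφ.compact).comp ?_).neg
    exact (continuous_apply j).comp ((PiLp.continuous_ofLp 2 _).comp
      (continuous_snd.comp (WithLp.prod_continuous_ofLp 2 _ _)))

instance W12.instCompleteSpace (d : ℕ) : CompleteSpace (W12 d) :=
  (isClosed_sobolevGraph d).completeSpace_coe

namespace W12

variable {d : ℕ}

/-- The weak partial derivative of `a` in the `j`-th coordinate direction. -/
def deriv (a : W12 d) (j : Fin d ⊕ Fin d) : L2 d := a.1.snd j

theorem hasWeakDeriv (a : W12 d) (j : Fin d ⊕ Fin d) :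
    HasWeakDeriv (coordDir d j) a.toL2 (a.deriv j) := a.2 j

/-- The element of `W^{1,2}` with given weak derivatives. -/
def ofWeak (f : L2 d) (g : Fin d ⊕ Fin d → L2 d)
    (h : ∀ j, HasWeakDeriv (coordDir d j) f (g j)) : W12 d :=
  ⟨WithLp.toLp 2 (f, WithLp.toLp 2 g), h⟩

@[simp] theorem toL2_ofWeak (f : L2 d) (g : Fin d ⊕ Fin d → L2 d) (h) :
    (ofWeak f g h).toL2 = f := rfl

@[simp] theorem deriv_ofWeak (f : L2 d) (g : Fin d ⊕ Fin d → L2 d) (h) (j) :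
    (ofWeak f g h).deriv j = g j := rfl

@[simp] theorem toL2_sub (a b : W12 d) : (a - b).toL2 = a.toL2 - b.toL2 := rfl
@[simp] theorem deriv_sub (a b : W12 d) (j) : (a - b).deriv j = a.deriv j - b.deriv j := rfl

theorem norm_sq (a : W12 d) : ‖a‖ ^ 2 = ‖a.toL2‖ ^ 2 + ∑ j, ‖a.deriv j‖ ^ 2 := by
  have h1 : ‖a‖ ^ 2 = ‖a.1.fst‖ ^ 2 + ‖a.1.snd‖ ^ 2 := WithLp.prod_norm_sq_eq_of_L2 a.1
  rw [h1, PiLp.norm_sq_eq_of_L2]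
  rfl

theorem norm_toL2_le (a : W12 d) : ‖a.toL2‖ ≤ ‖a‖ := by
  refine le_of_sq_le_sq ?_ (norm_nonneg _)
  rw [norm_sq]
  have : 0 ≤ ∑ j, ‖a.deriv j‖ ^ 2 := Finset.sum_nonneg fun j _ => sq_nonneg _
  linarith

theorem norm_deriv_le (a : W12 d) (j) : ‖a.deriv j‖ ≤ ‖a‖ := by
  refine le_of_sq_le_sq ?_ (norm_nonneg _)
  rw [norm_sq]
  have : ‖a.deriv j‖ ^ 2 ≤ ∑ j, ‖a.deriv j‖ ^ 2 :=
    Finset.single_le_sum (f := fun j => ‖a.deriv j‖ ^ 2) (fun j _ => sq_nonneg _) (Finset.mem_univ j)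
  nlinarith [sq_nonneg ‖a.toL2‖]

theorem norm_dx_le (a : W12 d) (i) : ‖a.dx i‖ ≤ ‖a‖ := a.norm_deriv_le _
theorem norm_dv_le (a : W12 d) (i) : ‖a.dv i‖ ≤ ‖a‖ := a.norm_deriv_le _

/-- Comparison of Sobolev norms from comparison of the components. -/
theorem norm_le_of_components {a b : W12 d} {c : ℝ} (hc : 0 ≤ c) (h0 : ‖b.toL2‖ ≤ ‖a.toL2‖)
    (h : ∀ j, ‖b.deriv j‖ ≤ ‖a.deriv j‖ + c * ‖a‖) : ‖b‖ ≤ (1 + (2 * d + 1) * c) * ‖a‖ := by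
  refine le_of_sq_le_sq ?_ (by positivity)
  rw [norm_sq]
  have hA := norm_nonneg a
  have h1 : ∑ j, ‖b.deriv j‖ ^ 2 ≤
      ∑ j, (‖a.deriv j‖ ^ 2 + 2 * c * ‖a‖ ^ 2 + c ^ 2 * ‖a‖ ^ 2) := by
    refine Finset.sum_le_sum fun j _ => ?_
    have h2 := pow_le_pow_left₀ (norm_nonneg _) (h j) 2
    have h3 := a.norm_deriv_le j
    nlinarith [mul_le_mul_of_nonneg_left h3 (mul_nonneg hc hA)]
  rw [Finset.sum_add_distrib, Finset.sum_add_distrib, Finset.sum_const, Finset.sum_const] at h1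
  have hcard : (Finset.univ : Finset (Fin d ⊕ Fin d)).card = 2 * d := by simp; ring
  rw [hcard, nsmul_eq_mul, nsmul_eq_mul] at h1
  push_cast at h1
  have h4 := norm_sq a
  have h5 := pow_le_pow_left₀ (norm_nonneg _) h0 2
  have hd : (0 : ℝ) ≤ d := Nat.cast_nonneg d
  -- The square contains the 2d cross terms and the 2d terms in c² produced by the sum over
  -- directions; what is left over is nonnegative.
  have e : ((1 + (2 * d + 1) * c) * ‖a‖) ^ 2 = ‖a‖ ^ 2 + (2 * d) * (2 * c * ‖a‖ ^ 2)
      + (2 * d) * (c ^ 2 * ‖a‖ ^ 2) + 2 * c * ‖a‖ ^ 2 + (4 * d ^ 2 + 2 * d + 1) * c ^ 2 * ‖a‖ ^ 2 := by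
    ring
  rw [e]
  have : 0 ≤ 2 * c * ‖a‖ ^ 2 + (4 * d ^ 2 + 2 * d + 1) * c ^ 2 * ‖a‖ ^ 2 := by positivity
  linarith

/-- The inclusion of `W^{1,2}` into `L²` as a continuous linear map. -/
def toL2L (d : ℕ) : W12 d →L[ℂ] L2 d :=
  LinearMap.mkContinuous ⟨⟨toL2, fun _ _ => rfl⟩, fun _ _ => rfl⟩ 1
    fun a => by rw [one_mul]; exact a.norm_toL2_le

/-- The weak derivative as a continuous linear map. -/
def derivL (j : Fin d ⊕ Fin d) : W12 d →L[ℂ] L2 d :=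
  LinearMap.mkContinuous ⟨⟨fun a => a.deriv j, fun _ _ => rfl⟩, fun _ _ => rfl⟩ 1
    fun a => by rw [one_mul]; exact a.norm_deriv_le j

theorem continuous_toL2 : Continuous (toL2 : W12 d → L2 d) := (toL2L d).continuous

theorem continuous_deriv (j) : Continuous fun a : W12 d => a.deriv j := (derivL j).continuous

theorem ext_components {a b : W12 d} (h : a.toL2 = b.toL2) (h' : ∀ j, a.deriv j = b.deriv j) :
    a = b := by
  rw [← sub_eq_zero, ← norm_eq_zero, ← sq_eq_zero_iff, norm_sq]
  simp [h, h']

/-- Uniqueness of weak derivatives. It allows identities and measurability in W^{1,2} to be checked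
in L². -/
theorem toL2_injective : Function.Injective (toL2 : W12 d → L2 d) := fun a b h =>
  ext_components h fun j => HasWeakDeriv.unique (a.hasWeakDeriv j) (h ▸ b.hasWeakDeriv j)

end W12

/-- Separability is used to pass between Borel and strong measurability, and to have Polish spaces
at hand in `W12.aestronglyMeasurable_of_toL2`. -/
instance L2.instSecondCountableTopology (d : ℕ) : SecondCountableTopology (L2 d) :=
  haveI : Fact ((2 : ENNReal) ≠ ⊤) := ⟨by norm_num⟩
  haveI : IsSeparable (volume : Measure (PhaseSpace d)) :=
    isSeparable_of_sigmaFinite _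
  Lp.SecondCountableTopology

instance W12.instSecondCountableTopology (d : ℕ) : SecondCountableTopology (W12 d) := by
  have : SecondCountableTopology (PiLp 2 fun _ : Fin d ⊕ Fin d => L2 d) :=
    (PiLp.homeomorph 2 (fun _ : Fin d ⊕ Fin d => L2 d)).isInducing.secondCountableTopology
  have : SecondCountableTopology (WithLp 2 (L2 d × PiLp 2 fun _ : Fin d ⊕ Fin d => L2 d)) :=
    (WithLp.homeomorphProd 2 (L2 d) (PiLp 2 fun _ : Fin d ⊕ Fin d => L2 d)).isInducing.secondCountableTopology
  exact TopologicalSpace.Subtype.secondCountableTopology _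

/-- A `W^{1,2}`-valued map is measurable as soon as it is measurable into `L²`. -/
theorem W12.aestronglyMeasurable_of_toL2 {d : ℕ} {X : Type*} [MeasurableSpace X] {μ : Measure X}
    {α : X → W12 d} (h : AEStronglyMeasurable (fun t => (α t).toL2) μ) :
    AEStronglyMeasurable α μ := by
  borelize (W12 d)
  borelize (L2 d)
  -- Lusin–Souslin: a continuous injection of Polish spaces is a Borel embedding, so measurability
  -- is reflected along the inclusion into L².
  have he : MeasurableEmbedding (W12.toL2 : W12 d → L2 d) :=
    W12.continuous_toL2.measurableEmbedding W12.toL2_injective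
  exact (he.aemeasurable_comp_iff.1 h.aemeasurable).aestronglyMeasurable

/-- Images of bounded sets under continuous linear maps of Hilbert spaces are closed under
sequential limits. -/
theorem exists_norm_le_of_tendsto_map {H K : Type*} [NormedAddCommGroup H] [InnerProductSpace ℂ H]
    [CompleteSpace H] [NormedAddCommGroup K] [InnerProductSpace ℂ K] [CompleteSpace K]
    (T : H →L[ℂ] K) {a : ℕ → H} {M : ℝ} (hM : ∀ n, ‖a n‖ ≤ M) {f : K}
    (h : Tendsto (fun n => T (a n)) atTop (𝓝 f)) : ∃ p : H, T p = f ∧ ‖p‖ ≤ M := by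
  -- Banach–Alaoglu through the Riesz isomorphism: along an ultrafilter finer than `atTop` the
  -- bounded sequence converges weakly, and the limit stays in the same closed ball.
  let ξ : ℕ → WeakDual ℂ H := fun n =>
    StrongDual.toWeakDual (InnerProductSpace.toDual ℂ H (a n))
  let U : Ultrafilter ℕ := Ultrafilter.of atTop
  have hU : (U : Filter ℕ) ≤ atTop := Ultrafilter.of_le _
  obtain ⟨x, hx, hxl⟩ := (WeakDual.isCompact_closedBall (𝕜 := ℂ) (E := H) 0 M).ultrafilter_le_nhds
    (U.map ξ) (by
      rw [le_principal_iff]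
      refine Eventually.of_forall (f := (U : Filter ℕ)) fun n => ?_
      rw [Set.mem_preimage, mem_closedBall_zero_iff]
      exact (LinearIsometryEquiv.norm_map (InnerProductSpace.toDual ℂ H) (a n)).le.trans (hM n))
  let p := (InnerProductSpace.toDual ℂ H).symm (WeakDual.toStrongDual x)
  have hp : ∀ y, Tendsto (fun n => inner ℂ (a n) y) U (𝓝 (inner ℂ p y)) := by
    intro y
    have h1 : Tendsto ξ U (𝓝 x) := hxl
    have h2 := ((WeakDual.eval_continuous y).tendsto x).comp h1
    have e : inner ℂ p y = x y := by
      rw [← InnerProductSpace.toDual_apply_apply (𝕜 := ℂ)]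
      simp [p]
    rw [e]
    exact h2
  refine ⟨p, ?_, ?_⟩
  -- Testing with the adjoint of T turns weak convergence in H into weak convergence of T (a n),
  -- whose limit must be the strong limit f.
  · refine ext_inner_right ℂ fun g => ?_
    have h1 := hp (ContinuousLinearMap.adjoint T g)
    simp_rw [ContinuousLinearMap.adjoint_inner_right] at h1
    exact tendsto_nhds_unique h1 ((h.inner tendsto_const_nhds).mono_left hU)
  · rw [Set.mem_preimage, mem_closedBall_zero_iff] at hx
    exact (LinearIsometryEquiv.norm_map _ _).le.trans hx

/-- Bounded sets of `W^{1,2}` are closed under `L²` limits. -/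
theorem W12.exists_of_tendsto {d : ℕ} {a : ℕ → W12 d} {M : ℝ} (hM : ∀ n, ‖a n‖ ≤ M) {f : L2 d}
    (h : Tendsto (fun n => (a n).toL2) atTop (𝓝 f)) : ∃ p : W12 d, p.toL2 = f ∧ ‖p‖ ≤ M :=
  exists_norm_le_of_tendsto_map (H := W12 d) (K := L2 d) (W12.toL2L d) hM h

/-! ### Multiplication operators -/

/-- Multiplication of an `L²` function by a bounded function (and zero for functions for which
the product is not in `L²`). -/
def mulL2 {d : ℕ} (m : PhaseSpace d → ℂ) (f : L2 d) : L2 d :=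
  open Classical in
  if h : MemLp (fun z => m z * f z) 2 volume then h.toLp _ else 0

theorem coeFn_mulL2 {d : ℕ} {m : PhaseSpace d → ℂ} (hm : Continuous m) {C : ℝ}
    (hC : ∀ z, ‖m z‖ ≤ C) (f : L2 d) : mulL2 m f =ᵐ[volume] fun z => m z * f z := by
  have h : MemLp (fun z => m z * f z) 2 volume :=
    (Lp.memLp f).of_le_mul (c := C) (hm.aestronglyMeasurable.mul (Lp.aestronglyMeasurable f))
      (Eventually.of_forall fun z => by
        rw [norm_mul]; exact mul_le_mul_of_nonneg_right (hC z) (norm_nonneg _))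
  rw [mulL2, dif_pos h]
  exact h.coeFn_toLp

theorem norm_mulL2_le {d : ℕ} {m : PhaseSpace d → ℂ} (hm : Continuous m) {C : ℝ}
    (hC : ∀ z, ‖m z‖ ≤ C) (f : L2 d) : ‖mulL2 m f‖ ≤ C * ‖f‖ := by
  refine Lp.norm_le_mul_norm_of_ae_le_mul ?_
  filter_upwards [coeFn_mulL2 hm hC f] with z hz
  rw [hz, norm_mul]; exact mul_le_mul_of_nonneg_right (hC z) (norm_nonneg _)

/-- The product rule for weak derivatives. -/
theorem HasWeakDeriv.bddMul {d : ℕ} {u : PhaseSpace d} {f g : L2 d} (h : HasWeakDeriv u f g)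
    {m : PhaseSpace d → ℂ} (hm : ContDiff ℝ 1 m) {C C' : ℝ} (hC : ∀ z, ‖m z‖ ≤ C)
    (hC' : ∀ z, ‖fderiv ℝ m z u‖ ≤ C') :
    HasWeakDeriv u (mulL2 m f) (mulL2 m g + mulL2 (fun z => fderiv ℝ m z u) f) := by
  intro φ hφ
  have hdm : Continuous fun z => fderiv ℝ m z u :=
    (hm.continuous_fderiv one_ne_zero).clm_apply continuous_const
  have hφ1 : ContDiff ℝ 1 φ := hφ.smooth.of_le (by exact_mod_cast le_top)
  -- The multiplier is absorbed into the test function. The product is complex and only C¹, hence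
  -- the need for `HasWeakDeriv.integral_C1`.
  let ψ : PhaseSpace d → ℂ := fun z => φ z • m z
  have hψ : ContDiff ℝ 1 ψ := hφ1.smul hm
  have hψc : HasCompactSupport ψ := hφ.compact.smul_right
  have key := h.integral_C1 hψ hψc
  have hd : ∀ z, fderiv ℝ ψ z u = φ z • fderiv ℝ m z u + fderiv ℝ φ z u • m z := fun z => by
    have := fderiv_smul (hφ1.differentiable one_ne_zero z) (hm.differentiable one_ne_zero z)
    have h2 : fderiv ℝ ψ z u = _ := congrArg (fun L => L u) this
    rw [h2]; simp
  have i1 : Integrable fun z => (φ z • fderiv ℝ m z u) * f z :=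
    integrable_mul_L2 (hφ.smooth.continuous.smul hdm) hφ.compact.smul_right f
  have i2 : Integrable fun z => (fderiv ℝ φ z u • m z) * f z :=
    integrable_mul_L2 (((hφ.smooth.continuous_fderiv (by simp)).clm_apply continuous_const).smul
      hm.continuous) (hφ.compact.fderiv_apply (𝕜 := ℝ) u).smul_right f
  have i3 : Integrable fun z => (φ z • m z) * g z :=
    integrable_mul_L2 (hφ.smooth.continuous.smul hm.continuous) hφ.compact.smul_right g
  simp_rw [hd, add_mul] at key
  rw [integral_add i1 i2] at key
  have e1 : ∫ z, fderiv ℝ φ z u • (mulL2 m f) z = ∫ z, (fderiv ℝ φ z u • m z) * f z := by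
    refine integral_congr_ae ?_
    filter_upwards [coeFn_mulL2 hm.continuous hC f] with z hz
    rw [hz, smul_mul_assoc]
  have e2 : ∫ z, φ z • (mulL2 m g + mulL2 (fun z => fderiv ℝ m z u) f : L2 d) z =
      ∫ z, ((φ z • m z) * g z + (φ z • fderiv ℝ m z u) * f z) := by
    refine integral_congr_ae ?_
    filter_upwards [coeFn_mulL2 hm.continuous hC g, coeFn_mulL2 hdm hC' f,
      Lp.coeFn_add (mulL2 m g) (mulL2 (fun z => fderiv ℝ m z u) f)] with z h1 h2 h3
    rw [h3, Pi.add_apply, h1, h2, smul_add, smul_mul_assoc, smul_mul_assoc]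
  rw [e1, e2, integral_add i3 i1]
  linear_combination key

/-! ### Translations and integration by parts -/

/-- Differentiation under the integral against an `L²` function. -/
theorem hasDerivAt_integral_mul {d : ℕ} {Ψ Ψ' : ℝ → PhaseSpace d → ℂ} {s₀ : ℝ}
    {K : Set (PhaseSpace d)} (hK : IsCompact K)
    (hΨ : ∀ s, Continuous (Ψ s)) (hΨ' : Continuous (Function.uncurry Ψ'))
    (hd : ∀ s z, HasDerivAt (fun s => Ψ s z) (Ψ' s z) s)
    (hs : ∀ s ∈ Metric.ball s₀ 1, ∀ z, z ∉ K → Ψ s z = 0) (f : L2 d) :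
    HasDerivAt (fun s => ∫ z, Ψ s z * f z) (∫ z, Ψ' s₀ z * f z) s₀ := by
  have hs' : ∀ s ∈ Metric.ball s₀ 1, ∀ z, z ∉ K → Ψ' s z = 0 := by
    intro s hs1 z hz
    have h0 : HasDerivAt (fun s => Ψ s z) 0 s := by
      refine (hasDerivAt_const s (0 : ℂ)).congr_of_eventuallyEq ?_
      filter_upwards [Metric.isOpen_ball.mem_nhds hs1] with r hr
      exact hs r hr z hz
    exact (hd s z).unique h0
  obtain ⟨C, hC⟩ := ((isCompact_closedBall s₀ 1).prod hK).exists_bound_of_continuousOn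
    hΨ'.continuousOn
  have hf : IntegrableOn (fun z => f z) K :=
    ((Lp.memLp f).locallyIntegrable (by norm_num)).integrableOn_isCompact hK
  refine (hasDerivAt_integral_of_dominated_loc_of_deriv_le (μ := volume)
    (F := fun s z => Ψ s z * f z) (F' := fun s z => Ψ' s z * f z)
    (bound := K.indicator fun z => C * ‖f z‖) (s := Metric.ball s₀ 1)
    (Metric.ball_mem_nhds s₀ one_pos) ?_ ?_ ?_ ?_ ?_ ?_).2
  · exact Eventually.of_forall fun s =>
      (hΨ s).aestronglyMeasurable.mul (Lp.aestronglyMeasurable f)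
  · refine integrable_mul_L2 (hΨ s₀) (HasCompactSupport.intro hK fun z hz => hs s₀ (Metric.mem_ball_self one_pos) z hz) f
  · exact ((hΨ'.comp (by fun_prop : Continuous fun z : PhaseSpace d => (s₀, z))).aestronglyMeasurable).mul
      (Lp.aestronglyMeasurable f)
  · filter_upwards with z s hs1
    by_cases hz : z ∈ K
    · rw [Set.indicator_of_mem hz, norm_mul]
      exact mul_le_mul_of_nonneg_right (hC (s, z) ⟨Metric.ball_subset_closedBall hs1, hz⟩)
        (norm_nonneg _)
    · rw [hs' s hs1 z hz, Set.indicator_of_notMem hz]; simp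
  · exact (integrable_indicator_iff hK.measurableSet).2 (hf.norm.const_mul C)
  · filter_upwards with z s _
    exact (hd s z).mul_const _

/-- Translation of `L²` functions. -/
def translL2 {d : ℕ} (h : PhaseSpace d) (f : L2 d) : L2 d :=
  Lp.compMeasurePreserving (fun z => z + h) (measurePreserving_add_right volume h) f

theorem coeFn_translL2 {d : ℕ} (h : PhaseSpace d) (f : L2 d) :
    translL2 h f =ᵐ[volume] fun z => f (z + h) :=
  Lp.coeFn_compMeasurePreserving f (measurePreserving_add_right volume h)

theorem continuous_translL2 {d : ℕ} (u : PhaseSpace d) (f : L2 d) :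
    Continuous fun s : ℝ => translL2 (s • u) f := by
  let g : ℝ → C(PhaseSpace d, PhaseSpace d) := fun s => ⟨fun z => z + s • u, by fun_prop⟩
  have hg : Continuous g := ContinuousMap.continuous_of_continuous_uncurry _ (by
    change Continuous fun p : ℝ × PhaseSpace d => p.2 + p.1 • u
    fun_prop)
  exact Continuous.compMeasurePreservingLp (μ := volume) (ν := volume) (p := 2) (f := fun _ : ℝ => f)
    (g := g) continuous_const hg (fun s => measurePreserving_add_right volume (s • u)) (by norm_num)

theorem integral_smul_translL2 {d : ℕ} (φ : PhaseSpace d → ℝ) (h : PhaseSpace d) (f : L2 d) :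
    ∫ z, φ z • translL2 h f z = ∫ z, (φ (z - h) : ℂ) * f z := by
  have e1 : ∫ z, φ z • translL2 h f z = ∫ z, (φ ((z + h) - h) : ℂ) * f (z + h) := by
    refine integral_congr_ae ?_
    filter_upwards [coeFn_translL2 h f] with z hz
    rw [hz, add_sub_cancel_right, Complex.real_smul]
  rw [e1]
  exact integral_add_right_eq_self (μ := volume) (fun z => (φ (z - h) : ℂ) * f z) h

/-- After pairing with φ the translation sits on φ, where it can be differentiated classically in
the translation parameter. The weak derivative identity converts that derivative into the pairing
with the translate of g, and the fundamental theorem of calculus concludes. -/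
theorem HasWeakDeriv.translL2_sub {d : ℕ} {u : PhaseSpace d} {f g : L2 d}
    (h : HasWeakDeriv u f g) (s : ℝ) :
    translL2 (s • u) f - translL2 ((0 : ℝ) • u) f = ∫ σ in (0 : ℝ)..s, translL2 (σ • u) g := by
  refine eq_of_test fun φ hφ => ?_
  rw [integral_smul_sub hφ.smooth.continuous hφ.compact]
  have hφ1 : ContDiff ℝ 1 φ := hφ.smooth.of_le (by exact_mod_cast le_top)
  have hcont := continuous_translL2 u g
  have e1 : ∫ z, φ z • (∫ σ in (0 : ℝ)..s, translL2 (σ • u) g : L2 d) z =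
      ∫ σ in (0 : ℝ)..s, ∫ z, φ z • translL2 (σ • u) g z := by
    exact ((testPairing hφ).intervalIntegral_comp_comm (hcont.intervalIntegrable 0 s)).symm
  rw [e1]
  have hder : ∀ r, HasDerivAt (fun r : ℝ => ∫ z, φ z • translL2 (r • u) f z)
      (∫ z, φ z • translL2 (r • u) g z) r := by
    intro r
    simp_rw [integral_smul_translL2]
    -- For parameters within distance 1 of r the shift has length at most (|r| + 1)‖u‖, so this set
    -- contains all the shifted supports.
    let K : Set (PhaseSpace d) := Metric.cthickening ((|r| + 1) * ‖u‖) (tsupport φ)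
    have hK : IsCompact K := hφ.compact.isCompact.cthickening
    have hd : ∀ (s : ℝ) (z : PhaseSpace d), HasDerivAt (fun s : ℝ => (φ (z - s • u) : ℂ))
        ((-(fderiv ℝ φ (z - s • u) u) : ℝ) : ℂ) s := by
      intro s z
      have h1 : HasDerivAt (fun s : ℝ => z - s • u) (-u) s := by
        simpa using ((hasDerivAt_id s).smul_const u).const_sub z
      have h2 := ((hφ1.differentiable one_ne_zero (z - s • u)).hasFDerivAt.comp_hasDerivAt s h1)
      rw [map_neg] at h2
      exact h2.ofReal_comp
    have := hasDerivAt_integral_mul (s₀ := r) hK (Ψ := fun s z => (φ (z - s • u) : ℂ))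
      (fun s => Complex.continuous_ofReal.comp (hφ1.continuous.comp (by fun_prop)))
      (Ψ' := fun s z => ((-(fderiv ℝ φ (z - s • u) u) : ℝ) : ℂ))
      (Complex.continuous_ofReal.comp
        (((hφ1.continuous_fderiv one_ne_zero).comp (by fun_prop :
          Continuous fun p : ℝ × PhaseSpace d => p.2 - p.1 • u)).clm_apply continuous_const).neg)
      hd ?_ f
    · convert this using 1
      have h3 := h.integral_C1 (φ := fun z => (φ (z - r • u) : ℂ))
        (Complex.ofRealCLM.contDiff.comp (hφ1.comp (contDiff_id.sub contDiff_const)))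
        (by
          refine HasCompactSupport.comp_left (g := fun x : ℝ => (x : ℂ)) ?_ rfl
          exact hφ.compact.comp_homeomorph (Homeomorph.subRight (r • u)))
      rw [eq_comm, neg_eq_iff_eq_neg] at h3
      rw [h3, ← integral_neg]
      congr 1; ext z
      have h4 : fderiv ℝ (fun z => (φ (z - r • u) : ℂ)) z u = (fderiv ℝ φ (z - r • u) u : ℂ) := by
        have h5 : HasFDerivAt (fun z : PhaseSpace d => z - r • u) (ContinuousLinearMap.id ℝ _) z :=
          (hasFDerivAt_id z).sub_const _
        have h6 := (Complex.ofRealCLM.hasFDerivAt.comp z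
          ((hφ1.differentiable one_ne_zero (z - r • u)).hasFDerivAt.comp z h5)).fderiv
        exact (congrArg (fun L => L u) h6).trans rfl
      rw [h4]; push_cast; ring
    · intro s hs z hz
      have : φ (z - s • u) = 0 := by
        by_contra hne
        refine hz (Metric.mem_cthickening_of_dist_le z (z - s • u) _ _ (subset_tsupport _ hne) ?_)
        rw [dist_eq_norm, sub_sub_cancel, norm_smul]
        refine mul_le_mul_of_nonneg_right ?_ (norm_nonneg _)
        rw [Metric.mem_ball, Real.dist_eq] at hs
        rw [Real.norm_eq_abs]
        linarith [abs_sub_abs_le_abs_sub s r]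
      simp [this]
  rw [intervalIntegral.integral_eq_sub_of_hasDerivAt (fun r _ => hder r)]
  refine Continuous.intervalIntegrable ?_ _ _
  exact (continuous_integral_smul hφ.smooth.continuous hφ.compact).comp hcont

theorem translL2_zero {d : ℕ} (f : L2 d) : translL2 0 f = f := by
  refine Lp.ext ?_
  filter_upwards [coeFn_translL2 0 f] with z hz
  rw [hz, add_zero]

/-- The orbit of f under translations is, by `HasWeakDeriv.translL2_sub`, the primitive of the
continuous orbit of g. Thus weak derivatives are strong derivatives of the translation group. -/
theorem HasWeakDeriv.hasDerivAt_translL2 {d : ℕ} {u : PhaseSpace d} {f g : L2 d}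
    (h : HasWeakDeriv u f g) : HasDerivAt (fun s : ℝ => translL2 (s • u) f) g 0 := by
  have h1 : (fun s : ℝ => translL2 (s • u) f) =
      fun s => f + ∫ σ in (0 : ℝ)..s, translL2 (σ • u) g := by
    ext1 s
    rw [← h.translL2_sub s, zero_smul, translL2_zero]; abel
  rw [h1]
  have hc := continuous_translL2 u g
  have := intervalIntegral.integral_hasDerivAt_right (hc.intervalIntegrable 0 0)
    (hc.stronglyMeasurableAtFilter _ _) hc.continuousAt
  rw [zero_smul, translL2_zero] at this
  exact this.const_add f

/-- Weak derivatives are skew-adjoint. -/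
theorem HasWeakDeriv.inner_eq_neg {d : ℕ} {u : PhaseSpace d} {f f' g g' : L2 d}
    (hf : HasWeakDeriv u f f') (hg : HasWeakDeriv u g g') :
    inner ℂ f g' = - inner ℂ f' g := by
  have h1 := hf.hasDerivAt_translL2.inner ℂ hg.hasDerivAt_translL2
  -- Translations are isometries, so the inner product of the two orbits is constant and the product
  -- rule at s = 0 gives the identity.
  have h2 : (fun s : ℝ => inner ℂ (translL2 (s • u) f) (translL2 (s • u) g)) =
      fun _ => inner ℂ f g := by
    ext s
    exact (Lp.compMeasurePreservingₗᵢ (E := ℂ) (p := 2) ℂ (fun z => z + s • u)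
      (measurePreserving_add_right volume (s • u))).inner_map_map f g
  simp only [zero_smul, translL2_zero] at h1
  rw [h2] at h1
  have h3 := h1.unique (hasDerivAt_const (0 : ℝ) (inner ℂ f g))
  exact eq_neg_of_add_eq_zero_left h3

/-! ### Composition with volume preserving shears -/

/-- Composition of an `L²` function with a volume preserving map. -/
def compL2 {d : ℕ} {Φ : PhaseSpace d → PhaseSpace d} (hΦ : MeasurePreserving Φ volume volume)
    (f : L2 d) : L2 d := Lp.compMeasurePreserving Φ hΦ f

theorem coeFn_compL2 {d : ℕ} {Φ : PhaseSpace d → PhaseSpace d}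
    (hΦ : MeasurePreserving Φ volume volume) (f : L2 d) :
    compL2 hΦ f =ᵐ[volume] fun z => f (Φ z) := Lp.coeFn_compMeasurePreserving f hΦ

@[simp] theorem norm_compL2 {d : ℕ} {Φ : PhaseSpace d → PhaseSpace d}
    (hΦ : MeasurePreserving Φ volume volume) (f : L2 d) : ‖compL2 hΦ f‖ = ‖f‖ :=
  Lp.norm_compMeasurePreserving f hΦ

theorem fderiv_ofReal_apply {E : Type*} [NormedAddCommGroup E] [NormedSpace ℝ E] {ψ : E → ℝ} {z : E}
    (h : DifferentiableAt ℝ ψ z) (u : E) :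
    fderiv ℝ (fun z => (ψ z : ℂ)) z u = (fderiv ℝ ψ z u : ℂ) := by
  have h6 := (Complex.ofRealCLM.hasFDerivAt.comp z h.hasFDerivAt).fderiv
  exact (congrArg (fun L => L u) h6).trans rfl

/-- The chain rule for weak derivatives under volume preserving `C¹` diffeomorphisms. -/
theorem HasWeakDeriv.comp {d : ℕ} {f : L2 d} {g : Fin d ⊕ Fin d → L2 d}
    (hf : ∀ j, HasWeakDeriv (coordDir d j) f (g j)) {Φ Φ' : PhaseSpace d → PhaseSpace d}
    (hΦ : ContDiff ℝ 1 Φ) (hΦ' : ContDiff ℝ 1 Φ') (hl : ∀ z, Φ' (Φ z) = z)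
    (hr : ∀ z, Φ (Φ' z) = z) (hmp : MeasurePreserving Φ volume volume) (u : PhaseSpace d)
    {c : Fin d ⊕ Fin d → PhaseSpace d → ℝ} (hc : ∀ j, ContDiff ℝ 1 (c j))
    (hc0 : ∀ j z, fderiv ℝ (c j) z (coordDir d j) = 0) {C : ℝ} (hcb : ∀ j z, |c j z| ≤ C)
    (hu : ∀ z, fderiv ℝ Φ z u = ∑ j, c j (Φ z) • coordDir d j) :
    HasWeakDeriv u (compL2 hmp f) (compL2 hmp (∑ j, mulL2 (fun z => (c j z : ℂ)) (g j))) := by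
  intro φ hφ
  have hφ1 : ContDiff ℝ 1 φ := hφ.smooth.of_le (by exact_mod_cast le_top)
  let e : PhaseSpace d ≃ₜ PhaseSpace d := ⟨⟨Φ, Φ', hl, hr⟩, hΦ.continuous, hΦ'.continuous⟩
  have hemb : MeasurableEmbedding Φ := e.measurableEmbedding
  -- The change of variables moves the diffeomorphism from f to the test function. The coefficients
  -- of the Jacobian are accordingly expressed at the image point.
  let ψ : PhaseSpace d → ℝ := φ ∘ Φ'
  have hψ : ContDiff ℝ 1 ψ := hφ1.comp hΦ'
  have hψc : HasCompactSupport ψ := hφ.compact.comp_homeomorph e.symm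
  have hψd : Differentiable ℝ ψ := hψ.differentiable one_ne_zero
  have hφψ : ∀ z, fderiv ℝ φ z u = ∑ j, c j (Φ z) * fderiv ℝ ψ (Φ z) (coordDir d j) := by
    intro z
    have h1 : φ = ψ ∘ Φ := by ext z; simp [ψ, hl]
    have h2 : fderiv ℝ φ z = (fderiv ℝ ψ (Φ z)).comp (fderiv ℝ Φ z) := by
      rw [h1]
      exact fderiv_comp z (hψd _) (hΦ.differentiable one_ne_zero z)
    rw [h2, ContinuousLinearMap.comp_apply, hu, map_sum]
    simp
  have e1 : ∫ z, fderiv ℝ φ z u • compL2 hmp f z =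
      ∫ z, (∑ j, c j z * fderiv ℝ ψ z (coordDir d j)) • f z := by
    rw [← hmp.integral_comp hemb fun z => (∑ j, c j z * fderiv ℝ ψ z (coordDir d j)) • f z]
    refine integral_congr_ae ?_
    filter_upwards [coeFn_compL2 hmp f] with z hz
    rw [hz, hφψ]
  have hsum : (∑ j, mulL2 (fun z => (c j z : ℂ)) (g j) : L2 d) =ᵐ[volume]
      fun z => ∑ j, (c j z : ℂ) * g j z := by
    have h1 := Lp.coeFn_finsetSum Finset.univ (fun j => mulL2 (fun z => (c j z : ℂ)) (g j))
    have h2 : ∀ᵐ z, ∀ j, mulL2 (fun z => (c j z : ℂ)) (g j) z = (c j z : ℂ) * g j z := by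
      rw [ae_all_iff]
      exact fun j => coeFn_mulL2 (m := fun z => (c j z : ℂ)) (Complex.continuous_ofReal.comp (hc j).continuous) (C := C)
        (fun z => by rw [Complex.norm_real]; exact hcb j z) _
    filter_upwards [h1, h2] with z h1 h2
    rw [h1, Finset.sum_apply]
    exact Finset.sum_congr rfl fun j _ => h2 j
  have e2 : ∫ z, φ z • compL2 hmp (∑ j, mulL2 (fun z => (c j z : ℂ)) (g j)) z =
      ∫ z, ψ z • ∑ j, (c j z : ℂ) * g j z := by
    rw [← hmp.integral_comp hemb fun z => ψ z • ∑ j, (c j z : ℂ) * g j z]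
    refine integral_congr_ae ?_
    filter_upwards [coeFn_compL2 hmp (∑ j, mulL2 (fun z => (c j z : ℂ)) (g j)),
      hmp.quasiMeasurePreserving.ae hsum] with z hz hz2
    rw [hz, hz2]
    simp [ψ, hl]
  -- As c j does not vary in its own direction j, it can be drawn inside the derivative and
  -- integration by parts leaves no zeroth order term.
  have hd : ∀ j z, fderiv ℝ (fun z => c j z * ψ z) z (coordDir d j) =
      c j z * fderiv ℝ ψ z (coordDir d j) := by
    intro j z
    have := fderiv_fun_mul ((hc j).differentiable one_ne_zero z) (hψd z)
    rw [this]
    simp [hc0 j z]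
  have key : ∀ j, ∫ z, (c j z * fderiv ℝ ψ z (coordDir d j)) • f z =
      - ∫ z, (c j z * ψ z) • g j z := by
    intro j
    rw [← (hf j).integral_C1_real ((hc j).mul hψ) hψc.mul_left]
    congr 1; ext z
    rw [hd j z]
  have i1 : ∀ j, Integrable fun z => (c j z * fderiv ℝ ψ z (coordDir d j)) • f z := fun j =>
    integrable_smul_L2 ((hc j).continuous.mul ((hψ.continuous_fderiv one_ne_zero).clm_apply
      continuous_const)) (hψc.fderiv_apply (𝕜 := ℝ) _).mul_left f
  have i2 : ∀ j, Integrable fun z => (c j z * ψ z) • g j z := fun j =>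
    integrable_smul_L2 ((hc j).continuous.mul hψ.continuous) hψc.mul_left (g j)
  rw [e1, e2]
  simp_rw [Finset.sum_smul, Finset.smul_sum]
  rw [integral_finsetSum _ fun j _ => i1 j]
  have e3 : ∀ z, ∑ j, ψ z • ((c j z : ℂ) * g j z) = ∑ j, (c j z * ψ z) • g j z := fun z =>
    Finset.sum_congr rfl fun j _ => by
      rw [Complex.real_smul, Complex.real_smul]; push_cast; ring
  simp_rw [e3]
  rw [integral_finsetSum _ fun j _ => i2 j, ← Finset.sum_neg_distrib]
  exact Finset.sum_congr rfl fun j _ => key j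

/-- The velocity shear `(x, v) ↦ (x, v + B x)`. -/
def kickMap {d : ℕ} (B : EuclideanSpace ℝ (Fin d) → EuclideanSpace ℝ (Fin d)) (z : PhaseSpace d) :
    PhaseSpace d := (z.1, z.2 + B z.1)

/-- The free flow `(x, v) ↦ (x - s v, v)`. -/
def driftMap {d : ℕ} (s : ℝ) (z : PhaseSpace d) : PhaseSpace d := (z.1 - s • z.2, z.2)

theorem measurePreserving_kickMap {d : ℕ}
    {B : EuclideanSpace ℝ (Fin d) → EuclideanSpace ℝ (Fin d)} (hB : Continuous B) :
    MeasurePreserving (kickMap B) volume volume := by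
  rw [Measure.volume_eq_prod]
  refine (MeasurePreserving.id volume).skew_product (g := fun x v => v + B x) ?_ ?_
  · exact (continuous_snd.add (hB.comp continuous_fst)).measurable
  · exact Eventually.of_forall fun x => (measurePreserving_add_right volume (B x)).map_eq

/-- The drift is a kick with the roles of position and velocity exchanged. -/
theorem measurePreserving_driftMap {d : ℕ} (s : ℝ) :
    MeasurePreserving (driftMap (d := d) s) volume volume := by
  have h := measurePreserving_kickMap (d := d) (B := fun v => -(s • v)) (by fun_prop)
  rw [Measure.volume_eq_prod] at h ⊢
  have h2 := (Measure.measurePreserving_swap.comp h).comp (Measure.measurePreserving_swap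
    (μ := (volume : Measure (EuclideanSpace ℝ (Fin d))))
    (ν := (volume : Measure (EuclideanSpace ℝ (Fin d)))))
  have e : driftMap (d := d) s = (Prod.swap ∘ kickMap fun v => -(s • v)) ∘ Prod.swap := by
    ext1 z
    simp [driftMap, kickMap, sub_eq_add_neg]
  rw [e]
  exact h2

theorem euclidean_eq_sum {d : ℕ} (y : EuclideanSpace ℝ (Fin d)) :
    y = ∑ k, y k • EuclideanSpace.single k (1 : ℝ) := by
  ext i
  simp [Pi.single_apply]

theorem inr_eq_sum {d : ℕ} (y : EuclideanSpace ℝ (Fin d)) :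
    ((0, y) : PhaseSpace d) = ∑ k, y k • coordDir d (Sum.inr k) := by
  conv_lhs => rw [euclidean_eq_sum y]
  rw [Prod.ext_iff]
  simp [coordDir, Prod.fst_sum, Prod.snd_sum]

theorem inl_eq_sum {d : ℕ} (y : EuclideanSpace ℝ (Fin d)) :
    ((y, 0) : PhaseSpace d) = ∑ k, y k • coordDir d (Sum.inl k) := by
  conv_lhs => rw [euclidean_eq_sum y]
  rw [Prod.ext_iff]
  simp [coordDir, Prod.fst_sum, Prod.snd_sum]

theorem fderiv_fst_dep {d : ℕ} {F : Type*} [NormedAddCommGroup F] [NormedSpace ℝ F]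
    {h : EuclideanSpace ℝ (Fin d) → F} {z : PhaseSpace d} (hd : DifferentiableAt ℝ h z.1)
    (u : PhaseSpace d) : fderiv ℝ (fun z : PhaseSpace d => h z.1) z u = fderiv ℝ h z.1 u.1 := by
  have := (hd.hasFDerivAt.comp z (hasFDerivAt_fst (𝕜 := ℝ) (E := EuclideanSpace ℝ (Fin d))
    (F := EuclideanSpace ℝ (Fin d)) (p := z))).fderiv
  exact (congrArg (fun L => L u) this).trans rfl

theorem contDiff_kickMap {d : ℕ} {n : WithTop ℕ∞}
    {B : EuclideanSpace ℝ (Fin d) → EuclideanSpace ℝ (Fin d)} (hB : ContDiff ℝ n B) :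
    ContDiff ℝ n (kickMap B) :=
  contDiff_fst.prodMk (contDiff_snd.add (hB.comp contDiff_fst))

theorem fderiv_kickMap {d : ℕ} {B : EuclideanSpace ℝ (Fin d) → EuclideanSpace ℝ (Fin d)}
    (hB : Differentiable ℝ B) (z u : PhaseSpace d) :
    fderiv ℝ (kickMap B) z u = u + (0, fderiv ℝ B z.1 u.1) := by
  have h2 : HasFDerivAt (fun z : PhaseSpace d => B z.1) _ z :=
    (hB z.1).hasFDerivAt.comp z (hasFDerivAt_fst (𝕜 := ℝ) (E := EuclideanSpace ℝ (Fin d))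
      (F := EuclideanSpace ℝ (Fin d)) (p := z))
  have h := ((hasFDerivAt_fst (𝕜 := ℝ) (p := z)).prodMk
    ((hasFDerivAt_snd (𝕜 := ℝ) (p := z)).add h2)).fderiv
  refine (congrArg (fun L => L u) h).trans ?_
  ext1 <;> simp

theorem contDiff_driftMap {d : ℕ} {n : WithTop ℕ∞} (s : ℝ) : ContDiff ℝ n (driftMap (d := d) s) :=
  (contDiff_fst.sub (contDiff_snd.const_smul s)).prodMk contDiff_snd

theorem fderiv_driftMap {d : ℕ} (s : ℝ) (z u : PhaseSpace d) :
    fderiv ℝ (driftMap s) z u = u + ((-s) • u.2, 0) := by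
  have h := (((hasFDerivAt_fst (𝕜 := ℝ) (p := z)).sub
    ((hasFDerivAt_snd (𝕜 := ℝ) (p := z)).const_smul s)).prodMk
    (hasFDerivAt_snd (𝕜 := ℝ) (p := z))).fderiv
  refine (congrArg (fun L => L u) h).trans ?_
  ext1 <;> simp [sub_eq_add_neg]

theorem norm_mulL2_sum_le {d : ℕ} {ι : Type*} (s : Finset ι) {c : ι → PhaseSpace d → ℝ}
    (hc : ∀ j, Continuous (c j)) {C M : ℝ} (hC : ∀ j z, |c j z| ≤ C) (hC0 : 0 ≤ C) {g : ι → L2 d}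
    (hg : ∀ j, ‖g j‖ ≤ M) :
    ‖∑ j ∈ s, mulL2 (fun z => (c j z : ℂ)) (g j)‖ ≤ s.card * (C * M) := by
  refine (norm_sum_le _ _).trans ?_
  rw [← nsmul_eq_mul]
  refine Finset.sum_le_card_nsmul _ _ _ fun j _ => ?_
  refine (norm_mulL2_le (m := fun z => (c j z : ℂ)) (Complex.continuous_ofReal.comp (hc j)) (C := C)
    (fun z => by rw [Complex.norm_real]; exact hC j z) _).trans ?_
  exact mul_le_mul_of_nonneg_left (hg j) hC0

theorem mulL2_const {d : ℕ} (c : ℂ) (f : L2 d) : mulL2 (fun _ => c) f = c • f := by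
  refine Lp.ext ?_
  filter_upwards [coeFn_mulL2 (continuous_const (y := c)) (fun _ => le_rfl) f,
    Lp.coeFn_smul c f] with z h1 h2
  rw [h1, h2]; rfl

/-- Composition with a kick, in `W^{1,2}`. -/
theorem W12.exists_comp_kick {d : ℕ} (a : W12 d)
    {B : EuclideanSpace ℝ (Fin d) → EuclideanSpace ℝ (Fin d)} (hB : ContDiff ℝ 2 B) {D : ℝ}
    (hD0 : 0 ≤ D) (hD : ∀ x i k, |fderiv ℝ B x (EuclideanSpace.single i 1) k| ≤ D) :
    ∃ b : W12 d, (b.toL2 =ᵐ[volume] fun z => a.toL2 (kickMap B z)) ∧ ‖b.toL2‖ = ‖a.toL2‖ ∧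
      ∀ j, ‖b.deriv j‖ ≤ ‖a.deriv j‖ + d * (D * ‖a‖) := by
  have hmp := measurePreserving_kickMap hB.continuous
  have hBd : Differentiable ℝ B := hB.differentiable two_ne_zero
  -- The component along l of the Jacobian applied to the direction j: the identity plus ∂_i B_k for
  -- j = x_i, l = v_k. It depends on x alone, which the kick leaves unchanged, so it may be
  -- evaluated at the image point; and it is nonconstant only for velocity directions l, along which
  -- it does not vary.
  let c : Fin d ⊕ Fin d → Fin d ⊕ Fin d → PhaseSpace d → ℝ := fun j l z =>
    (if l = j then 1 else 0) +
      Sum.elim (fun i => Sum.elim (fun _ => 0)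
        (fun k => fderiv ℝ B z.1 (EuclideanSpace.single i 1) k) l) (fun _ => 0) j
  have hdB : ∀ i k, ContDiff ℝ 1 fun x => fderiv ℝ B x (EuclideanSpace.single i 1) k := fun i k =>
    (EuclideanSpace.proj (𝕜 := ℝ) k).contDiff.comp
      ((hB.fderiv_right (m := 1) (by norm_num)).clm_apply contDiff_const)
  have hc : ∀ j l, ContDiff ℝ 1 (c j l) := by
    rintro (i | i) (k | k) <;> refine contDiff_const.add ?_
    · exact contDiff_const
    · exact (hdB i k).comp contDiff_fst
    · exact contDiff_const
    · exact contDiff_const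
  have hc0 : ∀ j l z, fderiv ℝ (c j l) z (coordDir d l) = 0 := by
    rintro (i | i) (k | k) z
    · simp [c]
    · simp only [c, Sum.elim_inl, Sum.elim_inr]
      rw [fderiv_const_add, fderiv_fst_dep (h := fun x => fderiv ℝ B x (EuclideanSpace.single i 1) k)
        ((hdB i k).differentiable one_ne_zero _)]
      simp [coordDir]
    · simp [c]
    · simp [c]
  have hcb : ∀ j l z, |c j l z| ≤ 1 + D := by
    intro j l z
    refine (abs_add_le _ _).trans (add_le_add ?_ ?_)
    · split_ifs <;> simp
    · rcases j with i | i <;> rcases l with k | k <;> simp [hD0, hD]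
  have hu : ∀ j z, fderiv ℝ (kickMap B) z (coordDir d j) =
      ∑ l, c j l (kickMap B z) • coordDir d l := by
    intro j z
    rw [fderiv_kickMap hBd]
    simp only [c, add_smul, Finset.sum_add_distrib, ite_smul, one_smul, zero_smul,
      Finset.sum_ite_eq', Finset.mem_univ, if_true]
    congr 1
    rw [inr_eq_sum, Fintype.sum_sum_type]
    rcases j with i | i
    · simp [coordDir, kickMap]
    · simp [coordDir]
  have hw := fun j => HasWeakDeriv.comp a.hasWeakDeriv
    (contDiff_kickMap (hB.of_le one_le_two)) (contDiff_kickMap (B := fun x => -B x)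
      (hB.of_le one_le_two).neg) (fun z => by simp [kickMap]) (fun z => by simp [kickMap]) hmp
    (coordDir d j) (hc j) (hc0 j) (hcb j) (hu j)
  refine ⟨ofWeak _ _ hw, coeFn_compL2 hmp _, norm_compL2 hmp _, fun j => ?_⟩
  rw [deriv_ofWeak, norm_compL2, Fintype.sum_sum_type]
  rcases j with i | i
  · have e1 : ∑ l, mulL2 (fun z => (c (Sum.inl i) (Sum.inl l) z : ℂ)) (a.deriv (Sum.inl l)) =
        a.deriv (Sum.inl i) := by
      rw [Finset.sum_eq_single i]
      · simp [c, mulL2_const]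
      · intro l _ hl; simp [c, hl, mulL2_const]
      · simp
    rw [e1]
    refine (norm_add_le _ _).trans (add_le_add le_rfl ?_)
    have := norm_mulL2_sum_le Finset.univ (c := fun k => c (Sum.inl i) (Sum.inr k))
      (fun k => (hc _ _).continuous) (C := D) (M := ‖a‖) (fun k z => by simp [c, hD]) hD0
      (g := fun k => a.deriv (Sum.inr k)) (fun k => a.norm_deriv_le _)
    simpa using this
  · have e1 : ∑ l, mulL2 (fun z => (c (Sum.inr i) (Sum.inl l) z : ℂ)) (a.deriv (Sum.inl l)) = 0 :=
      Finset.sum_eq_zero fun l _ => by simp [c, mulL2_const]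
    have e2 : ∑ l, mulL2 (fun z => (c (Sum.inr i) (Sum.inr l) z : ℂ)) (a.deriv (Sum.inr l)) =
        a.deriv (Sum.inr i) := by
      rw [Finset.sum_eq_single i]
      · simp [c, mulL2_const]
      · intro l _ hl; simp [c, hl, mulL2_const]
      · simp
    rw [e1, e2, zero_add]
    have : 0 ≤ d * (D * ‖a‖) := by positivity
    linarith

/-- Composition with the free flow, in `W^{1,2}`. -/
theorem W12.exists_comp_drift {d : ℕ} (a : W12 d) (s : ℝ) :
    ∃ b : W12 d, (b.toL2 =ᵐ[volume] fun z => a.toL2 (driftMap s z)) ∧ ‖b.toL2‖ = ‖a.toL2‖ ∧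
      ∀ j, ‖b.deriv j‖ ≤ ‖a.deriv j‖ + |s| * ‖a‖ := by
  have hmp := measurePreserving_driftMap (d := d) s
  -- The Jacobian is constant: the identity, with the extra entry -s taking the direction v_i to
  -- x_i.
  let c : Fin d ⊕ Fin d → Fin d ⊕ Fin d → PhaseSpace d → ℝ := fun j l z =>
    (if l = j then 1 else 0) +
      Sum.elim (fun _ => 0) (fun i => Sum.elim (fun k => if k = i then -s else 0)
        (fun _ => 0) l) j
  have hcc : ∀ j l, ∃ r : ℝ, c j l = fun _ => r := fun j l => ⟨c j l 0, rfl⟩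
  have hc : ∀ j l, ContDiff ℝ 1 (c j l) := fun j l => contDiff_const
  have hc0 : ∀ j l z, fderiv ℝ (c j l) z (coordDir d l) = 0 := by
    intro j l z
    obtain ⟨r, hr⟩ := hcc j l
    rw [hr]; simp
  have hcb : ∀ j l z, |c j l z| ≤ 1 + |s| := by
    intro j l z
    refine (abs_add_le _ _).trans (add_le_add ?_ ?_)
    · split_ifs <;> simp
    · rcases j with i | i <;> rcases l with k | k <;> simp
      split_ifs <;> simp
  have hu : ∀ j z, fderiv ℝ (driftMap s) z (coordDir d j) =
      ∑ l, c j l (driftMap s z) • coordDir d l := by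
    intro j z
    rw [fderiv_driftMap]
    simp only [c, add_smul, Finset.sum_add_distrib, ite_smul, one_smul, zero_smul,
      Finset.sum_ite_eq', Finset.mem_univ, if_true]
    congr 1
    rw [Fintype.sum_sum_type]
    rcases j with i | i
    · simp [coordDir]
    · simp [coordDir]
  have hw := fun j => HasWeakDeriv.comp a.hasWeakDeriv
    (contDiff_driftMap s) (contDiff_driftMap (-s)) (fun z => by simp [driftMap])
    (fun z => by simp [driftMap]) hmp (coordDir d j) (hc j) (hc0 j) (hcb j) (hu j)
  refine ⟨ofWeak _ _ hw, coeFn_compL2 hmp _, norm_compL2 hmp _, fun j => ?_⟩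
  rw [deriv_ofWeak, norm_compL2, Fintype.sum_sum_type]
  rcases j with i | i
  · have e1 : ∑ l, mulL2 (fun z => (c (Sum.inl i) (Sum.inl l) z : ℂ)) (a.deriv (Sum.inl l)) =
        a.deriv (Sum.inl i) := by
      rw [Finset.sum_eq_single i]
      · simp [c, mulL2_const]
      · intro l _ hl; simp [c, hl, mulL2_const]
      · simp
    have e2 : ∑ l, mulL2 (fun z => (c (Sum.inl i) (Sum.inr l) z : ℂ)) (a.deriv (Sum.inr l)) = 0 :=
      Finset.sum_eq_zero fun l _ => by simp [c, mulL2_const]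
    rw [e1, e2, add_zero]
    have : 0 ≤ |s| * ‖a‖ := by positivity
    linarith
  · have e1 : ∑ l, mulL2 (fun z => (c (Sum.inr i) (Sum.inl l) z : ℂ)) (a.deriv (Sum.inl l)) =
        ((-s : ℝ) : ℂ) • a.deriv (Sum.inl i) := by
      rw [Finset.sum_eq_single i]
      · simp [c, mulL2_const]
      · intro l _ hl; simp [c, hl, mulL2_const]
      · simp
    have e2 : ∑ l, mulL2 (fun z => (c (Sum.inr i) (Sum.inr l) z : ℂ)) (a.deriv (Sum.inr l)) =
        a.deriv (Sum.inr i) := by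
      rw [Finset.sum_eq_single i]
      · simp [c, mulL2_const]
      · intro l _ hl; simp [c, hl, mulL2_const]
      · simp
    rw [e1, e2, add_comm]
    refine (norm_add_le _ _).trans (add_le_add le_rfl ?_)
    rw [norm_smul, Complex.norm_real, norm_neg, Real.norm_eq_abs]
    exact mul_le_mul_of_nonneg_left (a.norm_deriv_le _) (abs_nonneg _)

/-- Multiplication by a bounded `C¹` function, in `W^{1,2}`. -/
theorem W12.exists_mul {d : ℕ} (a : W12 d) {m : PhaseSpace d → ℂ} (hm : ContDiff ℝ 1 m)
    {D : ℝ} (hm1 : ∀ z, ‖m z‖ ≤ 1)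
    (hD : ∀ j z, ‖fderiv ℝ m z (coordDir d j)‖ ≤ D) :
    ∃ b : W12 d, (b.toL2 =ᵐ[volume] fun z => m z * a.toL2 z) ∧ ‖b.toL2‖ ≤ ‖a.toL2‖ ∧
      ∀ j, ‖b.deriv j‖ ≤ ‖a.deriv j‖ + D * ‖a.toL2‖ := by
  refine ⟨ofWeak _ _ fun j => (a.hasWeakDeriv j).bddMul hm hm1 (hD j),
    coeFn_mulL2 hm.continuous hm1 _, ?_, fun j => ?_⟩
  · simpa using norm_mulL2_le hm.continuous hm1 a.toL2
  · rw [deriv_ofWeak]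
    refine (norm_add_le _ _).trans (add_le_add ?_ ?_)
    · simpa using norm_mulL2_le hm.continuous hm1 (a.deriv j)
    · exact norm_mulL2_le ((hm.continuous_fderiv one_ne_zero).clm_apply continuous_const) (hD j) _

/-! ### Mean fields -/

/-- `C` bounds the partial derivatives of the potential together with their first two derivatives. -/
structure PotentialBound {d : ℕ} (Γ : EuclideanSpace ℝ (Fin d) → ℝ) (C : ℝ) : Prop where
  nonneg : 0 ≤ C
  contDiff : ∀ i, ContDiff ℝ 2 (partialDeriv Γ i)
  bound : ∀ i x, |partialDeriv Γ i x| ≤ C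
  bound_fderiv : ∀ i x, ‖fderiv ℝ (partialDeriv Γ i) x‖ ≤ C
  bound_fderiv_two : ∀ i x, ‖fderiv ℝ (fderiv ℝ (partialDeriv Γ i)) x‖ ≤ C

/-- Evaluation of the first derivative at a unit vector has norm at most one, so the orders 1, 2, 3
for Γ control the orders 0, 1, 2 for each partial derivative. -/
theorem IsRegularPotential.exists_bound {d : ℕ} {Γ : EuclideanSpace ℝ (Fin d) → ℝ}
    (h : IsRegularPotential Γ) : ∃ C, PotentialBound Γ C := by
  obtain ⟨C, hC⟩ := h.bounded
  have hd : ContDiff ℝ 2 (fderiv ℝ Γ) := h.contDiff.fderiv_right (by norm_num)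
  have hi : ∀ (i : Fin d) (k : ℕ), k ≤ 2 → ∀ x, ‖iteratedFDeriv ℝ k (partialDeriv Γ i) x‖ ≤ C := by
    intro i k hk x
    let A : (EuclideanSpace ℝ (Fin d) →L[ℝ] ℝ) →L[ℝ] ℝ :=
      ContinuousLinearMap.apply ℝ ℝ (EuclideanSpace.single i 1)
    have hA : ‖A‖ ≤ 1 := by
      refine ContinuousLinearMap.opNorm_le_bound _ zero_le_one fun L => ?_
      have := L.le_opNorm (EuclideanSpace.single i 1)
      simpa [A] using this
    have e : partialDeriv Γ i = A ∘ fderiv ℝ Γ := rfl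
    rw [e]
    have h1 := A.norm_iteratedFDeriv_comp_left (hd.contDiffAt (x := x)) (n := k)
      (by exact_mod_cast hk)
    have h2 : ‖iteratedFDeriv ℝ k (fderiv ℝ Γ) x‖ ≤ C := by
      rw [norm_iteratedFDeriv_fderiv]
      exact hC (k + 1) (Finset.mem_Icc.2 ⟨by omega, by omega⟩) x
    exact h1.trans ((mul_le_mul hA h2 (norm_nonneg _) zero_le_one).trans (one_mul C).le)
  refine ⟨max C 0, le_max_right _ _, fun i => hd.clm_apply contDiff_const, fun i x => ?_,
    fun i x => ?_, fun i x => ?_⟩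
  · have := hi i 0 (by norm_num) x
    rw [norm_iteratedFDeriv_zero] at this
    exact this.trans (le_max_left _ _)
  · have := hi i 1 (by norm_num) x
    rw [norm_iteratedFDeriv_one] at this
    exact this.trans (le_max_left _ _)
  · have := hi i 2 le_rfl x
    rw [← norm_iteratedFDeriv_fderiv, norm_iteratedFDeriv_one] at this
    exact this.trans (le_max_left _ _)

/-! ### Convolution in x with an integrable phase-space density. -/

section Convolution

variable {d : ℕ} {𝕜 : Type*} [RCLike 𝕜] {F : Type*} [NormedAddCommGroup F]
  [NormedSpace 𝕜 F] {k : EuclideanSpace ℝ (Fin d) → F}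
  {ρ : PhaseSpace d → 𝕜} {C : ℝ}

theorem integrable_spatialConv (hk : Continuous k) (hC : ∀ x, ‖k x‖ ≤ C) (hρ : Integrable ρ)
    (x : EuclideanSpace ℝ (Fin d)) : Integrable fun w : PhaseSpace d => ρ w • k (x - w.1) := by
  refine (hρ.norm.mul_const C).mono' (hρ.aestronglyMeasurable.smul
    (Continuous.aestronglyMeasurable (by fun_prop))) (Eventually.of_forall fun w => ?_)
  rw [norm_smul]
  exact mul_le_mul_of_nonneg_left (hC _) (norm_nonneg _)

variable [NormedSpace ℝ F]

theorem norm_spatialConv_le (hC : ∀ x, ‖k x‖ ≤ C) (hρ : Integrable ρ)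
    (x : EuclideanSpace ℝ (Fin d)) : ‖∫ w : PhaseSpace d, ρ w • k (x - w.1)‖ ≤ C * ∫ w, ‖ρ w‖ := by
  rw [← integral_const_mul]
  refine norm_integral_le_of_norm_le (hρ.norm.const_mul C) (Eventually.of_forall fun w => ?_)
  rw [norm_smul, mul_comm]
  exact mul_le_mul_of_nonneg_right (hC _) (norm_nonneg _)

theorem continuous_spatialConv (hk : Continuous k) (hC : ∀ x, ‖k x‖ ≤ C) (hρ : Integrable ρ) :
    Continuous fun x => ∫ w : PhaseSpace d, ρ w • k (x - w.1) := by
  refine continuous_of_dominated (bound := fun w => ‖ρ w‖ * C) (fun x => ?_) (fun x => ?_)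
    (hρ.norm.mul_const C) (Eventually.of_forall fun w => by fun_prop)
  · exact hρ.aestronglyMeasurable.smul (Continuous.aestronglyMeasurable (by fun_prop))
  · refine Eventually.of_forall fun w => ?_
    rw [norm_smul]
    exact mul_le_mul_of_nonneg_left (hC _) (norm_nonneg _)

variable [SMulCommClass ℝ 𝕜 F]

/-- Derivatives fall on the bounded kernel and the density need only be integrable. The kernel is
vector valued so that the statement can be reapplied to its own derivative. -/
theorem hasFDerivAt_spatialConv (hk : ContDiff ℝ 1 k) (hC : ∀ x, ‖k x‖ ≤ C)
    (hC' : ∀ x, ‖fderiv ℝ k x‖ ≤ C) (hρ : Integrable ρ) (x : EuclideanSpace ℝ (Fin d)) :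
    HasFDerivAt (fun x => ∫ w : PhaseSpace d, ρ w • k (x - w.1))
      (∫ w : PhaseSpace d, ρ w • fderiv ℝ k (x - w.1)) x := by
  have hkc := hk.continuous
  have hdc := hk.continuous_fderiv one_ne_zero
  refine hasFDerivAt_integral_of_dominated_of_fderiv_le (bound := fun w => ‖ρ w‖ * C)
    (F' := fun x w => ρ w • fderiv ℝ k (x - w.1)) Filter.univ_mem ?_ ?_ ?_ ?_ (hρ.norm.mul_const C) ?_
  · exact Eventually.of_forall fun x =>
      hρ.aestronglyMeasurable.smul (Continuous.aestronglyMeasurable (by fun_prop))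
  · exact integrable_spatialConv hkc hC hρ x
  · exact hρ.aestronglyMeasurable.smul (Continuous.aestronglyMeasurable (by fun_prop))
  · refine Eventually.of_forall fun w y _ => ?_
    rw [norm_smul]
    exact mul_le_mul_of_nonneg_left (hC' _) (norm_nonneg _)
  · refine Eventually.of_forall fun w y _ => ?_
    have h1 : HasFDerivAt (fun y => k (y - w.1)) (fderiv ℝ k (y - w.1)) y := by
      have := ((hk.differentiable one_ne_zero (y - w.1)).hasFDerivAt).comp y
        ((hasFDerivAt_id y).sub_const w.1)
      exact this
    exact h1.const_smul (ρ w)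

theorem contDiff_one_spatialConv (hk : ContDiff ℝ 1 k) (hC : ∀ x, ‖k x‖ ≤ C)
    (hC' : ∀ x, ‖fderiv ℝ k x‖ ≤ C) (hρ : Integrable ρ) :
    ContDiff ℝ 1 fun x => ∫ w : PhaseSpace d, ρ w • k (x - w.1) := by
  rw [contDiff_one_iff_fderiv]
  refine ⟨fun x => (hasFDerivAt_spatialConv hk hC hC' hρ x).differentiableAt, ?_⟩
  rw [funext fun x => (hasFDerivAt_spatialConv hk hC hC' hρ x).fderiv]
  exact continuous_spatialConv (hk.continuous_fderiv one_ne_zero) hC' hρ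

theorem contDiff_two_spatialConv (hk : ContDiff ℝ 2 k) (hC : ∀ x, ‖k x‖ ≤ C)
    (hC' : ∀ x, ‖fderiv ℝ k x‖ ≤ C) (hC'' : ∀ x, ‖fderiv ℝ (fderiv ℝ k) x‖ ≤ C)
    (hρ : Integrable ρ) :
    ContDiff ℝ 2 fun x => ∫ w : PhaseSpace d, ρ w • k (x - w.1) := by
  have hk1 : ContDiff ℝ 1 k := hk.of_le one_le_two
  rw [show (2 : WithTop ℕ∞) = 1 + 1 by norm_num, contDiff_succ_iff_fderiv]
  refine ⟨fun x => (hasFDerivAt_spatialConv hk1 hC hC' hρ x).differentiableAt, by simp, ?_⟩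
  rw [funext fun x => (hasFDerivAt_spatialConv hk1 hC hC' hρ x).fderiv]
  exact contDiff_one_spatialConv (hk.fderiv_right (by norm_num)) hC' hC'' hρ

end Convolution

theorem l2norm_norm {d : ℕ} (f : L2 d) : l2norm (fun z => ‖f z‖) = ‖f‖ := by
  rw [l2norm, Lp.norm_def, eLpNorm_norm]

theorem integrable_norm_mul {d : ℕ} (f g : L2 d) : Integrable fun z => ‖f z‖ * ‖g z‖ :=
  (Lp.memLp f).norm.integrable_mul (Lp.memLp g).norm

theorem integral_norm_mul_le {d : ℕ} (f g : L2 d) : ∫ z, ‖f z‖ * ‖g z‖ ≤ ‖f‖ * ‖g‖ := by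
  have hg : MemLp (fun z => (‖g z‖ : ℂ)) 2 volume := (Lp.memLp g).norm.ofReal
  have h1 := norm_integral_smul_le (Lp.memLp f).norm (hg.toLp _)
  have h2 : ∫ z, ‖f z‖ • (hg.toLp _ : L2 d) z = ((∫ z, ‖f z‖ * ‖g z‖ : ℝ) : ℂ) := by
    refine Eq.trans (integral_congr_ae ?_) (integral_ofReal (𝕜 := ℂ))
    filter_upwards [hg.coeFn_toLp] with z hz
    rw [hz, Complex.real_smul]; simp
  have h3 : ‖(hg.toLp _ : L2 d)‖ = ‖g‖ := by
    rw [Lp.norm_toLp, Lp.norm_def]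
    congr 1
    exact eLpNorm_congr_norm_ae (Eventually.of_forall fun z => by simp)
  rw [h2, l2norm_norm, h3, Complex.norm_real] at h1
  exact (le_abs_self _).trans h1

theorem integrable_conj_mul {d : ℕ} (f g : L2 d) : Integrable fun z => conj (f z) * g z :=
  (integrable_norm_mul f g).mono' (((Complex.continuous_conj.comp_aestronglyMeasurable
    (Lp.aestronglyMeasurable f))).mul (Lp.aestronglyMeasurable g))
    (Eventually.of_forall fun z => by simp)

theorem integrable_norm_sq {d : ℕ} (f : L2 d) : Integrable fun z => ‖f z‖ ^ 2 := by
  simpa [sq] using integrable_norm_mul f f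

theorem integral_norm_sq_le {d : ℕ} (f : L2 d) : ∫ z, ‖f z‖ ^ 2 ≤ ‖f‖ ^ 2 := by
  simpa [sq] using integral_norm_mul_le f f

/-! ### Size, regularity and L² dependence of the mean fields. -/

section Fields

variable {d : ℕ} {Γ : EuclideanSpace ℝ (Fin d) → ℝ} {C : ℝ}

theorem fieldConv_eq (a : W12 d) (i : Fin d) :
    fieldConv Γ a i = fun x => ∫ w : PhaseSpace d, ‖a.toL2 w‖ ^ 2 • partialDeriv Γ i (x - w.1) := by
  ext x
  simp [fieldConv, mul_comm]

theorem bracketConv_eq (a : W12 d) :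
    bracketConv Γ a = fun x => ∑ i, ∫ w : PhaseSpace d,
      (conj (a.toL2 w) * a.dv i w) • (partialDeriv Γ i (x - w.1) : ℂ) := by
  ext x
  simp [bracketConv, mul_comm]

theorem contDiff_fieldConv (h : PotentialBound Γ C) (a : W12 d) (i : Fin d) :
    ContDiff ℝ 2 (fieldConv Γ a i) := by
  rw [fieldConv_eq]
  exact contDiff_two_spatialConv (𝕜 := ℝ) (h.contDiff i) (h.bound i) (h.bound_fderiv i)
    (h.bound_fderiv_two i) (integrable_norm_sq _)

theorem abs_fieldConv_le (h : PotentialBound Γ C) (a : W12 d) (i : Fin d) (x) :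
    |fieldConv Γ a i x| ≤ C * ‖a.toL2‖ ^ 2 := by
  rw [fieldConv_eq]
  refine (norm_spatialConv_le (𝕜 := ℝ) (k := partialDeriv Γ i) (h.bound i) (integrable_norm_sq _) x).trans ?_
  refine mul_le_mul_of_nonneg_left ?_ h.nonneg
  simpa using integral_norm_sq_le a.toL2

theorem norm_fderiv_fieldConv_le (h : PotentialBound Γ C) (a : W12 d) (i : Fin d) (x) :
    ‖fderiv ℝ (fieldConv Γ a i) x‖ ≤ C * ‖a.toL2‖ ^ 2 := by
  rw [fieldConv_eq, (hasFDerivAt_spatialConv (𝕜 := ℝ) ((h.contDiff i).of_le one_le_two) (h.bound i)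
    (h.bound_fderiv i) (integrable_norm_sq _) x).fderiv]
  refine (norm_spatialConv_le (𝕜 := ℝ) (h.bound_fderiv i) (integrable_norm_sq _) x).trans ?_
  refine mul_le_mul_of_nonneg_left ?_ h.nonneg
  simpa using integral_norm_sq_le a.toL2

/-- Pointwise, ||a|² − |b|²| ≤ |a − b|(|a| + |b|), followed by Cauchy–Schwarz. No derivative of a or
b is involved. -/
theorem abs_fieldConv_sub_le (h : PotentialBound Γ C) (a b : W12 d) (i : Fin d) (x) :
    |fieldConv Γ a i x - fieldConv Γ b i x| ≤
      C * (‖a.toL2 - b.toL2‖ * (‖a.toL2‖ + ‖b.toL2‖)) := by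
  rw [fieldConv_eq, fieldConv_eq]
  have hk := (h.contDiff i).continuous
  rw [← integral_sub (integrable_spatialConv (𝕜 := ℝ) hk (h.bound i) (integrable_norm_sq _) x)
    (integrable_spatialConv (𝕜 := ℝ) hk (h.bound i) (integrable_norm_sq _) x)]
  simp_rw [← sub_smul]
  refine (norm_spatialConv_le (𝕜 := ℝ) (k := partialDeriv Γ i) (h.bound i)
    ((integrable_norm_sq a.toL2).sub (integrable_norm_sq b.toL2)) x).trans ?_
  refine mul_le_mul_of_nonneg_left ?_ h.nonneg
  rw [mul_add]
  refine le_trans ?_ (add_le_add (integral_norm_mul_le (a.toL2 - b.toL2) a.toL2)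
    (integral_norm_mul_le (a.toL2 - b.toL2) b.toL2))
  rw [← integral_add (integrable_norm_mul _ _) (integrable_norm_mul _ _)]
  refine integral_mono_ae ((integrable_norm_sq a.toL2).sub (integrable_norm_sq b.toL2)).norm
    ((integrable_norm_mul _ _).add (integrable_norm_mul _ _)) ?_
  filter_upwards [Lp.coeFn_sub a.toL2 b.toL2] with z hz
  rw [hz, Pi.sub_apply, Pi.sub_apply, Real.norm_eq_abs, sq_sub_sq, abs_mul, mul_comm, ← mul_add]
  have h1 := abs_norm_sub_norm_le (a.toL2 z) (b.toL2 z)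
  rw [abs_of_nonneg (by positivity : 0 ≤ ‖a.toL2 z‖ + ‖b.toL2 z‖)]
  exact mul_le_mul_of_nonneg_right h1 (by positivity)

theorem contDiff_ofReal_partialDeriv (h : PotentialBound Γ C) (i : Fin d) :
    ContDiff ℝ 1 fun x => (partialDeriv Γ i x : ℂ) :=
  Complex.ofRealCLM.contDiff.comp ((h.contDiff i).of_le one_le_two)

theorem norm_ofReal_partialDeriv_le (h : PotentialBound Γ C) (i : Fin d) (x) :
    ‖(partialDeriv Γ i x : ℂ)‖ ≤ C := by
  rw [Complex.norm_real]; exact h.bound i x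

theorem norm_fderiv_ofReal_partialDeriv_le (h : PotentialBound Γ C) (i : Fin d) (x) :
    ‖fderiv ℝ (fun x => (partialDeriv Γ i x : ℂ)) x‖ ≤ C := by
  refine ContinuousLinearMap.opNorm_le_bound _ h.nonneg fun u => ?_
  rw [fderiv_ofReal_apply ((h.contDiff i).differentiable two_ne_zero x), Complex.norm_real]
  exact ((fderiv ℝ (partialDeriv Γ i) x).le_opNorm u).trans
    (mul_le_mul_of_nonneg_right (h.bound_fderiv i x) (norm_nonneg _))

theorem integral_norm_conj_mul_le (f g : L2 d) : ∫ z, ‖conj (f z) * g z‖ ≤ ‖f‖ * ‖g‖ := by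
  simpa using integral_norm_mul_le f g

theorem contDiff_bracketConv (h : PotentialBound Γ C) (a : W12 d) :
    ContDiff ℝ 1 (bracketConv Γ a) := by
  rw [bracketConv_eq]
  exact ContDiff.sum fun i _ => contDiff_one_spatialConv (𝕜 := ℂ)
    (contDiff_ofReal_partialDeriv h i) (norm_ofReal_partialDeriv_le h i)
    (norm_fderiv_ofReal_partialDeriv_le h i) (integrable_conj_mul _ _)

theorem sum_fin_le {d : ℕ} {f : Fin d → ℝ} {M : ℝ} (h : ∀ i, f i ≤ M) : ∑ i, f i ≤ d * M := by
  refine (Finset.sum_le_card_nsmul _ _ M fun i _ => h i).trans ?_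
  simp

theorem norm_bracketConv_le (h : PotentialBound Γ C) (a : W12 d) (x) :
    ‖bracketConv Γ a x‖ ≤ d * (C * (‖a.toL2‖ * ‖a‖)) := by
  rw [bracketConv_eq]
  refine (norm_sum_le _ _).trans (sum_fin_le fun i => ?_)
  refine (norm_spatialConv_le (𝕜 := ℂ) (k := fun x => (partialDeriv Γ i x : ℂ))
    (norm_ofReal_partialDeriv_le h i) (integrable_conj_mul _ _) x).trans ?_
  refine mul_le_mul_of_nonneg_left ((integral_norm_conj_mul_le _ _).trans ?_) h.nonneg
  exact mul_le_mul_of_nonneg_left (a.norm_dv_le i) (norm_nonneg _)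

theorem norm_fderiv_bracketConv_le (h : PotentialBound Γ C) (a : W12 d) (x) :
    ‖fderiv ℝ (bracketConv Γ a) x‖ ≤ d * (C * (‖a.toL2‖ * ‖a‖)) := by
  rw [bracketConv_eq]
  have hd := fun i => hasFDerivAt_spatialConv (𝕜 := ℂ)
    (contDiff_ofReal_partialDeriv h i) (norm_ofReal_partialDeriv_le h i)
    (norm_fderiv_ofReal_partialDeriv_le h i) (integrable_conj_mul a.toL2 (a.dv i)) x
  rw [(HasFDerivAt.fun_sum fun i (_ : i ∈ Finset.univ) => hd i).fderiv]
  refine (norm_sum_le _ _).trans (sum_fin_le fun i => ?_)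
  refine (norm_spatialConv_le (𝕜 := ℂ) (k := fderiv ℝ fun x => (partialDeriv Γ i x : ℂ))
    (norm_fderiv_ofReal_partialDeriv_le h i) (integrable_conj_mul _ _) x).trans ?_
  refine mul_le_mul_of_nonneg_left ((integral_norm_conj_mul_le _ _).trans ?_) h.nonneg
  exact mul_le_mul_of_nonneg_left (a.norm_dv_le i) (norm_nonneg _)

/-- Integration by parts in `v` against a weight depending on `x` only. -/
theorem integral_conj_mul_dv (h : PotentialBound Γ C) (b c : W12 d) (i : Fin d) (x) :
    ∫ w : PhaseSpace d, (conj (b.toL2 w) * c.dv i w) • (partialDeriv Γ i (x - w.1) : ℂ) =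
      - ∫ w : PhaseSpace d, (conj (b.dv i w) * c.toL2 w) • (partialDeriv Γ i (x - w.1) : ℂ) := by
  let m : PhaseSpace d → ℂ := fun w => (partialDeriv Γ i (x - w.1) : ℂ)
  have hm : ContDiff ℝ 1 m :=
    (contDiff_ofReal_partialDeriv h i).comp (contDiff_const.sub contDiff_fst)
  have hmb : ∀ w, ‖m w‖ ≤ C := fun w => norm_ofReal_partialDeriv_le h i _
  -- The weight does not see v, so the product rule produces no derivative of it.
  have hm0 : ∀ w, fderiv ℝ m w (coordDir d (Sum.inr i)) = 0 := by
    intro w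
    have := fderiv_fst_dep (h := fun y => (partialDeriv Γ i (x - y) : ℂ)) (z := w)
      (((contDiff_ofReal_partialDeriv h i).comp (contDiff_const.sub contDiff_id)).differentiable
        one_ne_zero _) (coordDir d (Sum.inr i))
    refine this.trans ?_
    simp [coordDir]
  have hw := (b.hasWeakDeriv (Sum.inr i)).bddMul hm hmb (C' := 0) (fun w => by rw [hm0]; simp)
  have key := hw.inner_eq_neg (c.hasWeakDeriv (Sum.inr i))
  have e0 : mulL2 (fun z => fderiv ℝ m z (coordDir d (Sum.inr i))) b.toL2 = 0 := by
    simp_rw [hm0]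
    rw [mulL2_const, zero_smul]
  rw [e0, add_zero, MeasureTheory.L2.inner_def, MeasureTheory.L2.inner_def] at key
  have e1 : ∀ f g : L2 d, ∫ w, inner ℂ (mulL2 m f w) (g w) = ∫ w, (conj (f w) * g w) • m w := by
    intro f g
    refine integral_congr_ae ?_
    filter_upwards [coeFn_mulL2 hm.continuous hmb f] with w hw
    rw [hw, RCLike.inner_apply, map_mul, smul_eq_mul]
    have : conj (m w) = m w := Complex.conj_ofReal _
    rw [this]; ring
  rw [e1, e1] at key
  exact key

/-- Integration by parts with both factors equal to a shows that each integral is minus its own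
conjugate. Consequently multiplication by exp(-sK_a) is a change of phase. -/
theorem bracketConv_re (h : PotentialBound Γ C) (a : W12 d) (x) : (bracketConv Γ a x).re = 0 := by
  rw [bracketConv_eq]
  simp only [Complex.re_sum]
  refine Finset.sum_eq_zero fun i _ => ?_
  have h1 := integral_conj_mul_dv h a a i x
  have h2 : ∫ w : PhaseSpace d, (conj (a.dv i w) * a.toL2 w) • (partialDeriv Γ i (x - w.1) : ℂ) =
      conj (∫ w : PhaseSpace d, (conj (a.toL2 w) * a.dv i w) • (partialDeriv Γ i (x - w.1) : ℂ)) := by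
    rw [← integral_conj]
    congr 1; ext w
    simp [mul_comm]
  rw [h2] at h1
  have h3 := congrArg Complex.re h1
  rw [Complex.neg_re, Complex.conj_re] at h3
  linarith

/-- The difference splits into conj(a − b) ∂_v a and conj(b) ∂_v(a − b). Integrating the second by
parts puts the derivative on b, so a − b enters only through its L² norm. Without this the stability
estimate would not close in L². -/
theorem norm_bracketConv_sub_le (h : PotentialBound Γ C) (a b : W12 d) (x) :
    ‖bracketConv Γ a x - bracketConv Γ b x‖ ≤
      d * (C * (‖a.toL2 - b.toL2‖ * (‖a‖ + ‖b‖))) := by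
  rw [bracketConv_eq, bracketConv_eq]
  beta_reduce
  rw [← Finset.sum_sub_distrib]
  refine (norm_sum_le _ _).trans (sum_fin_le fun i => ?_)
  have hk := (contDiff_ofReal_partialDeriv h i).continuous
  have hi := fun f g : L2 d => integrable_spatialConv (𝕜 := ℂ) hk (norm_ofReal_partialDeriv_le h i)
    (integrable_conj_mul f g) x
  have hn := fun f g : L2 d => norm_spatialConv_le (𝕜 := ℂ)
    (k := fun x => (partialDeriv Γ i x : ℂ)) (norm_ofReal_partialDeriv_le h i)
    (integrable_conj_mul f g) x
  have e1 : (∫ w : PhaseSpace d, (conj (a.toL2 w) * a.dv i w) • (partialDeriv Γ i (x - w.1) : ℂ)) -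
      ∫ w : PhaseSpace d, (conj (b.toL2 w) * b.dv i w) • (partialDeriv Γ i (x - w.1) : ℂ) =
      (∫ w : PhaseSpace d, (conj ((a - b).toL2 w) * a.dv i w) • (partialDeriv Γ i (x - w.1) : ℂ)) +
      ∫ w : PhaseSpace d, (conj (b.toL2 w) * (a - b).dv i w) • (partialDeriv Γ i (x - w.1) : ℂ) := by
    rw [← integral_sub (hi _ _) (hi _ _), ← integral_add (hi _ _) (hi _ _)]
    refine integral_congr_ae ?_
    filter_upwards [Lp.coeFn_sub a.toL2 b.toL2, Lp.coeFn_sub (a.dv i) (b.dv i)] with w h1 h2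
    have h1' : (a - b).toL2 w = a.toL2 w - b.toL2 w := h1
    have h2' : (a - b).dv i w = a.dv i w - b.dv i w := h2
    rw [h1', h2', map_sub]
    simp only [smul_eq_mul]
    ring
  rw [e1, integral_conj_mul_dv h b (a - b) i x]
  refine (norm_add_le _ _).trans ?_
  rw [norm_neg]
  refine (add_le_add (hn _ _) (hn _ _)).trans ?_
  rw [← mul_add]
  refine mul_le_mul_of_nonneg_left ?_ h.nonneg
  refine (add_le_add (integral_norm_conj_mul_le _ _) (integral_norm_conj_mul_le _ _)).trans ?_
  rw [W12.toL2_sub]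
  have h1 := mul_le_mul_of_nonneg_left (a.norm_dv_le i) (norm_nonneg (a.toL2 - b.toL2))
  have h2 := mul_le_mul_of_nonneg_right (b.norm_dv_le i) (norm_nonneg (a.toL2 - b.toL2))
  linarith

end Fields

/-! ### The energy identity for primitives in a Hilbert space -/

/-- Write the square as a double integral of Re ⟨g r, g s⟩. The integrand is symmetric, so the two
sides of the diagonal contribute equally, and the diagonal is null. Fubini alone thus gives the
energy identity, with g merely integrable in time. -/
theorem norm_sq_integral_eq {H : Type*} [NormedAddCommGroup H] [InnerProductSpace ℂ H]
    [CompleteSpace H] {μ : Measure ℝ} [SFinite μ] [NullSingletonClass μ] {g : ℝ → H} (hg : Integrable g μ) :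
    ‖∫ s, g s ∂μ‖ ^ 2 =
      2 * ∫ s, (inner ℂ (∫ r, (Set.Iic s).indicator g r ∂μ) (g s)).re ∂μ := by
  let G : ℝ × ℝ → ℝ := fun p => (inner ℂ (g p.1) (g p.2)).re
  have hG : Integrable G (μ.prod μ) := by
    refine Integrable.mono' (hg.norm.mul_prod hg.norm) ?_ (Eventually.of_forall fun p => ?_)
    · exact Complex.continuous_re.comp_aestronglyMeasurable
        ((hg.aestronglyMeasurable.comp_fst).inner (hg.aestronglyMeasurable.comp_snd))
    · exact (Complex.abs_re_le_norm _).trans (norm_inner_le_norm _ _)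
  let L : Set (ℝ × ℝ) := {p | p.1 ≤ p.2}
  have hL : MeasurableSet L := measurableSet_le measurable_fst measurable_snd
  have hI : ∀ S : Set ℝ, MeasurableSet S → ∀ s, ∫ r, S.indicator (fun r => G (r, s)) r ∂μ =
      (inner ℂ (∫ r, S.indicator g r ∂μ) (g s)).re := by
    intro S hS s
    have e1 : (inner ℂ (∫ r, S.indicator g r ∂μ) (g s)) =
        ∫ r, inner ℂ (S.indicator g r) (g s) ∂μ := by
      rw [← inner_conj_symm, ← integral_inner (hg.indicator hS), ← integral_conj]
      simp_rw [inner_conj_symm]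
    have hi : Integrable (fun r => inner ℂ (S.indicator g r) (g s)) μ :=
      (hg.indicator hS).inner_const _
    rw [e1]
    refine Eq.trans ?_ (integral_re (𝕜 := ℂ) hi)
    congr 1; ext r
    by_cases hr : r ∈ S
    · rw [Set.indicator_of_mem hr, Set.indicator_of_mem hr]; rfl
    · rw [Set.indicator_of_notMem hr, Set.indicator_of_notMem hr]; simp
  have h1 : ∫ p, G p ∂(μ.prod μ) = ‖∫ s, g s ∂μ‖ ^ 2 := by
    rw [integral_prod_symm _ hG]
    have e1 : ∀ s, ∫ r, G (r, s) ∂μ = (inner ℂ (∫ r, g r ∂μ) (g s)).re := fun s => by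
      simpa using hI Set.univ MeasurableSet.univ s
    simp_rw [e1]
    have hi : Integrable (fun s => inner ℂ (∫ r, g r ∂μ) (g s)) μ := hg.const_inner _
    refine (integral_re (𝕜 := ℂ) hi).trans ?_
    rw [integral_inner hg, inner_self_eq_norm_sq_to_K]
    norm_cast
  have h2 : ∫ p, L.indicator G p ∂(μ.prod μ) =
      ∫ s, (inner ℂ (∫ r, (Set.Iic s).indicator g r ∂μ) (g s)).re ∂μ := by
    rw [integral_prod_symm _ (hG.indicator hL)]
    congr 1; ext s
    rw [← hI _ measurableSet_Iic s]
    rfl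
  -- Integrating in the opposite order exchanges the two sides of the diagonal; the single point r =
  -- s is discarded as a null set.
  have h3 : ∫ p, Lᶜ.indicator G p ∂(μ.prod μ) = ∫ p, L.indicator G p ∂(μ.prod μ) := by
    rw [integral_prod_symm _ (hG.indicator hL), integral_prod _ (hG.indicator hL.compl)]
    congr 1; ext s
    refine integral_congr_ae ?_
    have : ∀ᵐ r ∂μ, r ≠ s := by simp [ae_iff]
    filter_upwards [this] with r hr
    have hsym : G (s, r) = G (r, s) := by
      simp only [G]
      rw [← inner_conj_symm, Complex.conj_re]
    by_cases h : r ≤ s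
    · have h1 : (s, r) ∈ Lᶜ := by
        simp only [L, Set.mem_compl_iff, Set.mem_ofPred_eq, not_le]
        exact lt_of_le_of_ne h hr
      have h2 : (r, s) ∈ L := h
      rw [Set.indicator_of_mem h1, Set.indicator_of_mem h2, hsym]
    · have h1 : (s, r) ∉ Lᶜ := by
        simp only [L, Set.mem_compl_iff, Set.mem_ofPred_eq, not_not]
        exact (not_le.1 h).le
      have h2 : (r, s) ∉ L := h
      rw [Set.indicator_of_notMem h1, Set.indicator_of_notMem h2]
  have h4 : ∫ p, L.indicator G p ∂(μ.prod μ) + ∫ p, Lᶜ.indicator G p ∂(μ.prod μ) =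
      ∫ p, G p ∂(μ.prod μ) := by
    rw [← integral_add (hG.indicator hL) (hG.indicator hL.compl)]
    congr 1; ext p
    exact congrFun (Set.indicator_self_add_compl L G) p
  rw [← h1, ← h2, ← h4, h3, two_mul]

/-- The energy identity for `y t = y₀ + ∫₀ᵗ g`. -/
theorem norm_sq_add_integral_eq {H : Type*} [NormedAddCommGroup H] [InnerProductSpace ℂ H]
    [CompleteSpace H] {g : ℝ → H} {t : ℝ} (ht : 0 ≤ t) (hg : IntervalIntegrable g volume 0 t)
    (y₀ : H) :
    ‖y₀ + ∫ s in (0 : ℝ)..t, g s‖ ^ 2 =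
      ‖y₀‖ ^ 2 + 2 * ∫ s in (0 : ℝ)..t, (inner ℂ (y₀ + ∫ r in (0 : ℝ)..s, g r) (g s)).re := by
  have hgi : IntegrableOn g (Set.Ioc 0 t) := (intervalIntegrable_iff_integrableOn_Ioc_of_le ht).1 hg
  have hcont : ContinuousOn (fun s => ∫ r in (0 : ℝ)..s, g r) (Set.Icc 0 t) := by
    have := intervalIntegral.continuousOn_primitive_interval (μ := volume) (f := g) (a := 0) (b := t)
      (by rwa [Set.uIcc_of_le ht, integrableOn_Icc_iff_integrableOn_Ioc])
    rwa [Set.uIcc_of_le ht] at this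
  have h0 := norm_sq_integral_eq (μ := volume.restrict (Set.Ioc 0 t)) hgi
  have e1 : ∫ s in (0 : ℝ)..t, g s = ∫ s in Set.Ioc 0 t, g s := intervalIntegral.integral_of_le ht
  have e2 : ∀ s ∈ Set.Ioc 0 t, ∫ r in Set.Ioc 0 t, (Set.Iic s).indicator g r =
      ∫ r in (0 : ℝ)..s, g r := by
    intro s hs
    rw [intervalIntegral.integral_of_le hs.1.le, integral_indicator measurableSet_Iic,
      Measure.restrict_restrict measurableSet_Iic]
    congr 2
    ext r
    simp only [Set.mem_inter_iff, Set.mem_Iic, Set.mem_Ioc]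
    exact ⟨fun h => ⟨h.2.1, h.1⟩, fun h => ⟨h.2, h.1, h.2.trans hs.2⟩⟩
  have e3 : ∫ s in Set.Ioc 0 t, (inner ℂ (∫ r in Set.Ioc 0 t, (Set.Iic s).indicator g r) (g s)).re =
      ∫ s in Set.Ioc 0 t, (inner ℂ (∫ r in (0 : ℝ)..s, g r) (g s)).re :=
    setIntegral_congr_fun measurableSet_Ioc fun s hs => by rw [e2 s hs]
  rw [e3] at h0
  have i1 : IntegrableOn (fun s => inner ℂ y₀ (g s)) (Set.Ioc 0 t) := hgi.const_inner _
  have i2 : IntegrableOn (fun s => (inner ℂ (∫ r in (0 : ℝ)..s, g r) (g s))) (Set.Ioc 0 t) := by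
    obtain ⟨M, hM⟩ := isCompact_Icc.exists_bound_of_continuousOn hcont
    refine Integrable.mono' (hgi.norm.const_mul M) ?_ ?_
    · exact ((hcont.mono Set.Ioc_subset_Icc_self).aestronglyMeasurable measurableSet_Ioc).inner
        hgi.aestronglyMeasurable
    · filter_upwards [ae_restrict_mem measurableSet_Ioc] with s hs
      exact (norm_inner_le_norm _ _).trans
        (mul_le_mul_of_nonneg_right (hM s (Set.Ioc_subset_Icc_self hs)) (norm_nonneg _))
  have e4 : ∫ s in Set.Ioc 0 t, (inner ℂ (y₀ + ∫ r in (0 : ℝ)..s, g r) (g s)).re =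
      (inner ℂ y₀ (∫ s in Set.Ioc 0 t, g s)).re +
        ∫ s in Set.Ioc 0 t, (inner ℂ (∫ r in (0 : ℝ)..s, g r) (g s)).re := by
    have h1 : (inner ℂ y₀ (∫ s in Set.Ioc 0 t, g s)).re =
        ∫ s in Set.Ioc 0 t, (inner ℂ y₀ (g s)).re := by
      rw [← integral_inner hgi]
      exact (integral_re (𝕜 := ℂ) i1).symm
    rw [h1]
    refine Eq.trans ?_ (integral_add i1.re i2.re)
    congr 1; ext s
    simp
  rw [intervalIntegral.integral_of_le (f := fun s => (inner ℂ (y₀ + ∫ r in (0 : ℝ)..s, g r) (g s)).re)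
    ht, e4, e1, norm_add_sq (𝕜 := ℂ), h0]
  simp only [RCLike.re_to_complex]
  ring

/-! ### Multiplication by real functions -/

section Real

variable {d : ℕ}

/-- Multiplication of an `L²` function by a bounded real function. -/
def mulR (r : PhaseSpace d → ℝ) (f : L2 d) : L2 d := mulL2 (fun z => (r z : ℂ)) f

theorem coeFn_mulR {r : PhaseSpace d → ℝ} (hr : Continuous r) {C : ℝ} (hC : ∀ z, |r z| ≤ C)
    (f : L2 d) : mulR r f =ᵐ[volume] fun z => (r z : ℂ) * f z :=
  coeFn_mulL2 (Complex.continuous_ofReal.comp hr) (C := C)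
    (fun z => (Complex.norm_real _).trans_le (hC z)) f

theorem norm_mulR_le {r : PhaseSpace d → ℝ} (hr : Continuous r) {C : ℝ} (hC : ∀ z, |r z| ≤ C)
    (f : L2 d) : ‖mulR r f‖ ≤ C * ‖f‖ :=
  norm_mulL2_le (Complex.continuous_ofReal.comp hr) (C := C)
    (fun z => (Complex.norm_real _).trans_le (hC z)) f

theorem mulL2_sub {m : PhaseSpace d → ℂ} (hm : Continuous m) {C : ℝ} (hC : ∀ z, ‖m z‖ ≤ C)
    (f g : L2 d) : mulL2 m (f - g) = mulL2 m f - mulL2 m g := by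
  refine Lp.ext ?_
  filter_upwards [coeFn_mulL2 hm hC f, coeFn_mulL2 hm hC g, coeFn_mulL2 hm hC (f - g),
    Lp.coeFn_sub f g, Lp.coeFn_sub (mulL2 m f) (mulL2 m g)] with z h1 h2 h3 h4 h5
  rw [h5, h3, Pi.sub_apply, h1, h2, h4, Pi.sub_apply, mul_sub]

theorem sub_mulL2 {m m' : PhaseSpace d → ℂ} (hm : Continuous m) (hm' : Continuous m') {C C' : ℝ}
    (hC : ∀ z, ‖m z‖ ≤ C) (hC' : ∀ z, ‖m' z‖ ≤ C') (f : L2 d) :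
    mulL2 (fun z => m z - m' z) f = mulL2 m f - mulL2 m' f := by
  refine Lp.ext ?_
  filter_upwards [coeFn_mulL2 hm hC f, coeFn_mulL2 hm' hC' f,
    coeFn_mulL2 (m := fun z => m z - m' z) (hm.sub hm') (fun z => (norm_sub_le _ _).trans (add_le_add (hC z) (hC' z))) f,
    Lp.coeFn_sub (mulL2 m f) (mulL2 m' f)] with z h1 h2 h3 h5
  rw [h5, h3, Pi.sub_apply, h1, h2, sub_mul]

/-- Products `m f` depend continuously on `m` in the sup norm and on `f` in `L²`. -/
theorem norm_mulL2_sub_mulL2_le {m m' : PhaseSpace d → ℂ} (hm : Continuous m)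
    (hm' : Continuous m') {C C' δ : ℝ} (hC : ∀ z, ‖m z‖ ≤ C) (hC' : ∀ z, ‖m' z‖ ≤ C')
    (hδ : ∀ z, ‖m z - m' z‖ ≤ δ) (f g : L2 d) :
    ‖mulL2 m f - mulL2 m' g‖ ≤ δ * ‖f‖ + C' * ‖f - g‖ := by
  have e : mulL2 m f - mulL2 m' g = mulL2 (fun z => m z - m' z) f + mulL2 m' (f - g) := by
    rw [sub_mulL2 hm hm' hC hC', mulL2_sub hm' hC']; abel
  rw [e]
  exact (norm_add_le _ _).trans (add_le_add (norm_mulL2_le (hm.sub hm') hδ f)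
    (norm_mulL2_le hm' hC' _))

theorem mulR_mulL2 {r : PhaseSpace d → ℝ} {m : PhaseSpace d → ℂ} (hr : Continuous r)
    (hm : Continuous m) {C C' : ℝ} (hC : ∀ z, |r z| ≤ C) (hC' : ∀ z, ‖m z‖ ≤ C') (f : L2 d) :
    mulR r (mulL2 m f) = mulL2 (fun z => (r z : ℂ) * m z) f := by
  have hp : ∀ z, ‖(r z : ℂ) * m z‖ ≤ C * C' := fun z => by
    rw [norm_mul, Complex.norm_real]
    exact mul_le_mul (hC z) (hC' z) (norm_nonneg _) ((abs_nonneg _).trans (hC z))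
  refine Lp.ext ?_
  filter_upwards [coeFn_mulR hr hC (mulL2 m f), coeFn_mulL2 hm hC' f,
    coeFn_mulL2 ((Complex.continuous_ofReal.comp hr).mul hm) hp f] with z h1 h2 h3
  rw [h1, h2]
  exact (h3.trans (mul_assoc _ _ _)).symm

theorem inner_mulR_left {r : PhaseSpace d → ℝ} (hr : Continuous r) {C : ℝ} (hC : ∀ z, |r z| ≤ C)
    (f g : L2 d) : inner ℂ (mulR r f) g = inner ℂ f (mulR r g) := by
  rw [MeasureTheory.L2.inner_def, MeasureTheory.L2.inner_def]
  refine integral_congr_ae ?_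
  filter_upwards [coeFn_mulR hr hC f, coeFn_mulR hr hC g] with z h1 h2
  rw [h1, h2, RCLike.inner_apply, RCLike.inner_apply, map_mul]
  have : conj (r z : ℂ) = r z := Complex.conj_ofReal _
  rw [this]; ring

/-- The quadratic form `Re ⟨f, r ∂f⟩` only sees the derivative of the real weight `r`. -/
theorem HasWeakDeriv.abs_re_inner_mulR_le {u : PhaseSpace d} {f g : L2 d}
    (h : HasWeakDeriv u f g) {r : PhaseSpace d → ℝ} (hr : ContDiff ℝ 1 r) {C C' : ℝ}
    (hC : ∀ z, |r z| ≤ C) (hC' : ∀ z, |fderiv ℝ r z u| ≤ C') :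
    |(inner ℂ f (mulR r g)).re| ≤ C' * ‖f‖ ^ 2 := by
  have hd : ∀ z, fderiv ℝ (fun z => (r z : ℂ)) z u = (fderiv ℝ r z u : ℂ) := fun z =>
    fderiv_ofReal_apply (hr.differentiable one_ne_zero z) u
  have hw := h.bddMul (m := fun z => (r z : ℂ)) (Complex.ofRealCLM.contDiff.comp hr) (C := C) (C' := C')
    (fun z => (Complex.norm_real _).trans_le (hC z))
    (fun z => by rw [hd, Complex.norm_real]; exact hC' z)
  have key := hw.inner_eq_neg h
  simp_rw [hd] at key
  change inner ℂ (mulR r f) g = - inner ℂ (mulR r g + mulR (fun z => fderiv ℝ r z u) f) f at key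
  rw [inner_mulR_left hr.continuous hC, inner_add_left] at key
  have h1 : (inner ℂ (mulR r g) f).re = (inner ℂ f (mulR r g)).re := by
    rw [← inner_conj_symm, Complex.conj_re]
  have h2 := congrArg Complex.re key
  rw [Complex.neg_re, Complex.add_re, h1] at h2
  have hdc : Continuous fun z => fderiv ℝ r z u :=
    (hr.continuous_fderiv one_ne_zero).clm_apply continuous_const
  have h3 : |(inner ℂ (mulR (fun z => fderiv ℝ r z u) f) f).re| ≤ C' * ‖f‖ ^ 2 := by
    refine (Complex.abs_re_le_norm _).trans ((norm_inner_le_norm _ _).trans ?_)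
    have := mul_le_mul_of_nonneg_right (norm_mulR_le hdc hC' f) (norm_nonneg f)
    linarith [this, sq ‖f‖, mul_assoc C' ‖f‖ ‖f‖]
  -- Skew-adjointness of the derivative gives Re ⟨f, r g⟩ = −½ Re ⟨(∂r) f, f⟩; the factor ½ is not
  -- kept in the conclusion.
  have h4 : |(inner ℂ f (mulR r g)).re| = |(inner ℂ (mulR (fun z => fderiv ℝ r z u) f) f).re| / 2 := by
    rw [← abs_neg, ← abs_two (α := ℝ), ← abs_div]
    congr 1
    linarith
  rw [h4]
  linarith [abs_nonneg (inner ℂ (mulR (fun z => fderiv ℝ r z u) f) f).re]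

theorem norm_sq_eq_integral (f : L2 d) : ‖f‖ ^ 2 = ∫ z, ‖f z‖ ^ 2 := by
  have h : inner ℂ f f = ((∫ z, ‖f z‖ ^ 2 : ℝ) : ℂ) := by
    rw [MeasureTheory.L2.inner_def]
    refine Eq.trans (integral_congr_ae (Eventually.of_forall fun z => ?_))
      (integral_ofReal (𝕜 := ℂ))
    simp only
    rw [inner_self_eq_norm_sq_to_K]
    simp
  rw [norm_sq_eq_re_inner (𝕜 := ℂ), h]
  rfl

theorem tendsto_mulR {r : ℕ → PhaseSpace d → ℝ} (hr : ∀ n, Continuous (r n))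
    (h1 : ∀ n z, |r n z| ≤ 1) (hlim : ∀ z, Tendsto (fun n => r n z) atTop (𝓝 1)) (f : L2 d) :
    Tendsto (fun n => mulR (r n) f) atTop (𝓝 f) := by
  rw [tendsto_iff_norm_sub_tendsto_zero]
  have hsq : Tendsto (fun n => ‖mulR (r n) f - f‖ ^ 2) atTop (𝓝 0) := by
    have e : ∀ n, ‖mulR (r n) f - f‖ ^ 2 = ∫ z, (r n z - 1) ^ 2 * ‖f z‖ ^ 2 := by
      intro n
      rw [norm_sq_eq_integral]
      refine integral_congr_ae ?_
      filter_upwards [coeFn_mulR (hr n) (h1 n) f, Lp.coeFn_sub (mulR (r n) f) f] with z hz hz2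
      rw [hz2, Pi.sub_apply, hz]
      have : (r n z : ℂ) * f z - f z = ((r n z - 1 : ℝ) : ℂ) * f z := by push_cast; ring
      rw [this, norm_mul, Complex.norm_real, mul_pow, Real.norm_eq_abs, sq_abs]
    simp_rw [e]
    have h0 : ∫ z, (0 : ℝ) * ‖f z‖ ^ 2 = 0 := by simp
    rw [← h0]
    refine tendsto_integral_of_dominated_convergence (fun z => 4 * ‖f z‖ ^ 2) (fun n => ?_)
      ((integrable_norm_sq f).const_mul 4) (fun n => ?_) ?_
    · exact ((((hr n).sub continuous_const).pow 2).aestronglyMeasurable).mul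
        (integrable_norm_sq f).aestronglyMeasurable
    · refine Eventually.of_forall fun z => ?_
      rw [Real.norm_eq_abs, abs_of_nonneg (by positivity)]
      refine mul_le_mul_of_nonneg_right ?_ (by positivity)
      have := abs_le.1 (h1 n z)
      nlinarith
    · refine Eventually.of_forall fun z => ?_
      have := (((hlim z).sub_const 1).pow 2).mul_const (‖f z‖ ^ 2)
      simpa using this
  have := hsq.sqrt
  simpa using this

end Real

/-! ### Velocity cutoffs -/

section Cutoff

variable {d : ℕ}

/-- The reference bump function in velocity. -/
def velocityBump (d : ℕ) : ContDiffBump (0 : EuclideanSpace ℝ (Fin d)) :=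
  ⟨1, 2, one_pos, one_lt_two⟩

/-- A smooth cutoff in the velocity, equal to one for `|v| ≤ R` and to zero for `|v| ≥ 2 R`. -/
def velCutoff (R : ℝ) (z : PhaseSpace d) : ℝ := velocityBump d (R⁻¹ • z.2)

theorem contDiff_velCutoff (R : ℝ) : ContDiff ℝ ((⊤ : ℕ∞) : WithTop ℕ∞) (velCutoff (d := d) R) :=
  (velocityBump d).contDiff.comp (contDiff_snd.const_smul R⁻¹)

theorem velCutoff_nonneg (R : ℝ) (z : PhaseSpace d) : 0 ≤ velCutoff R z := (velocityBump d).nonneg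

theorem velCutoff_le_one (R : ℝ) (z : PhaseSpace d) : velCutoff R z ≤ 1 := (velocityBump d).le_one

theorem abs_velCutoff_le_one (R : ℝ) (z : PhaseSpace d) : |velCutoff R z| ≤ 1 := by
  rw [abs_of_nonneg (velCutoff_nonneg R z)]; exact velCutoff_le_one R z

theorem velCutoff_eq_one {R : ℝ} (hR : 0 < R) {z : PhaseSpace d} (h : ‖z.2‖ ≤ R) :
    velCutoff R z = 1 := by
  refine (velocityBump d).one_of_mem_closedBall ?_
  rw [mem_closedBall_zero_iff, norm_smul, norm_inv, Real.norm_eq_abs, abs_of_pos hR]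
  change R⁻¹ * ‖z.2‖ ≤ 1
  rw [inv_mul_le_iff₀ hR, mul_one]
  exact h

theorem velCutoff_eq_zero {R : ℝ} (hR : 0 < R) {z : PhaseSpace d} (h : 2 * R ≤ ‖z.2‖) :
    velCutoff R z = 0 := by
  refine (velocityBump d).zero_of_le_dist ?_
  rw [dist_zero_right, norm_smul, norm_inv, Real.norm_eq_abs, abs_of_pos hR]
  change 2 ≤ R⁻¹ * ‖z.2‖
  rw [le_inv_mul_iff₀ hR, mul_comm]
  exact h

theorem abs_velCutoff_mul_le {R : ℝ} (hR : 0 < R) (z : PhaseSpace d) (i : Fin d) :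
    |velCutoff R z * z.2 i| ≤ 2 * R := by
  rcases le_or_gt (2 * R) ‖z.2‖ with h | h
  · rw [velCutoff_eq_zero hR h, zero_mul, abs_zero]; positivity
  · rw [abs_mul]
    have h1 : |z.2 i| ≤ ‖z.2‖ := PiLp.norm_apply_le z.2 i
    nlinarith [abs_velCutoff_le_one R z, abs_nonneg (velCutoff R z), abs_nonneg (z.2 i)]

theorem tendsto_velCutoff (z : PhaseSpace d) :
    Tendsto (fun n : ℕ => velCutoff ((n : ℝ) + 1) z) atTop (𝓝 1) := by
  refine tendsto_const_nhds.congr' ?_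
  obtain ⟨N, hN⟩ := exists_nat_ge ‖z.2‖
  filter_upwards [eventually_ge_atTop N] with n hn
  refine (velCutoff_eq_one (by positivity) ?_).symm
  have : (N : ℝ) ≤ n := by exact_mod_cast hn
  linarith

theorem fderiv_snd_dep {F : Type*} [NormedAddCommGroup F] [NormedSpace ℝ F]
    {h : EuclideanSpace ℝ (Fin d) → F} {z : PhaseSpace d} (hd : DifferentiableAt ℝ h z.2)
    (u : PhaseSpace d) : fderiv ℝ (fun z : PhaseSpace d => h z.2) z u = fderiv ℝ h z.2 u.2 := by
  have := (hd.hasFDerivAt.comp z (hasFDerivAt_snd (𝕜 := ℝ) (E := EuclideanSpace ℝ (Fin d))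
    (F := EuclideanSpace ℝ (Fin d)) (p := z))).fderiv
  exact (congrArg (fun L => L u) this).trans rfl

theorem norm_coordDir_le (j : Fin d ⊕ Fin d) : ‖coordDir d j‖ ≤ 1 := by
  rcases j with i | i <;> simp [coordDir]

/-- The gradient of the cutoff is of size `1 / R`. -/
theorem exists_fderiv_velCutoff_le (d : ℕ) : ∃ A : ℝ, 0 ≤ A ∧ ∀ R : ℝ, 0 < R →
    ∀ (z : PhaseSpace d) j, |fderiv ℝ (velCutoff R) z (coordDir d j)| ≤ A / R := by
  obtain ⟨A, hA⟩ := ((velocityBump d).contDiff (n := 1)).continuous_fderiv one_ne_zero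
    |>.bounded_above_of_compact_support ((velocityBump d).hasCompactSupport.fderiv (𝕜 := ℝ))
  refine ⟨A, (norm_nonneg _).trans (hA 0), fun R hR z j => ?_⟩
  have hb : Differentiable ℝ (velocityBump d) :=
    ((velocityBump d).contDiff (n := 1)).differentiable one_ne_zero
  have h1 : HasFDerivAt (fun z : PhaseSpace d => R⁻¹ • z.2)
      (R⁻¹ • ContinuousLinearMap.snd ℝ _ _) z := (hasFDerivAt_snd (p := z)).const_smul R⁻¹
  have h2 := ((hb (R⁻¹ • z.2)).hasFDerivAt.comp z h1).fderiv
  have h3 : fderiv ℝ (velCutoff R) z (coordDir d j) =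
      R⁻¹ * fderiv ℝ (velocityBump d) (R⁻¹ • z.2) (coordDir d j).2 := by
    refine (congrArg (fun L => L (coordDir d j)) h2).trans ?_
    simp
  rw [h3, abs_mul, abs_of_pos (inv_pos.2 hR), div_eq_inv_mul]
  refine mul_le_mul_of_nonneg_left ?_ (inv_pos.2 hR).le
  rw [← Real.norm_eq_abs]
  refine (ContinuousLinearMap.le_opNorm _ _).trans ?_
  have h4 : ‖(coordDir d j).2‖ ≤ 1 := (norm_snd_le _).trans (norm_coordDir_le j)
  have h5 := hA (R⁻¹ • z.2)
  have h6 : (0 : ℝ) ≤ A := (norm_nonneg _).trans (hA 0)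
  calc _ ≤ A * 1 := mul_le_mul h5 h4 (norm_nonneg _) h6
    _ = A := mul_one A

end Cutoff

/-! ### The localized right-hand side -/

section CutRHS

variable {d : ℕ} {Γ : EuclideanSpace ℝ (Fin d) → ℝ} {C : ℝ}

/-- The right-hand side of the equation localized in the velocity, as an element of `L²`. -/
def cutRHS (Γ : EuclideanSpace ℝ (Fin d) → ℝ) (R : ℝ) (a : W12 d) : L2 d :=
  ∑ i, (mulR (fun z => -(velCutoff R z * z.2 i)) (a.dx i)
    + mulR (fun z => velCutoff R z * fieldConv Γ a i z.1) (a.dv i))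
    - mulL2 (fun z => (velCutoff R z : ℂ) * bracketConv Γ a z.1) a.toL2

theorem continuous_velCutoff_mul_coord (R : ℝ) (i : Fin d) :
    Continuous fun z : PhaseSpace d => -(velCutoff R z * z.2 i) :=
  ((contDiff_velCutoff R).continuous.mul ((EuclideanSpace.proj (𝕜 := ℝ) i).continuous.comp
    continuous_snd)).neg

theorem abs_neg_velCutoff_mul_le {R : ℝ} (hR : 0 < R) (i : Fin d) (z : PhaseSpace d) :
    |-(velCutoff R z * z.2 i)| ≤ 2 * R := by
  rw [abs_neg]; exact abs_velCutoff_mul_le hR z i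

theorem continuous_velCutoff_mul_field (h : PotentialBound Γ C) (R : ℝ) (a : W12 d) (i : Fin d) :
    Continuous fun z : PhaseSpace d => velCutoff R z * fieldConv Γ a i z.1 :=
  (contDiff_velCutoff R).continuous.mul ((contDiff_fieldConv h a i).continuous.comp continuous_fst)

theorem abs_velCutoff_mul_field_le (h : PotentialBound Γ C) (R : ℝ) (a : W12 d) (i : Fin d)
    (z : PhaseSpace d) : |velCutoff R z * fieldConv Γ a i z.1| ≤ C * ‖a.toL2‖ ^ 2 := by
  rw [abs_mul]
  refine (mul_le_of_le_one_left (abs_nonneg _) (abs_velCutoff_le_one R z)).trans ?_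
  exact abs_fieldConv_le h a i _

theorem continuous_velCutoff_mul_bracket (h : PotentialBound Γ C) (R : ℝ) (a : W12 d) :
    Continuous fun z : PhaseSpace d => (velCutoff R z : ℂ) * bracketConv Γ a z.1 :=
  (Complex.continuous_ofReal.comp (contDiff_velCutoff R).continuous).mul
    ((contDiff_bracketConv h a).continuous.comp continuous_fst)

theorem norm_velCutoff_mul_le (R : ℝ) (z : PhaseSpace d) (w : ℂ) :
    ‖(velCutoff R z : ℂ) * w‖ ≤ ‖w‖ := by
  rw [norm_mul, Complex.norm_real]
  exact mul_le_of_le_one_left (norm_nonneg _) (abs_velCutoff_le_one R z)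

theorem norm_velCutoff_mul_bracket_le (h : PotentialBound Γ C) (R : ℝ) (a : W12 d)
    (z : PhaseSpace d) :
    ‖(velCutoff R z : ℂ) * bracketConv Γ a z.1‖ ≤ d * (C * (‖a.toL2‖ * ‖a‖)) :=
  (norm_velCutoff_mul_le R z _).trans (norm_bracketConv_le h a _)

/-- The full right-hand side may fail to be in L² because of the factor v. After multiplication by
the cutoff all coefficients are bounded, and the product is an honest element of L². -/
theorem coeFn_cutRHS (h : PotentialBound Γ C) {R : ℝ} (hR : 0 < R) (a : W12 d) :
    cutRHS Γ R a =ᵐ[volume] fun z => (velCutoff R z : ℂ) * hvlRHS Γ a z := by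
  have h1 : ∀ᵐ z, ∀ i, mulR (fun z => -(velCutoff R z * z.2 i)) (a.dx i) z =
      ((-(velCutoff R z * z.2 i) : ℝ) : ℂ) * a.dx i z := ae_all_iff.2 fun i =>
    coeFn_mulR (continuous_velCutoff_mul_coord R i) (abs_neg_velCutoff_mul_le hR i) _
  have h2 : ∀ᵐ z, ∀ i, mulR (fun z => velCutoff R z * fieldConv Γ a i z.1) (a.dv i) z =
      ((velCutoff R z * fieldConv Γ a i z.1 : ℝ) : ℂ) * a.dv i z := ae_all_iff.2 fun i =>
    coeFn_mulR (continuous_velCutoff_mul_field h R a i) (abs_velCutoff_mul_field_le h R a i) _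
  have h3 := coeFn_mulL2 (continuous_velCutoff_mul_bracket h R a)
    (norm_velCutoff_mul_bracket_le h R a) a.toL2
  have h4 : ∀ᵐ z, ∀ i, (mulR (fun z => -(velCutoff R z * z.2 i)) (a.dx i)
    + mulR (fun z => velCutoff R z * fieldConv Γ a i z.1) (a.dv i) : L2 d) z = _ :=
    ae_all_iff.2 fun i => Lp.coeFn_add _ _
  have h5 := Lp.coeFn_finsetSum Finset.univ
    (fun i => (mulR (fun z => -(velCutoff R z * z.2 i)) (a.dx i)
    + mulR (fun z => velCutoff R z * fieldConv Γ a i z.1) (a.dv i) : L2 d))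
  have h6 := Lp.coeFn_sub (∑ i, (mulR (fun z => -(velCutoff R z * z.2 i)) (a.dx i)
    + mulR (fun z => velCutoff R z * fieldConv Γ a i z.1) (a.dv i) : L2 d))
    (mulL2 (fun z => (velCutoff R z : ℂ) * bracketConv Γ a z.1) a.toL2)
  filter_upwards [h1, h2, h3, h4, h5, h6] with z h1 h2 h3 h4 h5 h6
  refine h6.trans ?_
  rw [Pi.sub_apply, h5, h3, Finset.sum_apply, hvlRHS, mul_sub, Finset.mul_sum]
  congr 1
  · refine Finset.sum_congr rfl fun i _ => ?_
    rw [h4 i, Pi.add_apply, h1, h2]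
    push_cast; ring
  · ring

theorem norm_cutRHS_le (h : PotentialBound Γ C) {R : ℝ} (hR : 0 < R) (a : W12 d) :
    ‖cutRHS Γ R a‖ ≤ (d * (2 * R) + d * (2 * C) * ‖a.toL2‖ ^ 2) * ‖a‖ := by
  have h0 : ‖∑ i, (mulR (fun z => -(velCutoff R z * z.2 i)) (a.dx i)
    + mulR (fun z => velCutoff R z * fieldConv Γ a i z.1) (a.dv i))‖ ≤
      d * (2 * R * ‖a‖ + C * ‖a.toL2‖ ^ 2 * ‖a‖) := by
    refine (norm_sum_le _ _).trans (sum_fin_le fun i => (norm_add_le _ _).trans (add_le_add ?_ ?_))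
    · exact (norm_mulR_le (continuous_velCutoff_mul_coord R i) (abs_neg_velCutoff_mul_le hR i)
        _).trans (mul_le_mul_of_nonneg_left (a.norm_dx_le i) (by positivity))
    · exact (norm_mulR_le (continuous_velCutoff_mul_field h R a i) (abs_velCutoff_mul_field_le h R a i)
        _).trans (mul_le_mul_of_nonneg_left (a.norm_dv_le i) (mul_nonneg h.nonneg (sq_nonneg _)))
  have h1 := norm_mulL2_le (continuous_velCutoff_mul_bracket h R a)
    (norm_velCutoff_mul_bracket_le h R a) a.toL2
  refine (norm_sub_le _ _).trans ((add_le_add h0 h1).trans (le_of_eq ?_))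
  ring

/-- Needed for the strong measurability of s ↦ `cutRHS Γ R (α s)` along a measurable curve in
W^{1,2}. -/
theorem continuous_cutRHS (h : PotentialBound Γ C) {R : ℝ} (hR : 0 < R) :
    Continuous (cutRHS Γ R) := by
  refine Continuous.sub (continuous_finsetSum _ fun i _ => Continuous.add ?_ ?_) ?_
  · refine continuous_iff_continuousAt.2 fun a => ?_
    refine tendsto_iff_norm_sub_tendsto_zero.2 ?_
    have hl : Tendsto (fun b : W12 d => 2 * R * ‖b - a‖) (𝓝 a) (𝓝 0) := by
      have : Continuous fun b : W12 d => 2 * R * ‖b - a‖ := by fun_prop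
      simpa using this.tendsto a
    refine squeeze_zero (fun _ => norm_nonneg _) (fun b => ?_) hl
    have hc := continuous_velCutoff_mul_coord (d := d) R i
    have e := mulL2_sub (m := fun z => ((-(velCutoff R z * z.2 i) : ℝ) : ℂ))
      (Complex.continuous_ofReal.comp hc) (C := 2 * R)
      (fun z => (Complex.norm_real _).trans_le (abs_neg_velCutoff_mul_le hR i z)) (b.dx i) (a.dx i)
    refine (congrArg norm e).symm.trans_le ((norm_mulR_le hc (abs_neg_velCutoff_mul_le hR i) _).trans ?_)
    exact mul_le_mul_of_nonneg_left ((b - a).norm_dx_le i) (by positivity)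
  · refine continuous_iff_continuousAt.2 fun a => ?_
    refine tendsto_iff_norm_sub_tendsto_zero.2 ?_
    have hl : Tendsto (fun b : W12 d => C * (‖b.toL2 - a.toL2‖ * (‖b.toL2‖ + ‖a.toL2‖)) * ‖b.dv i‖ +
        C * ‖a.toL2‖ ^ 2 * ‖b.dv i - a.dv i‖) (𝓝 a) (𝓝 0) := by
      have h1 := W12.continuous_toL2 (d := d)
      have h2 : Continuous fun b : W12 d => b.dv i := W12.continuous_deriv (Sum.inr i)
      have : Continuous (fun b : W12 d => C * (‖b.toL2 - a.toL2‖ * (‖b.toL2‖ + ‖a.toL2‖)) * ‖b.dv i‖ +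
        C * ‖a.toL2‖ ^ 2 * ‖b.dv i - a.dv i‖) := by fun_prop
      simpa using this.tendsto a
    refine squeeze_zero (fun _ => norm_nonneg _) (fun b => ?_) hl
    refine norm_mulL2_sub_mulL2_le
      (Complex.continuous_ofReal.comp (continuous_velCutoff_mul_field h R b i))
      (Complex.continuous_ofReal.comp (continuous_velCutoff_mul_field h R a i))
      (fun z => (Complex.norm_real _).trans_le (abs_velCutoff_mul_field_le h R b i z))
      (fun z => (Complex.norm_real _).trans_le (abs_velCutoff_mul_field_le h R a i z))
      (fun z => ?_) _ _
    simp only [Function.comp]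
    rw [← Complex.ofReal_sub, Complex.norm_real, ← mul_sub, Real.norm_eq_abs, abs_mul]
    exact (mul_le_of_le_one_left (abs_nonneg _) (abs_velCutoff_le_one R z)).trans
      (abs_fieldConv_sub_le h b a i _)
  · refine continuous_iff_continuousAt.2 fun a => ?_
    refine tendsto_iff_norm_sub_tendsto_zero.2 ?_
    have hl : Tendsto (fun b : W12 d => d * (C * (‖b.toL2 - a.toL2‖ * (‖b‖ + ‖a‖))) * ‖b.toL2‖ +
        d * (C * (‖a.toL2‖ * ‖a‖)) * ‖b.toL2 - a.toL2‖) (𝓝 a) (𝓝 0) := by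
      have h1 := W12.continuous_toL2 (d := d)
      have : Continuous (fun b : W12 d => d * (C * (‖b.toL2 - a.toL2‖ * (‖b‖ + ‖a‖))) * ‖b.toL2‖ +
        d * (C * (‖a.toL2‖ * ‖a‖)) * ‖b.toL2 - a.toL2‖) := by fun_prop
      simpa using this.tendsto a
    refine squeeze_zero (fun _ => norm_nonneg _) (fun b => ?_) hl
    refine norm_mulL2_sub_mulL2_le (continuous_velCutoff_mul_bracket h R b)
      (continuous_velCutoff_mul_bracket h R a) (norm_velCutoff_mul_bracket_le h R b)
      (norm_velCutoff_mul_bracket_le h R a) (fun z => ?_) _ _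
    rw [← mul_sub]
    exact (norm_velCutoff_mul_le R z _).trans (norm_bracketConv_sub_le h b a _)

theorem abs_re_inner_le {f g : L2 d} : |(inner ℂ f g).re| ≤ ‖f‖ * ‖g‖ :=
  (Complex.abs_re_le_norm _).trans (norm_inner_le_norm _ _)

/-- The one-sided Lipschitz estimate for the localized right-hand side. -/
theorem exists_re_inner_cutRHS_le (h : PotentialBound Γ C) : ∃ A : ℝ, 0 ≤ A ∧
    ∀ (R : ℝ), 0 < R → ∀ (a b : W12 d) (m : ℝ), ‖a.toL2‖ ≤ m → ‖b.toL2‖ ≤ m →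
    (inner ℂ (mulR (velCutoff R) (a.toL2 - b.toL2)) (cutRHS Γ R a - cutRHS Γ R b)).re ≤
      (A * m ^ 2 / R + A * m * (‖a‖ + ‖b‖)) * ‖a.toL2 - b.toL2‖ ^ 2 := by
  obtain ⟨A₀, hA₀, hgrad⟩ := exists_fderiv_velCutoff_le d
  have hC := h.nonneg
  -- The part 2 A₀ comes from the gradient of the squared cutoff; the 4 generously covers the three
  -- remaining terms, whose coefficients add up to at most 3.
  refine ⟨d * C * (2 * A₀ + 4), by positivity, fun R hR a b m ha hb => ?_⟩
  have hm0 : 0 ≤ m := (norm_nonneg _).trans ha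
  set γ : W12 d := a - b with hγ
  have hχ := (contDiff_velCutoff (d := d) R)
  have hχ1 : ContDiff ℝ 1 (velCutoff (d := d) R) := hχ.of_le (by exact_mod_cast le_top)
  have hu : ‖mulR (velCutoff R) γ.toL2‖ ≤ ‖γ.toL2‖ := by
    simpa using norm_mulR_le hχ.continuous (abs_velCutoff_le_one R) γ.toL2
  set u := mulR (velCutoff R) γ.toL2 with hu_def
  set N := ‖γ.toL2‖ with hN
  have hN0 : 0 ≤ N := norm_nonneg _
  have hcx := fun i => continuous_velCutoff_mul_coord (d := d) R i
  have hcE := fun (a : W12 d) i => continuous_velCutoff_mul_field h R a i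
  have hbE := fun (a : W12 d) i => abs_velCutoff_mul_field_le h R a i
  have hcK := fun (a : W12 d) => continuous_velCutoff_mul_bracket h R a
  have hbK := fun (a : W12 d) => norm_velCutoff_mul_bracket_le h R a
  have hdiffE : ∀ i, Continuous fun z : PhaseSpace d =>
      velCutoff R z * fieldConv Γ a i z.1 - velCutoff R z * fieldConv Γ b i z.1 := fun i =>
    (hcE a i).sub (hcE b i)
  -- The operator with the coefficients of a acts on γ, and the differences of coefficients act on
  -- b.
  have decomp : cutRHS Γ R a - cutRHS Γ R b =
      ∑ i, (mulR (fun z => -(velCutoff R z * z.2 i)) (γ.dx i)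
        + mulR (fun z => velCutoff R z * fieldConv Γ a i z.1) (γ.dv i)
        + mulR (fun z => velCutoff R z * fieldConv Γ a i z.1 - velCutoff R z * fieldConv Γ b i z.1)
          (b.dv i))
      - mulL2 (fun z => (velCutoff R z : ℂ) * bracketConv Γ a z.1) γ.toL2
      - mulL2 (fun z => (velCutoff R z : ℂ) * bracketConv Γ a z.1 -
          (velCutoff R z : ℂ) * bracketConv Γ b z.1) b.toL2 := by
    have e1 : ∀ i, mulR (fun z => -(velCutoff R z * z.2 i)) (γ.dx i) =
        mulR (fun z => -(velCutoff R z * z.2 i)) (a.dx i) -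
        mulR (fun z => -(velCutoff R z * z.2 i)) (b.dx i) := fun i =>
      mulL2_sub (m := fun z => ((-(velCutoff R z * z.2 i) : ℝ) : ℂ))
        (Complex.continuous_ofReal.comp (hcx i)) (C := 2 * R)
        (fun z => (Complex.norm_real _).trans_le (abs_neg_velCutoff_mul_le hR i z)) _ _
    have e2 : ∀ i, mulR (fun z => velCutoff R z * fieldConv Γ a i z.1) (γ.dv i) =
        mulR (fun z => velCutoff R z * fieldConv Γ a i z.1) (a.dv i) -
        mulR (fun z => velCutoff R z * fieldConv Γ a i z.1) (b.dv i) := fun i =>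
      mulL2_sub (m := fun z => ((velCutoff R z * fieldConv Γ a i z.1 : ℝ) : ℂ))
        (Complex.continuous_ofReal.comp (hcE a i))
        (fun z => (Complex.norm_real _).trans_le (hbE a i z)) _ _
    have e3 : ∀ i, mulR (fun z => velCutoff R z * fieldConv Γ a i z.1 -
          velCutoff R z * fieldConv Γ b i z.1) (b.dv i) =
        mulR (fun z => velCutoff R z * fieldConv Γ a i z.1) (b.dv i) -
        mulR (fun z => velCutoff R z * fieldConv Γ b i z.1) (b.dv i) := fun i => by
      rw [mulR, mulR, mulR, ← sub_mulL2
        (m := fun z => ((velCutoff R z * fieldConv Γ a i z.1 : ℝ) : ℂ))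
        (m' := fun z => ((velCutoff R z * fieldConv Γ b i z.1 : ℝ) : ℂ))
        (Complex.continuous_ofReal.comp (hcE a i))
        (Complex.continuous_ofReal.comp (hcE b i))
        (fun z => (Complex.norm_real _).trans_le (hbE a i z))
        (fun z => (Complex.norm_real _).trans_le (hbE b i z))]
      congr 1; ext z; push_cast; rfl
    have e4 : mulL2 (fun z => (velCutoff R z : ℂ) * bracketConv Γ a z.1) γ.toL2 =
        mulL2 (fun z => (velCutoff R z : ℂ) * bracketConv Γ a z.1) a.toL2 -
        mulL2 (fun z => (velCutoff R z : ℂ) * bracketConv Γ a z.1) b.toL2 :=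
      mulL2_sub (hcK a) (hbK a) _ _
    rw [e4, sub_mulL2 (hcK a) (hcK b) (hbK a) (hbK b)]
    simp_rw [e1, e2, e3]
    simp only [cutRHS, Finset.sum_add_distrib, Finset.sum_sub_distrib]
    abel
  have hmul : ∀ (r : PhaseSpace d → ℝ) (hr : Continuous r) (B : ℝ) (hB : ∀ z, |r z| ≤ B) (f : L2 d),
      inner ℂ u (mulR r f) = inner ℂ γ.toL2 (mulR (fun z => velCutoff R z * r z) f) := by
    intro r hr B hB f
    rw [hu_def, inner_mulR_left hχ.continuous (abs_velCutoff_le_one R), mulR, mulR,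
      ← mulR, mulR_mulL2 (m := fun z => (r z : ℂ)) hχ.continuous
      (Complex.continuous_ofReal.comp hr) (abs_velCutoff_le_one R)
      (fun z => (Complex.norm_real _).trans_le (hB z))]
    congr 2; ext z; push_cast; rfl
  -- The combined weight −χ² v_i is a function of v, so its x_i-derivative is zero and free
  -- transport drops out exactly, however large R is.
  have t1 : ∀ i, |(inner ℂ u (mulR (fun z => -(velCutoff R z * z.2 i)) (γ.dx i))).re| ≤ 0 := by
    intro i
    rw [hmul _ (hcx i) _ (abs_neg_velCutoff_mul_le hR i)]
    have hdep : ContDiff ℝ 1 fun v : EuclideanSpace ℝ (Fin d) =>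
        velocityBump d (R⁻¹ • v) * -(velocityBump d (R⁻¹ • v) * v i) :=
      have h1 : ContDiff ℝ 1 fun v : EuclideanSpace ℝ (Fin d) => velocityBump d (R⁻¹ • v) :=
        (velocityBump d).contDiff.comp (contDiff_id.const_smul R⁻¹)
      h1.mul (h1.mul (EuclideanSpace.proj (𝕜 := ℝ) i).contDiff).neg
    have := (γ.hasWeakDeriv (Sum.inl i)).abs_re_inner_mulR_le
      (r := fun z => velCutoff R z * -(velCutoff R z * z.2 i)) (hdep.comp contDiff_snd)
      (C := 1 * (2 * R)) (C' := 0) (fun z => by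
        rw [abs_mul]
        exact mul_le_mul (abs_velCutoff_le_one R z) (abs_neg_velCutoff_mul_le hR i z)
          (abs_nonneg _) zero_le_one)
      (fun z => by
        have := fderiv_snd_dep (z := z) (hdep.differentiable one_ne_zero _) (coordDir d (Sum.inl i))
        refine le_of_eq (abs_eq_zero.2 (Eq.trans this ?_))
        simp [coordDir])
    rw [zero_mul] at this
    exact this
  -- The field is a function of x, so the v_i-derivative of χ² E_i only involves the cutoff and is
  -- O(1/R).
  have t2 : ∀ i, |(inner ℂ u (mulR (fun z => velCutoff R z * fieldConv Γ a i z.1) (γ.dv i))).re| ≤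
      2 * (A₀ / R) * (C * m ^ 2) * N ^ 2 := by
    intro i
    rw [hmul _ (hcE a i) _ (hbE a i)]
    have hE1 : ContDiff ℝ 1 fun z : PhaseSpace d => fieldConv Γ a i z.1 :=
      ((contDiff_fieldConv h a i).of_le one_le_two).comp contDiff_fst
    have hEm : ∀ x, |fieldConv Γ a i x| ≤ C * m ^ 2 := fun x =>
      (abs_fieldConv_le h a i x).trans
        (mul_le_mul_of_nonneg_left (pow_le_pow_left₀ (norm_nonneg _) ha 2) hC)
    refine (γ.hasWeakDeriv (Sum.inr i)).abs_re_inner_mulR_le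
      (r := fun z => velCutoff R z * (velCutoff R z * fieldConv Γ a i z.1))
      (hχ1.mul (hχ1.mul hE1)) (C := 1 * (C * ‖a.toL2‖ ^ 2)) (fun z => ?_) (fun z => ?_)
    · rw [abs_mul]
      exact mul_le_mul (abs_velCutoff_le_one R z) (hbE a i z) (abs_nonneg _) zero_le_one
    · have dχ := (hχ1.differentiable one_ne_zero z).hasFDerivAt
      have dE := (hE1.differentiable one_ne_zero z).hasFDerivAt
      have hfd := (dχ.mul (dχ.mul dE)).fderiv
      have hfd' : fderiv ℝ (fun z => velCutoff R z * (velCutoff R z * fieldConv Γ a i z.1)) z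
          (coordDir d (Sum.inr i)) =
          2 * velCutoff R z * fderiv ℝ (velCutoff R) z (coordDir d (Sum.inr i)) *
            fieldConv Γ a i z.1 := by
        refine (congrArg (fun L => L (coordDir d (Sum.inr i))) hfd).trans ?_
        have h0 : fderiv ℝ (fun z : PhaseSpace d => fieldConv Γ a i z.1) z
            (coordDir d (Sum.inr i)) = 0 := by
          rw [fderiv_fst_dep (((contDiff_fieldConv h a i).differentiable two_ne_zero) _)]
          simp [coordDir]
        simp only [add_apply, smul_apply, smul_eq_mul, h0, Pi.mul_apply]
        ring
      rw [hfd', abs_mul, abs_mul, abs_mul, abs_two]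
      have g1 := hgrad R hR z (Sum.inr i)
      have g2 := hEm z.1
      have g3 : 2 * |velCutoff R z| ≤ 2 := by linarith [abs_velCutoff_le_one R z]
      exact mul_le_mul (mul_le_mul g3 g1 (abs_nonneg _) zero_le_two) g2 (abs_nonneg _)
        (by positivity)
  have t3 : ∀ i, |(inner ℂ u (mulR (fun z => velCutoff R z * fieldConv Γ a i z.1 -
      velCutoff R z * fieldConv Γ b i z.1) (b.dv i))).re| ≤ C * (2 * m) * ‖b‖ * N ^ 2 := by
    intro i
    refine abs_re_inner_le.trans ?_
    have h1 := norm_mulR_le (hdiffE i) (C := C * (N * (2 * m))) (fun z => by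
      rw [← mul_sub, abs_mul]
      refine (mul_le_of_le_one_left (abs_nonneg _) (abs_velCutoff_le_one R z)).trans
        ((abs_fieldConv_sub_le h a b i z.1).trans (mul_le_mul_of_nonneg_left
          (mul_le_mul_of_nonneg_left ?_ hN0) hC))
      linarith) (b.dv i)
    have h2 : C * (N * (2 * m)) * ‖b.dv i‖ ≤ C * (N * (2 * m)) * ‖b‖ :=
      mul_le_mul_of_nonneg_left (b.norm_dv_le i) (by positivity)
    calc _ ≤ N * (C * (N * (2 * m)) * ‖b‖) := mul_le_mul hu (h1.trans h2) (norm_nonneg _) hN0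
      _ = _ := by ring
  have t4 : |(inner ℂ u (mulL2 (fun z => (velCutoff R z : ℂ) * bracketConv Γ a z.1) γ.toL2)).re| ≤
      d * (C * (m * ‖a‖)) * N ^ 2 := by
    refine abs_re_inner_le.trans ?_
    have h1 := norm_mulL2_le (hcK a) (C := d * (C * (m * ‖a‖))) (fun z => (hbK a z).trans (by
      gcongr)) γ.toL2
    calc _ ≤ N * (d * (C * (m * ‖a‖)) * N) := mul_le_mul hu h1 (norm_nonneg _) hN0
      _ = _ := by ring
  -- This term uses the L² control of K_a − K_b, which supplies the second factor N.
  have t5 : |(inner ℂ u (mulL2 (fun z => (velCutoff R z : ℂ) * bracketConv Γ a z.1 -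
          (velCutoff R z : ℂ) * bracketConv Γ b z.1) b.toL2)).re| ≤
      d * (C * (‖a‖ + ‖b‖)) * m * N ^ 2 := by
    refine abs_re_inner_le.trans ?_
    have h1 := norm_mulL2_le (m := fun z => (velCutoff R z : ℂ) * bracketConv Γ a z.1 -
          (velCutoff R z : ℂ) * bracketConv Γ b z.1) ((hcK a).sub (hcK b)) (C := d * (C * (N * (‖a‖ + ‖b‖)))) (fun z => by
      rw [← mul_sub]
      exact (norm_velCutoff_mul_le R z _).trans (norm_bracketConv_sub_le h a b _)) b.toL2
    have h2 : d * (C * (N * (‖a‖ + ‖b‖))) * ‖b.toL2‖ ≤ d * (C * (N * (‖a‖ + ‖b‖))) * m :=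
      mul_le_mul_of_nonneg_left hb (by positivity)
    calc _ ≤ N * (d * (C * (N * (‖a‖ + ‖b‖))) * m) := mul_le_mul hu (h1.trans h2) (norm_nonneg _) hN0
      _ = _ := by ring
  have hsum : (inner ℂ u (cutRHS Γ R a - cutRHS Γ R b)).re =
      ∑ i, ((inner ℂ u (mulR (fun z => -(velCutoff R z * z.2 i)) (γ.dx i))).re
        + (inner ℂ u (mulR (fun z => velCutoff R z * fieldConv Γ a i z.1) (γ.dv i))).re
        + (inner ℂ u (mulR (fun z => velCutoff R z * fieldConv Γ a i z.1 -
            velCutoff R z * fieldConv Γ b i z.1) (b.dv i))).re)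
      - (inner ℂ u (mulL2 (fun z => (velCutoff R z : ℂ) * bracketConv Γ a z.1) γ.toL2)).re
      - (inner ℂ u (mulL2 (fun z => (velCutoff R z : ℂ) * bracketConv Γ a z.1 -
          (velCutoff R z : ℂ) * bracketConv Γ b z.1) b.toL2)).re := by
    rw [decomp]
    simp only [inner_sub_right, inner_sum, inner_add_right, Complex.sub_re, Complex.re_sum,
      Complex.add_re]
  change (inner ℂ u (cutRHS Γ R a - cutRHS Γ R b)).re ≤ _ * N ^ 2
  rw [hsum]
  have s1 := sum_fin_le (d := d) (f := fun i =>
    ((inner ℂ u (mulR (fun z => -(velCutoff R z * z.2 i)) (γ.dx i))).re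
        + (inner ℂ u (mulR (fun z => velCutoff R z * fieldConv Γ a i z.1) (γ.dv i))).re
        + (inner ℂ u (mulR (fun z => velCutoff R z * fieldConv Γ a i z.1 -
            velCutoff R z * fieldConv Γ b i z.1) (b.dv i))).re))
    (M := 0 + 2 * (A₀ / R) * (C * m ^ 2) * N ^ 2 + C * (2 * m) * ‖b‖ * N ^ 2) fun i =>
      add_le_add (add_le_add ((le_abs_self _).trans (t1 i)) ((le_abs_self _).trans (t2 i)))
        ((le_abs_self _).trans (t3 i))
  have s4 := (neg_le_abs _).trans t4
  have s5 := (neg_le_abs _).trans t5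
  have hfin : d * (0 + 2 * (A₀ / R) * (C * m ^ 2) * N ^ 2 + C * (2 * m) * ‖b‖ * N ^ 2) +
      d * (C * (m * ‖a‖)) * N ^ 2 + d * (C * (‖a‖ + ‖b‖)) * m * N ^ 2 ≤
      (d * C * (2 * A₀ + 4) * m ^ 2 / R + d * C * (2 * A₀ + 4) * m * (‖a‖ + ‖b‖)) * N ^ 2 := by
    have e : (d * C * (2 * A₀ + 4) * m ^ 2 / R + d * C * (2 * A₀ + 4) * m * (‖a‖ + ‖b‖)) * N ^ 2 -
      (d * (0 + 2 * (A₀ / R) * (C * m ^ 2) * N ^ 2 + C * (2 * m) * ‖b‖ * N ^ 2) +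
      d * (C * (m * ‖a‖)) * N ^ 2 + d * (C * (‖a‖ + ‖b‖)) * m * N ^ 2) =
      d * C * 4 * m ^ 2 / R * N ^ 2 + d * C * m * N ^ 2 * (2 * A₀ * (‖a‖ + ‖b‖) + 2 * ‖a‖ + ‖b‖) := by
      field_simp
      ring
    have : 0 ≤ d * C * 4 * m ^ 2 / R * N ^ 2 +
        d * C * m * N ^ 2 * (2 * A₀ * (‖a‖ + ‖b‖) + 2 * ‖a‖ + ‖b‖) := by positivity
    linarith
  linarith

end CutRHS

/-! ### Approximate solutions and their L² stability. -/

variable {d : ℕ} {Γ : EuclideanSpace ℝ (Fin d) → ℝ} {C : ℝ}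

/-- A curve that solves the Hamiltonian Vlasov equation on `[0, T]` up to a defect of size `ε`
in the dual of `L²`. -/
structure IsApproxSolution (Γ : EuclideanSpace ℝ (Fin d) → ℝ) (α : ℝ → W12 d) (T ε : ℝ) :
    Prop where
  continuous_L2 : ContinuousOn (fun t => (α t).toL2) (Set.Icc 0 T)
  integrable_W12 : IntegrableOn α (Set.Icc 0 T)
  equation : ∀ φ : PhaseSpace d → ℝ, IsTestFunction φ → ∀ t ∈ Set.Icc 0 T,
    ‖(∫ z, φ z • (α t).toL2 z) - (∫ z, φ z • (α 0).toL2 z)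
      - ∫ s in (0 : ℝ)..t, ∫ z, φ z • hvlRHS Γ (α s) z‖ ≤ ε * l2norm φ

theorem IsHVlSolution.isApproxSolution {a : W12 d} {α : ℝ → W12 d} (h : IsHVlSolution Γ a α)
    (T : ℝ) : IsApproxSolution Γ α T 0 where
  continuous_L2 := h.continuous_L2.mono Set.Icc_subset_Ici_self
  integrable_W12 := h.integrable_W12 T
  equation φ hφ t ht := by
    rw [h.equation φ hφ t ht.1, h.initial, add_sub_cancel_left, sub_self, norm_zero, zero_mul]

theorem IsApproxSolution.mono {α : ℝ → W12 d} {T ε ε' : ℝ} (h : IsApproxSolution Γ α T ε)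
    (hε : ε ≤ ε') : IsApproxSolution Γ α T ε' where
  continuous_L2 := h.continuous_L2
  integrable_W12 := h.integrable_W12
  equation φ hφ t ht := (h.equation φ hφ t ht).trans
    (mul_le_mul_of_nonneg_right hε (l2norm_nonneg φ))

theorem IsTestFunction.mul_velCutoff {φ : PhaseSpace d → ℝ} (hφ : IsTestFunction φ) (R : ℝ) :
    IsTestFunction fun z => φ z * velCutoff R z :=
  ⟨hφ.smooth.mul (contDiff_velCutoff R), hφ.compact.mul_right⟩

theorem integral_smul_mulR_velCutoff (φ : PhaseSpace d → ℝ) (R : ℝ) (f : L2 d) :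
    ∫ z, φ z • mulR (velCutoff R) f z = ∫ z, (φ z * velCutoff R z) • f z := by
  refine integral_congr_ae ?_
  filter_upwards [coeFn_mulR (contDiff_velCutoff (d := d) R).continuous
    (abs_velCutoff_le_one R) f] with z hz
  rw [hz, mul_smul, Complex.real_smul (x := velCutoff R z)]

theorem integral_smul_cutRHS (h : PotentialBound Γ C) (φ : PhaseSpace d → ℝ) {R : ℝ} (hR : 0 < R)
    (a : W12 d) :
    ∫ z, φ z • cutRHS Γ R a z = ∫ z, (φ z * velCutoff R z) • hvlRHS Γ a z := by
  refine integral_congr_ae ?_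
  filter_upwards [coeFn_cutRHS h hR a] with z hz
  rw [hz, mul_smul, Complex.real_smul (x := velCutoff R z)]

theorem ContinuousOn.exists_norm_le_Icc {E : Type*} [SeminormedAddCommGroup E] {f : ℝ → E} {T : ℝ}
    (h : ContinuousOn f (Set.Icc 0 T)) : ∃ m : ℝ, 0 ≤ m ∧ ∀ t ∈ Set.Icc 0 T, ‖f t‖ ≤ m := by
  obtain ⟨m, hm⟩ := isCompact_Icc.exists_bound_of_continuousOn h
  exact ⟨max m 0, le_max_right _ _, fun t ht => (hm t ht).trans (le_max_left _ _)⟩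

theorem IsApproxSolution.integrableOn_cutRHS (h : PotentialBound Γ C) {α : ℝ → W12 d} {T ε : ℝ}
    (hα : IsApproxSolution Γ α T ε) {R : ℝ} (hR : 0 < R) :
    IntegrableOn (fun s => cutRHS Γ R (α s)) (Set.Icc 0 T) := by
  obtain ⟨m, hm0, hm⟩ := hα.continuous_L2.exists_norm_le_Icc
  have hC := h.nonneg
  refine (hα.integrable_W12.norm.const_mul (d * (2 * R) + d * (2 * C) * m ^ 2)).mono'
    ((continuous_cutRHS h hR).comp_aestronglyMeasurable hα.integrable_W12.aestronglyMeasurable) ?_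
  refine (ae_restrict_iff' measurableSet_Icc).2 (Eventually.of_forall fun s hs => ?_)
  refine (norm_cutRHS_le h hR (α s)).trans (mul_le_mul_of_nonneg_right ?_ (norm_nonneg _))
  have := pow_le_pow_left₀ (norm_nonneg _) (hm s hs) 2
  gcongr

theorem IntegrableOn.intervalIntegrable_of_mem {E : Type*} [NormedAddCommGroup E] {g : ℝ → E}
    {T t : ℝ} (hg : IntegrableOn g (Set.Icc 0 T)) (ht : t ∈ Set.Icc 0 T) :
    IntervalIntegrable g volume 0 t :=
  (intervalIntegrable_iff_integrableOn_Icc_of_le ht.1).2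
    (hg.mono_set (Set.Icc_subset_Icc_right ht.2))

/-- The localized equation holds strongly in `L²`, up to the defect. -/
theorem IsApproxSolution.norm_sub_integral_cutRHS_le (h : PotentialBound Γ C) {α : ℝ → W12 d}
    {T ε : ℝ} (hε : 0 ≤ ε) (hα : IsApproxSolution Γ α T ε) {R : ℝ} (hR : 0 < R) {t : ℝ}
    (ht : t ∈ Set.Icc 0 T) :
    ‖mulR (velCutoff R) (α t).toL2 - mulR (velCutoff R) (α 0).toL2
      - ∫ s in (0 : ℝ)..t, cutRHS Γ R (α s)‖ ≤ 2 * ε := by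
  -- Testing the original equation with φ χ_R amounts to testing the localized equation with φ. The
  -- factor 2 in the bound is the one of `norm_le_of_test`.
  refine norm_le_of_test hε fun φ hφ => ?_
  have hψ := hφ.mul_velCutoff R
  have hint := IntegrableOn.intervalIntegrable_of_mem (hα.integrableOn_cutRHS h hR) ht
  have e : ∫ z, φ z • (mulR (velCutoff R) (α t).toL2 - mulR (velCutoff R) (α 0).toL2
      - ∫ s in (0 : ℝ)..t, cutRHS Γ R (α s) : L2 d) z =
      (∫ z, (φ z * velCutoff R z) • (α t).toL2 z) - (∫ z, (φ z * velCutoff R z) • (α 0).toL2 z)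
      - ∫ s in (0 : ℝ)..t, ∫ z, (φ z * velCutoff R z) • hvlRHS Γ (α s) z := by
    rw [← testPairing_apply hφ, map_sub, map_sub, ← (testPairing hφ).intervalIntegral_comp_comm hint]
    simp only [testPairing_apply, integral_smul_mulR_velCutoff, integral_smul_cutRHS h φ hR]
  rw [e]
  refine (hα.equation _ hψ t ht).trans (mul_le_mul_of_nonneg_left (l2norm_mono hφ.memLp
    (Eventually.of_forall fun z => ?_)) hε)
  rw [abs_mul]
  exact mul_le_of_le_one_right (abs_nonneg _) (abs_velCutoff_le_one R z)

/-- The basic stability estimate between two approximate solutions. -/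
theorem exists_stability (h : PotentialBound Γ C) : ∃ A : ℝ, 0 ≤ A ∧
    ∀ (T ε η m : ℝ) (α β : ℝ → W12 d), 0 ≤ ε →
    IsApproxSolution Γ α T ε → IsApproxSolution Γ β T ε →
    (∀ t ∈ Set.Icc 0 T, ‖(α t).toL2‖ ≤ m) → (∀ t ∈ Set.Icc 0 T, ‖(β t).toL2‖ ≤ m) →
    (∀ t ∈ Set.Icc 0 T, ∀ R : ℝ, 0 < R → ε * ‖cutRHS Γ R (α t)‖ ≤ η) →
    (∀ t ∈ Set.Icc 0 T, ∀ R : ℝ, 0 < R → ε * ‖cutRHS Γ R (β t)‖ ≤ η) →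
    ∀ t ∈ Set.Icc 0 T, ‖(α t).toL2 - (β t).toL2‖ ^ 2 ≤
      (2 * ‖(α 0).toL2 - (β 0).toL2‖ ^ 2 + 32 * (η * T + ε ^ 2)) +
      ∫ s in (0 : ℝ)..t, A * m * (‖α s‖ + ‖β s‖) * ‖(α s).toL2 - (β s).toL2‖ ^ 2 := by
  obtain ⟨A, hA, hlip⟩ := exists_re_inner_cutRHS_le h
  refine ⟨4 * A, by positivity, fun T ε η m α β hε hα hβ hαm hβm hαη hβη t ht => ?_⟩
  have hT : (0 : ℝ) ≤ T := ht.1.trans ht.2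
  have h0T : (0 : ℝ) ∈ Set.Icc 0 T := ⟨le_rfl, hT⟩
  have hm0 : 0 ≤ m := (norm_nonneg _).trans (hαm 0 h0T)
  have hη : 0 ≤ η := (mul_nonneg hε (norm_nonneg _)).trans (hαη 0 h0T 1 one_pos)
  set γ : ℝ → L2 d := fun s => (α s).toL2 - (β s).toL2 with hγ
  have hγc : ContinuousOn γ (Set.Icc 0 T) := hα.continuous_L2.sub hβ.continuous_L2
  set k : ℝ → ℝ := fun s => (‖α s‖ + ‖β s‖) * ‖γ s‖ ^ 2 with hk
  have hki : IntegrableOn k (Set.Icc 0 T) := by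
    exact IntegrableOn.mul_continuousOn (hα.integrable_W12.norm.add hβ.integrable_W12.norm)
      (hγc.norm.pow 2) isCompact_Icc
  have hγ2i : IntegrableOn (fun s => ‖γ s‖ ^ 2) (Set.Icc 0 T) :=
    (hγc.norm.pow 2).integrableOn_compact isCompact_Icc
  have sub01 : ∀ s ∈ Set.Icc 0 t, s ∈ Set.Icc 0 T := fun s hs => ⟨hs.1, hs.2.trans ht.2⟩
  have key : ∀ R : ℝ, 0 < R → ‖mulR (velCutoff R) (γ t)‖ ^ 2 ≤
      (2 * ‖γ 0‖ ^ 2 + 32 * (η * T + ε ^ 2)) +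
      4 * (A * m ^ 2 / R * (∫ s in (0 : ℝ)..t, ‖γ s‖ ^ 2) + A * m * ∫ s in (0 : ℝ)..t, k s) := by
    intro R hR
    have hχ := (contDiff_velCutoff (d := d) R).continuous
    have hmsub : ∀ f g : L2 d, mulR (velCutoff R) (f - g) =
        mulR (velCutoff R) f - mulR (velCutoff R) g := fun f g =>
      mulL2_sub (m := fun z => (velCutoff R z : ℂ)) (Complex.continuous_ofReal.comp hχ) (C := 1)
        (fun z => (Complex.norm_real _).trans_le (abs_velCutoff_le_one R z)) f g
    set g : ℝ → L2 d := fun s => cutRHS Γ R (α s) - cutRHS Γ R (β s) with hg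
    have hgi : IntegrableOn g (Set.Icc 0 T) :=
      (hα.integrableOn_cutRHS h hR).sub (hβ.integrableOn_cutRHS h hR)
    -- The cutoff difference itself need not be a primitive. Here y is the primitive of the
    -- difference of right-hand sides, to which the energy identity applies; each of the two curves
    -- accounts for an error 2 ε.
    set y : ℝ → L2 d := fun s => mulR (velCutoff R) (γ 0) + ∫ r in (0 : ℝ)..s, g r with hy
    have hw : ∀ s ∈ Set.Icc 0 T, ‖mulR (velCutoff R) (γ s) - y s‖ ≤ 4 * ε := by
      intro s hs
      have e : mulR (velCutoff R) (γ s) - y s =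
          (mulR (velCutoff R) (α s).toL2 - mulR (velCutoff R) (α 0).toL2
            - ∫ r in (0 : ℝ)..s, cutRHS Γ R (α r)) -
          (mulR (velCutoff R) (β s).toL2 - mulR (velCutoff R) (β 0).toL2
            - ∫ r in (0 : ℝ)..s, cutRHS Γ R (β r)) := by
        simp only [hy, hγ, hg, hmsub]
        rw [intervalIntegral.integral_sub
          (IntegrableOn.intervalIntegrable_of_mem (hα.integrableOn_cutRHS h hR) hs)
          (IntegrableOn.intervalIntegrable_of_mem (hβ.integrableOn_cutRHS h hR) hs)]
        abel
      rw [e]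
      refine (norm_sub_le _ _).trans ?_
      linarith [hα.norm_sub_integral_cutRHS_le h hε hR hs,
        hβ.norm_sub_integral_cutRHS_le h hε hR hs]
    have hpt : ∀ s ∈ Set.Icc 0 t, (inner ℂ (y s) (g s)).re ≤
        A * m ^ 2 / R * ‖γ s‖ ^ 2 + A * m * k s + 8 * η := by
      intro s hs
      have hs' := sub01 s hs
      have e : inner ℂ (y s) (g s) = inner ℂ (mulR (velCutoff R) (γ s)) (g s) -
          inner ℂ (mulR (velCutoff R) (γ s) - y s) (g s) := by
        rw [← inner_sub_left, sub_sub_cancel]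
      rw [e, Complex.sub_re]
      have h1 := hlip R hR (α s) (β s) m (hαm s hs') (hβm s hs')
      -- Replacing y by χ_R γ costs the defect times the size of the localized right-hand sides. The
      -- assumption with η bounds this uniformly in R.
      have h2 : |(inner ℂ (mulR (velCutoff R) (γ s) - y s) (g s)).re| ≤ 8 * η := by
        refine abs_re_inner_le.trans ?_
        calc _ ≤ 4 * ε * (‖cutRHS Γ R (α s)‖ + ‖cutRHS Γ R (β s)‖) :=
              mul_le_mul (hw s hs') (norm_sub_le _ _) (norm_nonneg _) (by positivity)
          _ ≤ 8 * η := by linarith [hαη s hs' R hR, hβη s hs' R hR]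
      have h3 := neg_le_abs ((inner ℂ (mulR (velCutoff R) (γ s) - y s) (g s)).re)
      calc _ ≤ (A * m ^ 2 / R + A * m * (‖α s‖ + ‖β s‖)) * ‖γ s‖ ^ 2 + 8 * η := by
            linarith
        _ = _ := by simp only [hk]; ring
    have hgt := IntegrableOn.intervalIntegrable_of_mem hgi ht
    have hen : ‖y t‖ ^ 2 = ‖mulR (velCutoff R) (γ 0)‖ ^ 2 +
        2 * ∫ s in (0 : ℝ)..t, (inner ℂ (y s) (g s)).re := norm_sq_add_integral_eq ht.1 hgt (mulR (velCutoff R) (γ 0))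
    have hyc : ContinuousOn y (Set.Icc 0 t) := by
      refine continuousOn_const.add ?_
      have := intervalIntegral.continuousOn_primitive_interval (f := g) (a := 0) (b := t) (μ := volume)
        (by rw [Set.uIcc_of_le ht.1]; exact hgi.mono_set (Set.Icc_subset_Icc_right ht.2))
      rwa [Set.uIcc_of_le ht.1] at this
    have hii : IntervalIntegrable (fun s => (inner ℂ (y s) (g s)).re) volume 0 t := by
      obtain ⟨Y, hY0, hY⟩ := hyc.exists_norm_le_Icc
      rw [intervalIntegrable_iff_integrableOn_Icc_of_le ht.1]
      have hgi' := hgi.mono_set (Set.Icc_subset_Icc_right ht.2)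
      refine (hgi'.norm.const_mul Y).mono' ?_ ?_
      · have := (hyc.aestronglyMeasurable measurableSet_Icc).inner (𝕜 := ℂ) hgi'.aestronglyMeasurable
        exact Complex.continuous_re.comp_aestronglyMeasurable this
      · refine (ae_restrict_iff' measurableSet_Icc).2 (Eventually.of_forall fun s hs => ?_)
        exact abs_re_inner_le.trans (mul_le_mul_of_nonneg_right (hY s hs) (norm_nonneg _))
    have i1 := IntegrableOn.intervalIntegrable_of_mem hγ2i ht
    have i2 := IntegrableOn.intervalIntegrable_of_mem hki ht
    have hmono := intervalIntegral.integral_mono_on ht.1 hii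
      (((i1.const_mul (A * m ^ 2 / R)).add (i2.const_mul (A * m))).add
        (intervalIntegrable_const (c := 8 * η))) hpt
    have hsplit : ∫ s in (0 : ℝ)..t, (A * m ^ 2 / R * ‖γ s‖ ^ 2 + A * m * k s + 8 * η) =
        A * m ^ 2 / R * (∫ s in (0 : ℝ)..t, ‖γ s‖ ^ 2) + A * m * (∫ s in (0 : ℝ)..t, k s)
          + 8 * η * t := by
      rw [intervalIntegral.integral_add ((i1.const_mul _).add (i2.const_mul _))
        intervalIntegrable_const, intervalIntegral.integral_add (i1.const_mul _) (i2.const_mul _),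
        intervalIntegral.integral_const_mul, intervalIntegral.integral_const_mul,
        intervalIntegral.integral_const, smul_eq_mul, sub_zero, mul_comm t]
    have hmono' : ∫ s in (0 : ℝ)..t, (inner ℂ (y s) (g s)).re ≤
        A * m ^ 2 / R * (∫ s in (0 : ℝ)..t, ‖γ s‖ ^ 2) + A * m * (∫ s in (0 : ℝ)..t, k s)
          + 8 * η * t := hmono.trans_eq hsplit
    have hyt : ‖y t‖ ^ 2 ≤ ‖γ 0‖ ^ 2 + 2 * (A * m ^ 2 / R * (∫ s in (0 : ℝ)..t, ‖γ s‖ ^ 2)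
        + A * m * (∫ s in (0 : ℝ)..t, k s) + 8 * η * T) := by
      have h0 : ‖mulR (velCutoff R) (γ 0)‖ ≤ ‖γ 0‖ := by
        simpa using norm_mulR_le hχ (abs_velCutoff_le_one R) (γ 0)
      have h0' := pow_le_pow_left₀ (norm_nonneg _) h0 2
      have hηt : η * t ≤ η * T := mul_le_mul_of_nonneg_left ht.2 hη
      calc ‖y t‖ ^ 2 = _ := hen
        _ ≤ _ := by linarith
    have htri : ‖mulR (velCutoff R) (γ t)‖ ≤ ‖y t‖ + 4 * ε := by
      have := norm_add_le (y t) (mulR (velCutoff R) (γ t) - y t)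
      rw [add_sub_cancel] at this
      exact this.trans (by linarith [hw t ht])
    -- The doubling here, with the 2 of the energy identity, turns A into 4 A and 8 η into 32 η; the
    -- last term is 2 (4 ε)² = 32 ε².
    have hsq : ‖mulR (velCutoff R) (γ t)‖ ^ 2 ≤ 2 * ‖y t‖ ^ 2 + 2 * (4 * ε) ^ 2 := by
      have := pow_le_pow_left₀ (norm_nonneg _) htri 2
      nlinarith [sq_nonneg (‖y t‖ - 4 * ε)]
    calc _ ≤ 2 * ‖y t‖ ^ 2 + 2 * (4 * ε) ^ 2 := hsq
      _ ≤ 2 * (‖γ 0‖ ^ 2 + 2 * (A * m ^ 2 / R * (∫ s in (0 : ℝ)..t, ‖γ s‖ ^ 2)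
        + A * m * (∫ s in (0 : ℝ)..t, k s) + 8 * η * T)) + 2 * (4 * ε) ^ 2 := by linarith
      _ = _ := by ring
  -- Remove the cutoff along R = n + 1; the commutator term with A m² / R disappears.
  have hlim1 : Tendsto (fun n : ℕ => ‖mulR (velCutoff ((n : ℝ) + 1)) (γ t)‖ ^ 2) atTop
      (𝓝 (‖γ t‖ ^ 2)) :=
    (tendsto_mulR (fun n => (contDiff_velCutoff _).continuous)
      (fun n => abs_velCutoff_le_one _) tendsto_velCutoff (γ t)).norm.pow 2
  have hlim0 : Tendsto (fun n : ℕ => A * m ^ 2 / ((n : ℝ) + 1)) atTop (𝓝 0) :=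
    tendsto_const_nhds.div_atTop (tendsto_atTop_add_const_right _ 1 tendsto_natCast_atTop_atTop)
  have hlim2 := ((hlim0.mul_const (∫ s in (0 : ℝ)..t, ‖γ s‖ ^ 2)).add_const
    (A * m * ∫ s in (0 : ℝ)..t, k s)).const_mul 4 |>.const_add
    (2 * ‖γ 0‖ ^ 2 + 32 * (η * T + ε ^ 2))
  have hfin := le_of_tendsto_of_tendsto' hlim1 hlim2 fun n => key _ (by positivity)
  refine hfin.trans_eq ?_
  have hint : ∫ s in (0 : ℝ)..t, 4 * A * m * (‖α s‖ + ‖β s‖) * ‖(α s).toL2 - (β s).toL2‖ ^ 2 =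
      4 * (A * m * ∫ s in (0 : ℝ)..t, k s) := by
    rw [← mul_assoc, ← mul_assoc, ← intervalIntegral.integral_const_mul]
    simp only [hk, hγ, mul_assoc]
  rw [hint]
  simp only [hγ]
  ring

/-! ### Grönwall inequalities and uniqueness. -/

/-- Grönwall's inequality in integral form, with a constant kernel. -/
theorem gronwall_const {u : ℝ → ℝ} {T D c : ℝ} (hc : 0 ≤ c) (hu : ContinuousOn u (Set.Icc 0 T))
    (h : ∀ t ∈ Set.Icc 0 T, u t ≤ D + ∫ s in (0 : ℝ)..t, c * u s) :
    ∀ t ∈ Set.Icc 0 T, u t ≤ D * Real.exp (c * t) := by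
  intro t ht
  have hT : (0 : ℝ) ≤ T := ht.1.trans ht.2
  -- Extending u by constants beyond [0, T] makes its primitive differentiable at every point, the
  -- endpoints included.
  set v : ℝ → ℝ := Set.IccExtend hT (Set.domRestrict (Set.Icc 0 T) u) with hv
  have hvc : Continuous v := (continuousOn_iff_continuous_domRestrict.1 hu).Icc_extend'
  have hvu : ∀ s ∈ Set.Icc 0 T, v s = u s := fun s hs => by
    rw [hv, Set.IccExtend_of_mem hT _ hs]; rfl
  set U : ℝ → ℝ := fun s => D + ∫ r in (0 : ℝ)..s, c * v r with hU
  have hUd : ∀ s, HasDerivAt U (c * v s) s := fun s =>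
    ((hvc.const_mul c).integral_hasStrictDerivAt 0 s).hasDerivAt.const_add D
  have hUu : ∀ s ∈ Set.Icc 0 T, v s ≤ U s := by
    intro s hs
    rw [hvu s hs]
    refine (h s hs).trans_eq ?_
    simp only [hU]
    congr 1
    refine intervalIntegral.integral_congr fun r hr => ?_
    rw [Set.uIcc_of_le hs.1] at hr
    simp only [hvu r ⟨hr.1, hr.2.trans hs.2⟩]
  have hW : ∀ s, HasDerivAt (fun s => U s * Real.exp (-(c * s)))
      (c * v s * Real.exp (-(c * s)) + U s * (Real.exp (-(c * s)) * -(c * 1))) s := fun s =>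
    (hUd s).mul (((hasDerivAt_id s).const_mul c).neg.exp)
  have hanti : AntitoneOn (fun s => U s * Real.exp (-(c * s))) (Set.Icc 0 T) := by
    refine antitoneOn_of_deriv_nonpos (convex_Icc 0 T)
      (fun s _ => (hW s).continuousAt.continuousWithinAt)
      (fun s _ => (hW s).differentiableAt.differentiableWithinAt) fun s hs => ?_
    rw [interior_Icc] at hs
    rw [(hW s).deriv]
    have h1 := hUu s ⟨hs.1.le, hs.2.le⟩
    have h2 : 0 ≤ c * Real.exp (-(c * s)) := by positivity
    nlinarith
  have h0 := hanti ⟨le_rfl, hT⟩ ht ht.1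
  simp only [hU, intervalIntegral.integral_same, mul_zero, neg_zero, Real.exp_zero, mul_one,
    add_zero] at h0
  have h1 := hUu t ht
  rw [hvu t ht] at h1
  refine h1.trans ?_
  rw [Real.exp_neg, ← div_eq_mul_inv, div_le_iff₀ (Real.exp_pos _)] at h0
  exact h0

/-- Grönwall's inequality in integral form, with an integrable kernel and zero initial value. -/
theorem gronwall_zero {u k : ℝ → ℝ} {T : ℝ} (hu : ContinuousOn u (Set.Icc 0 T))
    (hu0 : ∀ t ∈ Set.Icc 0 T, 0 ≤ u t) (hk : IntegrableOn k (Set.Icc 0 T)) (hk0 : ∀ t, 0 ≤ k t)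
    (h : ∀ t ∈ Set.Icc 0 T, u t ≤ ∫ s in (0 : ℝ)..t, k s * u s) :
    ∀ t ∈ Set.Icc 0 T, u t = 0 := by
  by_cases hT : 0 ≤ T
  swap
  · intro t ht; exact absurd (ht.1.trans ht.2) hT
  set P : ℝ → ℝ := fun s => ∫ r in (0 : ℝ)..s, k r with hP
  have hPc : ContinuousOn P (Set.Icc 0 T) := by
    have := intervalIntegral.continuousOn_primitive_interval (f := k) (a := 0) (b := T)
      (μ := volume) (by rwa [Set.uIcc_of_le hT])
    rwa [Set.uIcc_of_le hT] at this
  -- Uniform continuity of the primitive of k cuts [0, T] into steps of length δ/2 over each of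
  -- which k has integral at most 1/2.
  obtain ⟨δ, hδ, hPδ⟩ := Metric.uniformContinuousOn_iff.1
    (isCompact_Icc.uniformContinuousOn_of_continuous hPc) (1 / 2) (by norm_num)
  have hkint : ∀ s ∈ Set.Icc 0 T, ∀ t ∈ Set.Icc 0 T, IntervalIntegrable k volume s t :=
    fun s hs t ht => (IntegrableOn.intervalIntegrable_of_mem hk hs).symm.trans
      (IntegrableOn.intervalIntegrable_of_mem hk ht)
  have hkuint : ∀ s ∈ Set.Icc 0 T, ∀ t ∈ Set.Icc 0 T,
      IntervalIntegrable (fun r => k r * u r) volume s t := by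
    have : IntegrableOn (fun r => k r * u r) (Set.Icc 0 T) := hk.mul_continuousOn hu isCompact_Icc
    exact fun s hs t ht => (IntegrableOn.intervalIntegrable_of_mem this hs).symm.trans
      (IntegrableOn.intervalIntegrable_of_mem this ht)
  have step : ∀ n : ℕ, ∀ t ∈ Set.Icc 0 T, t ≤ n * (δ / 2) → u t = 0 := by
    intro n
    induction n with
    | zero =>
      intro t ht htn
      have : t = 0 := le_antisymm (by simpa using htn) ht.1
      subst this
      refine le_antisymm ?_ (hu0 0 ht)
      simpa using h 0 ht
    | succ n ih =>
      set b := min T (((n + 1 : ℕ) : ℝ) * (δ / 2)) with hb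
      have hb0 : 0 ≤ b := le_min hT (by positivity)
      have hbT : b ≤ T := min_le_left _ _
      obtain ⟨p, hp, hmax⟩ := isCompact_Icc.exists_isMaxOn (Set.nonempty_Icc.2 hb0)
        (hu.mono (Set.Icc_subset_Icc_right hbT))
      have hpT : p ∈ Set.Icc 0 T := ⟨hp.1, hp.2.trans hbT⟩
      -- At a maximum point p beyond the interval already treated, only the last step of the
      -- integral survives, and there u is at most u p. So u p is at most half of itself.
      have hle : u p ≤ 1 / 2 * u p := by
        rcases le_total p (n * (δ / 2)) with hpn | hpn
        · rw [ih p hpT hpn]; simp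
        · set q := (n : ℝ) * (δ / 2) with hq
          have hq0 : 0 ≤ q := by positivity
          have hqT : q ∈ Set.Icc 0 T := ⟨hq0, hpn.trans hpT.2⟩
          have h0T : (0 : ℝ) ∈ Set.Icc 0 T := ⟨le_rfl, hT⟩
          have e1 : ∫ s in (0 : ℝ)..q, k s * u s = 0 := by
            have : ∫ s in (0 : ℝ)..q, k s * u s = ∫ s in (0 : ℝ)..q, (0 : ℝ) := by
              refine intervalIntegral.integral_congr fun s hs => ?_
              rw [Set.uIcc_of_le hq0] at hs
              simp only [ih s ⟨hs.1, hs.2.trans hqT.2⟩ hs.2, mul_zero]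
            rw [this, intervalIntegral.integral_zero]
          have e2 := intervalIntegral.integral_add_adjacent_intervals
            (hkuint 0 h0T q hqT) (hkuint q hqT p hpT)
          have e3 : ∫ s in q..p, k s * u s ≤ ∫ s in q..p, k s * u p :=
            intervalIntegral.integral_mono_on hpn (hkuint q hqT p hpT)
              ((hkint q hqT p hpT).mul_const _) fun s hs =>
                mul_le_mul_of_nonneg_left (hmax ⟨hq0.trans hs.1, hs.2.trans hp.2⟩) (hk0 s)
          rw [intervalIntegral.integral_mul_const] at e3
          have e4 := intervalIntegral.integral_add_adjacent_intervals
            (hkint 0 h0T q hqT) (hkint q hqT p hpT)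
          have hpq : dist p q < δ := by
            have : p ≤ ((n + 1 : ℕ) : ℝ) * (δ / 2) := hp.2.trans (min_le_right _ _)
            push_cast at this
            rw [Real.dist_eq, abs_of_nonneg (sub_nonneg.2 hpn)]
            have : p - q ≤ δ / 2 := by rw [hq]; linarith
            linarith
          have e5 := hPδ p hpT q hqT hpq
          rw [Real.dist_eq] at e5
          have e6 : ∫ s in q..p, k s ≤ 1 / 2 := by
            have := le_abs_self (P p - P q)
            simp only [hP] at this e5
            linarith
          have := mul_le_mul_of_nonneg_right e6 (hu0 p hpT)
          linarith [h p hpT]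
      intro t ht htn
      refine le_antisymm ?_ (hu0 t ht)
      exact (hmax ⟨ht.1, le_min ht.2 htn⟩).trans (by linarith)
  intro t ht
  obtain ⟨n, hn⟩ := exists_nat_ge (t / (δ / 2))
  exact step n t ht ((div_le_iff₀ (by positivity)).1 hn)

/-- Solutions of the Hamiltonian Vlasov equation are determined by their initial datum. -/
theorem IsHVlSolution.eqOn (h : PotentialBound Γ C) {a : W12 d} {α β : ℝ → W12 d}
    (hα : IsHVlSolution Γ a α) (hβ : IsHVlSolution Γ a β) : Set.EqOn α β (Set.Ici 0) := by
  obtain ⟨A, hA, hst⟩ := exists_stability h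
  intro t ht
  have hα' := hα.isApproxSolution t
  have hβ' := hβ.isApproxSolution t
  obtain ⟨m₁, hm₁, hαm⟩ := hα'.continuous_L2.exists_norm_le_Icc
  obtain ⟨m₂, hm₂, hβm⟩ := hβ'.continuous_L2.exists_norm_le_Icc
  have key := hst t 0 0 (max m₁ m₂) α β le_rfl hα' hβ'
    (fun s hs => (hαm s hs).trans (le_max_left _ _))
    (fun s hs => (hβm s hs).trans (le_max_right _ _))
    (fun s _ R _ => by rw [zero_mul]) (fun s _ R _ => by rw [zero_mul])
  have hm : 0 ≤ max m₁ m₂ := hm₁.trans (le_max_left _ _)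
  -- Solutions are only assumed Bochner integrable into W^{1,2}, so the kernel is integrable but
  -- possibly unbounded.
  have := gronwall_zero (u := fun s => ‖(α s).toL2 - (β s).toL2‖ ^ 2)
    (k := fun s => A * max m₁ m₂ * (‖α s‖ + ‖β s‖)) (T := t)
    ((hα'.continuous_L2.sub hβ'.continuous_L2).norm.pow 2) (fun s _ => by positivity)
    ((hα'.integrable_W12.norm.add hβ'.integrable_W12.norm).const_mul _)
    (fun s => by positivity)
    (fun s hs => by
      have := key s hs
      rw [hα.initial, hβ.initial] at this
      simpa using this) t ⟨ht, le_rfl⟩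
  refine W12.toL2_injective (sub_eq_zero.1 (norm_eq_zero.1 ?_))
  exact pow_eq_zero_iff two_ne_zero |>.1 this

/-- Stability of approximate solutions that are bounded in `W^{1,2}`. -/
theorem exists_stability_of_bounded (h : PotentialBound Γ C) : ∃ A : ℝ, 0 ≤ A ∧
    ∀ (T ε η M : ℝ) (α β : ℝ → W12 d), 0 ≤ ε →
    IsApproxSolution Γ α T ε → IsApproxSolution Γ β T ε →
    (∀ t ∈ Set.Icc 0 T, ‖α t‖ ≤ M) → (∀ t ∈ Set.Icc 0 T, ‖β t‖ ≤ M) →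
    (∀ t ∈ Set.Icc 0 T, ∀ R : ℝ, 0 < R → ε * ‖cutRHS Γ R (α t)‖ ≤ η) →
    (∀ t ∈ Set.Icc 0 T, ∀ R : ℝ, 0 < R → ε * ‖cutRHS Γ R (β t)‖ ≤ η) →
    ∀ t ∈ Set.Icc 0 T, ‖(α t).toL2 - (β t).toL2‖ ^ 2 ≤
      (2 * ‖(α 0).toL2 - (β 0).toL2‖ ^ 2 + 32 * (η * T + ε ^ 2)) *
        Real.exp (A * M ^ 2 * T) := by
  obtain ⟨A, hA, hst⟩ := exists_stability h
  refine ⟨2 * A, by positivity, fun T ε η M α β hε hα hβ hαM hβM hαη hβη t ht => ?_⟩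
  have hT : (0 : ℝ) ≤ T := ht.1.trans ht.2
  have h0T : (0 : ℝ) ∈ Set.Icc 0 T := ⟨le_rfl, hT⟩
  have hM : 0 ≤ M := (norm_nonneg _).trans (hαM 0 h0T)
  have hη : 0 ≤ η := (mul_nonneg hε (norm_nonneg _)).trans (hαη 0 h0T 1 one_pos)
  have hγc : ContinuousOn (fun s => ‖(α s).toL2 - (β s).toL2‖ ^ 2) (Set.Icc 0 T) :=
    (hα.continuous_L2.sub hβ.continuous_L2).norm.pow 2
  have hki : IntegrableOn (fun s => A * M * (‖α s‖ + ‖β s‖) * ‖(α s).toL2 - (β s).toL2‖ ^ 2)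
      (Set.Icc 0 T) :=
    IntegrableOn.mul_continuousOn
      ((hα.integrable_W12.norm.add hβ.integrable_W12.norm).const_mul _) hγc isCompact_Icc
  have key := hst T ε η M α β hε hα hβ (fun s hs => (α s).norm_toL2_le.trans (hαM s hs))
    (fun s hs => (β s).norm_toL2_le.trans (hβM s hs)) hαη hβη
  refine (gronwall_const (c := 2 * A * M ^ 2) (by positivity) hγc (fun s hs => (key s hs).trans
    (add_le_add_right (intervalIntegral.integral_mono_on hs.1
      (IntegrableOn.intervalIntegrable_of_mem hki hs)
      (IntegrableOn.intervalIntegrable_of_mem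
        ((hγc.integrableOn_compact isCompact_Icc).const_mul _) hs) fun r hr => ?_) _)) t ht).trans ?_
  · have hr' : r ∈ Set.Icc 0 T := ⟨hr.1, hr.2.trans hs.2⟩
    refine mul_le_mul_of_nonneg_right ?_ (by positivity)
    have : ‖α r‖ + ‖β r‖ ≤ 2 * M := by linarith [hαM r hr', hβM r hr']
    calc A * M * (‖α r‖ + ‖β r‖) ≤ A * M * (2 * M) := mul_le_mul_of_nonneg_left this (by positivity)
      _ = _ := by ring
  · refine mul_le_mul_of_nonneg_left (Real.exp_le_exp.2 ?_) (by positivity)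
    exact mul_le_mul_of_nonneg_left ht.2 (by positivity)

/-! ### The splitting step -/

/-- The field `∇Γ * |a|²` as a vector field. -/
def fieldVec (Γ : EuclideanSpace ℝ (Fin d) → ℝ) (a : W12 d) (x : EuclideanSpace ℝ (Fin d)) :
    EuclideanSpace ℝ (Fin d) := WithLp.toLp 2 fun i => fieldConv Γ a i x

theorem contDiff_fieldVec (h : PotentialBound Γ C) (a : W12 d) : ContDiff ℝ 2 (fieldVec Γ a) :=
  contDiff_euclidean.2 fun i => contDiff_fieldConv h a i

theorem norm_fieldVec_le (h : PotentialBound Γ C) (a : W12 d) (x) :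
    ‖fieldVec Γ a x‖ ≤ d * (C * ‖a.toL2‖ ^ 2) := by
  rw [euclidean_eq_sum (fieldVec Γ a x)]
  refine (norm_sum_le _ _).trans (sum_fin_le fun i => ?_)
  rw [norm_smul, PiLp.norm_single, norm_one, mul_one]
  exact abs_fieldConv_le h a i x

/-- The phase factor `exp (-s K_a(x))`. -/
def phaseFactor (Γ : EuclideanSpace ℝ (Fin d) → ℝ) (a : W12 d) (s : ℝ) (z : PhaseSpace d) : ℂ :=
  Complex.exp (-((s : ℂ) * bracketConv Γ a z.1))

theorem norm_phaseFactor (h : PotentialBound Γ C) (a : W12 d) (s : ℝ) (z : PhaseSpace d) :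
    ‖phaseFactor Γ a s z‖ = 1 := by
  rw [phaseFactor, Complex.norm_exp, Complex.neg_re, Complex.re_ofReal_mul, bracketConv_re h,
    mul_zero, neg_zero, Real.exp_zero]

theorem contDiff_phaseFactor (h : PotentialBound Γ C) (a : W12 d) (s : ℝ) :
    ContDiff ℝ 1 (phaseFactor Γ a s) :=
  (contDiff_const.mul ((contDiff_bracketConv h a).comp contDiff_fst)).neg.cexp

theorem norm_fderiv_phaseFactor_le (h : PotentialBound Γ C) (a : W12 d) (s : ℝ) (j)
    (z : PhaseSpace d) : ‖fderiv ℝ (phaseFactor Γ a s) z (coordDir d j)‖ ≤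
      |s| * (d * (C * (‖a.toL2‖ * ‖a‖))) := by
  have hK : HasFDerivAt (fun z : PhaseSpace d => bracketConv Γ a z.1)
      (fderiv ℝ (fun z : PhaseSpace d => bracketConv Γ a z.1) z) z :=
    (((contDiff_bracketConv h a).comp contDiff_fst).differentiable one_ne_zero z).hasFDerivAt
  have hd := ((hK.const_mul (s : ℂ)).neg.cexp).fderiv
  have e : fderiv ℝ (phaseFactor Γ a s) z (coordDir d j) = phaseFactor Γ a s z *
      -((s : ℂ) * fderiv ℝ (bracketConv Γ a) z.1 (coordDir d j).1) := by
    refine (congrArg (fun L => L (coordDir d j)) hd).trans ?_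
    rw [← fderiv_fst_dep ((contDiff_bracketConv h a).differentiable one_ne_zero _)]
    simp [phaseFactor]
  rw [e, norm_mul, norm_phaseFactor h, one_mul, norm_neg, norm_mul, Complex.norm_real,
    Real.norm_eq_abs]
  refine mul_le_mul_of_nonneg_left ?_ (abs_nonneg _)
  refine ((fderiv ℝ (bracketConv Γ a) z.1).le_opNorm _).trans ?_
  have h1 : ‖(coordDir d j).1‖ ≤ 1 := (norm_fst_le _).trans (norm_coordDir_le j)
  calc _ ≤ ‖fderiv ℝ (bracketConv Γ a) z.1‖ * 1 := mul_le_mul_of_nonneg_left h1 (norm_nonneg _)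
    _ ≤ _ := by rw [mul_one]; exact norm_fderiv_bracketConv_le h a _

/-- The exponential growth rate of the `W^{1,2}` norm of solutions with `L²` norm at most `m`. -/
def growthRate (d : ℕ) (C m : ℝ) : ℝ := (2 * d + 1) * (1 + 2 * d * C * m ^ 2)

theorem growthRate_nonneg (hC : 0 ≤ C) (m : ℝ) : 0 ≤ growthRate d C m := by
  unfold growthRate; positivity

theorem growthRate_mono (hC : 0 ≤ C) {m m' : ℝ} (hm : 0 ≤ m) (h : m ≤ m') :
    growthRate d C m ≤ growthRate d C m' := by
  unfold growthRate; gcongr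

/-- The step is a kick, a unimodular multiplication and a drift. None increases the L² norm, and
each multiplies the W^{1,2} norm by a factor 1 + O(s). Bounding these factors by exponentials makes
them accumulate to the same growth whatever the number of steps. -/
theorem exists_splitStep (h : PotentialBound Γ C) (a : W12 d) (s : ℝ) : ∃ b : W12 d,
    (b.toL2 =ᵐ[volume] fun z => phaseFactor Γ a s (driftMap s z) *
      a.toL2 (kickMap (fun x => s • fieldVec Γ a x) (driftMap s z))) ∧
    ‖b.toL2‖ ≤ ‖a.toL2‖ ∧ ‖b‖ ≤ Real.exp (growthRate d C ‖a.toL2‖ * |s|) * ‖a‖ := by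
  have hC := h.nonneg
  have hB : ContDiff ℝ 2 fun x => s • fieldVec Γ a x := (contDiff_fieldVec h a).const_smul s
  have hD : ∀ x i k, |fderiv ℝ (fun x => s • fieldVec Γ a x) x (EuclideanSpace.single i 1) k| ≤
      |s| * (C * ‖a.toL2‖ ^ 2) := by
    intro x i k
    have hE : HasFDerivAt (fun x => s • fieldVec Γ a x) _ x :=
      ((contDiff_fieldVec h a).differentiable two_ne_zero x).hasFDerivAt.const_smul s
    have hk : HasFDerivAt (fun x => (EuclideanSpace.proj (𝕜 := ℝ) k) (fieldVec Γ a x)) _ x :=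
      (EuclideanSpace.proj (𝕜 := ℝ) k).hasFDerivAt.comp x
        ((contDiff_fieldVec h a).differentiable two_ne_zero x).hasFDerivAt
    have hk' : fderiv ℝ (fieldConv Γ a k) x (EuclideanSpace.single i 1) =
        fderiv ℝ (fieldVec Γ a) x (EuclideanSpace.single i 1) k :=
      congrArg (fun L => L (EuclideanSpace.single i 1)) hk.fderiv
    rw [hE.fderiv]
    change |s * fderiv ℝ (fieldVec Γ a) x (EuclideanSpace.single i 1) k| ≤ _
    rw [← hk', abs_mul]
    refine mul_le_mul_of_nonneg_left ?_ (abs_nonneg _)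
    refine ((fderiv ℝ (fieldConv Γ a k) x).le_opNorm _).trans ?_
    rw [PiLp.norm_single, norm_one, mul_one]
    exact norm_fderiv_fieldConv_le h a k x
  obtain ⟨b₁, h1, h1n, h1d⟩ := a.exists_comp_kick hB (by positivity) hD
  obtain ⟨b₂, h2, h2n, h2d⟩ := b₁.exists_mul (contDiff_phaseFactor h a s)
    (fun z => (norm_phaseFactor h a s z).le) (norm_fderiv_phaseFactor_le h a s)
  obtain ⟨b₃, h3, h3n, h3d⟩ := b₂.exists_comp_drift s
  -- Kick and phase each contribute d C ‖a‖₂² |s| ‖a‖. They are estimated jointly because the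
  -- gradient of the phase carries the Sobolev norm of the frozen a, not that of the kicked
  -- function.
  have h12 : ‖b₂‖ ≤ (1 + (2 * d + 1) * (2 * d * C * ‖a.toL2‖ ^ 2 * |s|)) * ‖a‖ := by
    refine W12.norm_le_of_components (by positivity) (h2n.trans h1n.le) fun j => ?_
    refine (h2d j).trans ?_
    rw [h1n]
    linarith [h1d j]
  have h23 : ‖b₃‖ ≤ (1 + (2 * d + 1) * |s|) * ‖b₂‖ :=
    W12.norm_le_of_components (abs_nonneg s) h3n.le h3d
  refine ⟨b₃, ?_, h3n.le.trans (h2n.trans h1n.le), ?_⟩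
  · have q1 := (measurePreserving_driftMap (d := d) s).quasiMeasurePreserving.ae h1
    have q2 := (measurePreserving_driftMap (d := d) s).quasiMeasurePreserving.ae h2
    filter_upwards [h3, q1, q2] with z e3 e1 e2
    rw [e3, e2, e1]
  · have e1 : 1 + (2 * d + 1) * (2 * d * C * ‖a.toL2‖ ^ 2 * |s|) ≤
        Real.exp ((2 * d + 1) * (2 * d * C * ‖a.toL2‖ ^ 2 * |s|)) := by
      rw [add_comm]; exact Real.add_one_le_exp _
    have e2 : 1 + (2 * d + 1) * |s| ≤ Real.exp ((2 * d + 1) * |s|) := by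
      rw [add_comm]; exact Real.add_one_le_exp _
    calc ‖b₃‖ ≤ Real.exp ((2 * d + 1) * |s|) *
          (Real.exp ((2 * d + 1) * (2 * d * C * ‖a.toL2‖ ^ 2 * |s|)) * ‖a‖) :=
        h23.trans (mul_le_mul e2 (h12.trans (mul_le_mul_of_nonneg_right e1 (norm_nonneg _)))
          (norm_nonneg _) (Real.exp_nonneg _))
      _ = _ := by
        rw [← mul_assoc, ← Real.exp_add, growthRate]
        ring_nf

/-- One step of the splitting scheme: the field frozen at `a` acts for time `s`, followed by free
transport for time `s`. -/
def splitStep (h : PotentialBound Γ C) (a : W12 d) (s : ℝ) : W12 d :=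
  (exists_splitStep h a s).choose

theorem coeFn_splitStep (h : PotentialBound Γ C) (a : W12 d) (s : ℝ) :
    (splitStep h a s).toL2 =ᵐ[volume] fun z => phaseFactor Γ a s (driftMap s z) *
      a.toL2 (kickMap (fun x => s • fieldVec Γ a x) (driftMap s z)) :=
  (exists_splitStep h a s).choose_spec.1

theorem norm_toL2_splitStep_le (h : PotentialBound Γ C) (a : W12 d) (s : ℝ) :
    ‖(splitStep h a s).toL2‖ ≤ ‖a.toL2‖ := (exists_splitStep h a s).choose_spec.2.1

theorem norm_splitStep_le (h : PotentialBound Γ C) (a : W12 d) (s : ℝ) :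
    ‖splitStep h a s‖ ≤ Real.exp (growthRate d C ‖a.toL2‖ * |s|) * ‖a‖ :=
  (exists_splitStep h a s).choose_spec.2.2

theorem splitStep_zero (h : PotentialBound Γ C) (a : W12 d) : splitStep h a 0 = a := by
  refine W12.toL2_injective (Lp.ext ?_)
  filter_upwards [coeFn_splitStep h a 0] with z hz
  simpa [phaseFactor, kickMap, driftMap] using hz

/-- The flow inverse to the one used in `splitStep`. -/
def splitFlow (Γ : EuclideanSpace ℝ (Fin d) → ℝ) (a : W12 d) (s : ℝ) (z : PhaseSpace d) :
    PhaseSpace d :=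
  (z.1 + s • (z.2 - s • fieldVec Γ a z.1), z.2 - s • fieldVec Γ a z.1)

theorem continuous_splitFlow (h : PotentialBound Γ C) (a : W12 d) :
    Continuous fun p : ℝ × PhaseSpace d => splitFlow Γ a p.1 p.2 := by
  have := (contDiff_fieldVec h a).continuous
  unfold splitFlow
  fun_prop

/-- A change of variables by the volume preserving flow puts the time dependence on Φ and on the
phase. The phase is evaluated at the kicked point because the kick leaves x, hence K, unchanged. -/
theorem integral_mul_splitStep (h : PotentialBound Γ C) (a : W12 d) (s : ℝ)
    {Φ : PhaseSpace d → ℂ} (hΦ : Continuous Φ) :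
    ∫ z, Φ z * (splitStep h a s).toL2 z =
      ∫ z, (Φ (splitFlow Γ a s z) * phaseFactor Γ a s z) * a.toL2 z := by
  have hE := (contDiff_fieldVec h a).continuous
  have hmp : MeasurePreserving (fun z : PhaseSpace d => kickMap (fun x => s • fieldVec Γ a x)
      (driftMap s z)) volume volume :=
    (measurePreserving_kickMap (hE.const_smul s)).comp (measurePreserving_driftMap s)
  set F : PhaseSpace d → ℂ := fun z =>
    (Φ (splitFlow Γ a s z) * phaseFactor Γ a s z) * a.toL2 z with hF
  have hFm : AEStronglyMeasurable F volume := by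
    refine AEStronglyMeasurable.mul (Continuous.aestronglyMeasurable ?_)
      (Lp.aestronglyMeasurable _)
    exact (hΦ.comp ((continuous_splitFlow h a).comp (Continuous.prodMk_right s))).mul
      (contDiff_phaseFactor h a s).continuous
  have e1 := integral_map hmp.measurable.aemeasurable (f := F) (by rwa [hmp.map_eq])
  rw [hmp.map_eq] at e1
  rw [e1]
  refine integral_congr_ae ?_
  filter_upwards [coeFn_splitStep h a s] with z hz
  rw [hz]
  have e2 : splitFlow Γ a s (kickMap (fun x => s • fieldVec Γ a x) (driftMap s z)) = z := by
    simp [splitFlow, kickMap, driftMap]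
  simp only [hF, e2]
  simp only [phaseFactor, kickMap]
  ring

/-- The formal adjoint of the generator of `splitStep`, applied to a function `φ`. -/
def splitAdjoint (Γ : EuclideanSpace ℝ (Fin d) → ℝ) (a : W12 d) (s : ℝ) (φ : PhaseSpace d → ℝ)
    (z : PhaseSpace d) : ℂ :=
  (fderiv ℝ φ z (z.2 - s • fieldVec Γ a (driftMap s z).1, -fieldVec Γ a (driftMap s z).1) : ℝ)
    - (φ z : ℂ) * bracketConv Γ a (driftMap s z).1

theorem continuous_driftMap : Continuous fun p : ℝ × PhaseSpace d => driftMap p.1 p.2 := by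
  unfold driftMap; fun_prop

theorem continuous_splitAdjoint (h : PotentialBound Γ C) (a : W12 d) {φ : PhaseSpace d → ℝ}
    (hφ : IsTestFunction φ) :
    Continuous fun p : ℝ × PhaseSpace d => splitAdjoint Γ a p.1 φ p.2 := by
  have hE := (contDiff_fieldVec h a).continuous
  have hK := (contDiff_bracketConv h a).continuous
  have h1 : Continuous fun p : ℝ × PhaseSpace d => (driftMap p.1 p.2).1 :=
    continuous_fst.comp continuous_driftMap
  have h2 := hE.comp h1
  have h3 := hK.comp h1
  have h4 : Continuous (fderiv ℝ φ) := hφ.smooth.continuous_fderiv (by simp)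
  refine Continuous.sub (Complex.continuous_ofReal.comp ((h4.comp continuous_snd).clm_apply ?_))
    (Continuous.mul (Complex.continuous_ofReal.comp (hφ.smooth.continuous.comp continuous_snd)) h3)
  exact ((continuous_snd.comp continuous_snd).sub (continuous_fst.smul h2)).prodMk h2.neg

/-- The scheme in weak form. -/
theorem hasDerivAt_integral_splitStep (h : PotentialBound Γ C) (a : W12 d) {φ : PhaseSpace d → ℝ}
    (hφ : IsTestFunction φ) (s₀ : ℝ) :
    HasDerivAt (fun s => ∫ z, φ z • (splitStep h a s).toL2 z)
      (∫ z, splitAdjoint Γ a s₀ φ z * (splitStep h a s₀).toL2 z) s₀ := by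
  have hE := (contDiff_fieldVec h a).continuous
  have hK := (contDiff_bracketConv h a).continuous
  have hφc : Continuous fun z => (φ z : ℂ) := Complex.continuous_ofReal.comp hφ.smooth.continuous
  have hadj := continuous_splitAdjoint h a hφ
  have e1 : ∀ s, ∫ z, φ z • (splitStep h a s).toL2 z =
      ∫ z, ((φ (splitFlow Γ a s z) : ℂ) * phaseFactor Γ a s z) * a.toL2 z := fun s => by
    simp only [Complex.real_smul]
    exact integral_mul_splitStep h a s hφc
  simp_rw [e1]
  have hadj₀ : Continuous (splitAdjoint Γ a s₀ φ) := hadj.comp (Continuous.prodMk_right s₀)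
  rw [integral_mul_splitStep h a s₀ hadj₀]
  obtain ⟨r, hr⟩ := hφ.compact.isCompact.isBounded.subset_closedBall 0
  set M : ℝ := d * (C * ‖a.toL2‖ ^ 2) with hM
  have hM0 : 0 ≤ M := by have := h.nonneg; positivity
  have hphase : Continuous fun p : ℝ × PhaseSpace d => phaseFactor Γ a p.1 p.2 := by
    unfold phaseFactor
    exact Complex.continuous_exp.comp (((Complex.continuous_ofReal.comp continuous_fst).mul
      (hK.comp (continuous_fst.comp continuous_snd))).neg)
  -- The radius: if the flow brings z into the ball of radius |r|, undoing the kick and the drift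
  -- with |s| ≤ |s₀| + 1 moves each component by at most (|s₀| + 1) M or (|s₀| + 1)|r|.
  refine hasDerivAt_integral_mul
    (Ψ := fun s z => (φ (splitFlow Γ a s z) : ℂ) * phaseFactor Γ a s z)
    (Ψ' := fun s z => splitAdjoint Γ a s φ (splitFlow Γ a s z) * phaseFactor Γ a s z)
    (K := Metric.closedBall 0 (|r| + (|s₀| + 1) * (M + |r|)))
    (isCompact_closedBall _ _) (fun s => ?_) ?_ (fun s z => ?_) (fun s hs z hz => ?_) a.toL2
  · exact (hφc.comp ((continuous_splitFlow h a).comp (Continuous.prodMk_right s))).mul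
      (hphase.comp (Continuous.prodMk_right s))
  · exact (hadj.comp (continuous_fst.prodMk (continuous_splitFlow h a))).mul hphase
  · have hv : HasDerivAt (fun s : ℝ => z.2 - s • fieldVec Γ a z.1)
        (-fieldVec Γ a z.1) s := by
      simpa using ((hasDerivAt_id s).smul_const (fieldVec Γ a z.1)).const_sub z.2
    have hx : HasDerivAt (fun s : ℝ => z.1 + s • (z.2 - s • fieldVec Γ a z.1))
        (z.2 - s • fieldVec Γ a z.1 - s • fieldVec Γ a z.1) s := by
      have := ((hasDerivAt_id s).smul hv).const_add z.1
      refine this.congr_deriv ?_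
      simp only [id, smul_neg, one_smul]
      abel
    have hf : HasDerivAt (fun s => splitFlow Γ a s z) (z.2 - s • fieldVec Γ a z.1 -
        s • fieldVec Γ a z.1, -fieldVec Γ a z.1) s := hx.prodMk hv
    have hφf := ((hφ.smooth.differentiable (by simp)
      (splitFlow Γ a s z)).hasFDerivAt.comp_hasDerivAt s hf).ofReal_comp
    have hp : HasDerivAt (fun s => phaseFactor Γ a s z)
        (phaseFactor Γ a s z * -(1 * bracketConv Γ a z.1)) s :=
      (((hasDerivAt_id s).ofReal_comp.mul_const (bracketConv Γ a z.1)).neg).cexp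
    refine (hφf.mul hp).congr_deriv ?_
    -- Drifting back recovers the initial position, so the coefficients of the adjoint are constant
    -- along the flow and match the chain rule.
    have e2 : (driftMap s (splitFlow Γ a s z)).1 = z.1 := by simp [driftMap, splitFlow]
    rw [splitAdjoint, e2]
    simp only [splitFlow, Function.comp]
    ring
  · have hs' : |s| ≤ |s₀| + 1 := by
      rw [Metric.mem_ball, Real.dist_eq] at hs
      have := abs_sub_abs_le_abs_sub s s₀
      linarith
    have h0 : φ (splitFlow Γ a s z) = 0 := by
      by_contra hne
      refine hz ?_
      have h1 := hr (subset_tsupport _ (Function.mem_support.2 hne))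
      rw [mem_closedBall_zero_iff] at h1 ⊢
      have hEz := norm_fieldVec_le h a z.1
      rw [← hM] at hEz
      have hv : ‖z.2 - s • fieldVec Γ a z.1‖ ≤ |r| :=
        (norm_snd_le (splitFlow Γ a s z)).trans (h1.trans (le_abs_self r))
      have hx : ‖z.1 + s • (z.2 - s • fieldVec Γ a z.1)‖ ≤ |r| :=
        (norm_fst_le (splitFlow Γ a s z)).trans (h1.trans (le_abs_self r))
      have b1 : ‖s • fieldVec Γ a z.1‖ ≤ (|s₀| + 1) * M := by
        rw [norm_smul]; exact mul_le_mul hs' hEz (norm_nonneg _) (by positivity)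
      have b2 : ‖s • (z.2 - s • fieldVec Γ a z.1)‖ ≤ (|s₀| + 1) * |r| := by
        rw [norm_smul]; exact mul_le_mul hs' hv (norm_nonneg _) (by positivity)
      have c1 : ‖z.2‖ ≤ |r| + (|s₀| + 1) * M := by
        have := norm_add_le (z.2 - s • fieldVec Γ a z.1) (s • fieldVec Γ a z.1)
        rw [sub_add_cancel] at this
        linarith
      have c2 : ‖z.1‖ ≤ |r| + (|s₀| + 1) * |r| := by
        have := norm_sub_le (z.1 + s • (z.2 - s • fieldVec Γ a z.1))
          (s • (z.2 - s • fieldVec Γ a z.1))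
        rw [add_sub_cancel_right] at this
        linarith
      have p1 : 0 ≤ (|s₀| + 1) * M := by positivity
      have p2 : 0 ≤ (|s₀| + 1) * |r| := by positivity
      rw [Prod.norm_def, mul_add]
      exact max_le (by linarith) (by linarith)
    simp [h0]

/-! ### First order operators in weak form -/

theorem HasWeakDeriv.add_dir {u u' : PhaseSpace d} {f g g' : L2 d} (h : HasWeakDeriv u f g)
    (h' : HasWeakDeriv u' f g') : HasWeakDeriv (u + u') f (g + g') := by
  intro φ hφ
  have e : ∫ z, φ z • (g + g') z = (∫ z, φ z • g z) + ∫ z, φ z • g' z := by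
    simp only [← testPairing_apply hφ, map_add]
  simp only [map_add, add_smul]
  rw [integral_add (hφ.integrable_fderiv_smul u f) (hφ.integrable_fderiv_smul u' f), h φ hφ,
    h' φ hφ, e, neg_add]

theorem HasWeakDeriv.smul_dir {u : PhaseSpace d} {f g : L2 d} (s : ℝ) (h : HasWeakDeriv u f g) :
    HasWeakDeriv (s • u) f (s • g) := by
  intro φ hφ
  have e : ∫ z, φ z • (s • g) z = s • ∫ z, φ z • g z := by
    simp only [← testPairing_apply hφ, map_smul]
  simp only [map_smul, smul_assoc]
  rw [integral_smul, h φ hφ, e, smul_neg]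

/-- The first order operator with the given coefficients. -/
def transportOp (p q : Fin d → PhaseSpace d → ℝ) (k : PhaseSpace d → ℂ) (b : W12 d)
    (z : PhaseSpace d) : ℂ :=
  ∑ i, ((p i z : ℂ) * b.dx i z + (q i z : ℂ) * b.dv i z) - k z * b.toL2 z

theorem hvlRHS_eq_transportOp (b : W12 d) : hvlRHS Γ b =
    transportOp (fun i z => -z.2 i) (fun i z => fieldConv Γ b i z.1)
      (fun z => bracketConv Γ b z.1) b := by
  ext z
  simp [hvlRHS, transportOp]

theorem integrable_smul_transportOp {p q : Fin d → PhaseSpace d → ℝ} {k : PhaseSpace d → ℂ}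
    (hp : ∀ i, Continuous (p i)) (hq : ∀ i, Continuous (q i)) (hk : Continuous k) (b : W12 d)
    {φ : PhaseSpace d → ℝ} (hφ : IsTestFunction φ) :
    Integrable fun z => φ z • transportOp p q k b z := by
  have hc := hφ.smooth.continuous
  have h1 : ∀ i, Integrable fun z => (φ z * p i z) • b.dx i z := fun i =>
    integrable_smul_L2 (hc.mul (hp i)) hφ.compact.mul_right _
  have h2 : ∀ i, Integrable fun z => (φ z * q i z) • b.dv i z := fun i =>
    integrable_smul_L2 (hc.mul (hq i)) hφ.compact.mul_right _
  have h3 : Integrable fun z => ((φ z : ℂ) * k z) * b.toL2 z :=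
    integrable_mul_L2 ((Complex.continuous_ofReal.comp hc).mul hk)
      (hφ.compact.comp_left (g := Complex.ofReal) rfl).mul_right _
  refine ((integrable_finsetSum Finset.univ fun i _ => (h1 i).add (h2 i)).sub h3).congr
    (Eventually.of_forall fun z => ?_)
  simp only [Pi.sub_apply, Pi.add_apply, transportOp, smul_sub, Finset.smul_sum,
    Complex.real_smul]
  push_cast
  congr 1
  · exact Finset.sum_congr rfl fun i _ => by ring
  · ring

theorem integral_smul_transportOp {p q : Fin d → PhaseSpace d → ℝ} {k : PhaseSpace d → ℂ}
    (hp : ∀ i, Continuous (p i)) (hq : ∀ i, Continuous (q i)) (hk : Continuous k) (b : W12 d)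
    {φ : PhaseSpace d → ℝ} (hφ : IsTestFunction φ) :
    ∫ z, φ z • transportOp p q k b z =
      ∑ i, ((∫ z, (φ z * p i z) • b.dx i z) + ∫ z, (φ z * q i z) • b.dv i z)
        - ∫ z, ((φ z : ℂ) * k z) * b.toL2 z := by
  have hc := hφ.smooth.continuous
  have h1 : ∀ i, Integrable fun z => (φ z * p i z) • b.dx i z := fun i =>
    integrable_smul_L2 (hc.mul (hp i)) hφ.compact.mul_right _
  have h2 : ∀ i, Integrable fun z => (φ z * q i z) • b.dv i z := fun i =>
    integrable_smul_L2 (hc.mul (hq i)) hφ.compact.mul_right _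
  have h3 : Integrable fun z => ((φ z : ℂ) * k z) * b.toL2 z :=
    integrable_mul_L2 ((Complex.continuous_ofReal.comp hc).mul hk)
      (hφ.compact.comp_left (g := Complex.ofReal) rfl).mul_right _
  have h12 : ∀ i, Integrable fun z => (φ z * p i z) • b.dx i z + (φ z * q i z) • b.dv i z :=
    fun i => (h1 i).add (h2 i)
  simp_rw [← integral_add (h1 _) (h2 _)]
  rw [← integral_finsetSum _ fun i _ => h12 i,
    ← integral_sub (integrable_finsetSum _ fun i _ => h12 i) h3]
  refine integral_congr_ae (Eventually.of_forall fun z => ?_)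
  simp only [transportOp, smul_sub, Finset.smul_sum, Complex.real_smul]
  push_cast
  congr 1
  · exact Finset.sum_congr rfl fun i _ => by ring
  · ring

/-- `a` vanishes for velocities of size larger than `ρ`. -/
def HasVelocityBound (a : W12 d) (ρ : ℝ) : Prop :=
  ∀ᵐ z : PhaseSpace d, ρ < ‖z.2‖ → a.toL2 z = 0

/-- Test functions supported in the open set ρ < |v| do not see a, so the weak derivatives vanish
there as well. The factor v is then bounded wherever it acts. -/
theorem HasVelocityBound.deriv {a : W12 d} {ρ : ℝ} (h : HasVelocityBound a ρ)
    (j : Fin d ⊕ Fin d) : ∀ᵐ z : PhaseSpace d, ρ < ‖z.2‖ → a.deriv j z = 0 := by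
  have hU : IsOpen {z : PhaseSpace d | ρ < ‖z.2‖} :=
    isOpen_lt continuous_const continuous_snd.norm
  refine hU.ae_eq_zero_of_integral_contDiff_smul_eq_zero
    (((Lp.memLp _).locallyIntegrable (by norm_num)).locallyIntegrableOn _) fun g hg hgc hgU => ?_
  have e := a.hasWeakDeriv j g ⟨hg, hgc⟩
  rw [← neg_eq_zero, ← e]
  refine integral_eq_zero_of_ae ?_
  filter_upwards [h] with z hz
  by_cases hzU : ρ < ‖z.2‖
  · simp [hz hzU]
  · have : z ∉ tsupport (fderiv ℝ g) := fun hh => hzU (hgU (tsupport_fderiv_subset ℝ hh))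
    simp [image_eq_zero_of_notMem_tsupport this]

theorem integrable_abs_mul_norm {φ : PhaseSpace d → ℝ} (hφ : MemLp φ 2 volume) (g : L2 d) :
    Integrable fun z => |φ z| * ‖g z‖ :=
  hφ.norm.integrable_mul (Lp.memLp g).norm

theorem integral_abs_mul_norm_le {φ : PhaseSpace d → ℝ} (hφ : MemLp φ 2 volume) (g : L2 d) :
    ∫ z, |φ z| * ‖g z‖ ≤ l2norm φ * ‖g‖ := by
  have hc : MemLp (fun z => (φ z : ℂ)) 2 volume := hφ.ofReal
  have e : ∫ z, |φ z| * ‖g z‖ = ∫ z, ‖hc.toLp _ z‖ * ‖g z‖ := by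
    refine integral_congr_ae ?_
    filter_upwards [hc.coeFn_toLp] with z hz
    rw [hz, Complex.norm_real, Real.norm_eq_abs]
  rw [e]
  refine (integral_norm_mul_le _ g).trans (mul_le_mul_of_nonneg_right ?_ (norm_nonneg _))
  rw [Lp.norm_toLp, l2norm]
  refine le_of_eq (congrArg _ (eLpNorm_congr_norm_ae (Eventually.of_forall fun z => ?_)))
  simp

/-- Coefficients need only be compared on the velocity support of b, since b and its derivatives
vanish elsewhere. The bound by the L² norm of φ is the shape of the defect in `IsApproxSolution`. -/
theorem norm_integral_transportOp_sub_le {p q p' q' : Fin d → PhaseSpace d → ℝ}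
    {k k' : PhaseSpace d → ℂ}
    (hp : ∀ i, Continuous (p i)) (hq : ∀ i, Continuous (q i)) (hk : Continuous k)
    (hp' : ∀ i, Continuous (p' i)) (hq' : ∀ i, Continuous (q' i)) (hk' : Continuous k')
    {b : W12 d} {ρ P Q κ : ℝ} (hb : HasVelocityBound b ρ) (hP0 : 0 ≤ P) (hQ0 : 0 ≤ Q) (hκ0 : 0 ≤ κ)
    (hP : ∀ i z, ‖z.2‖ ≤ ρ → |p i z - p' i z| ≤ P)
    (hQ : ∀ i z, ‖z.2‖ ≤ ρ → |q i z - q' i z| ≤ Q)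
    (hκ : ∀ z, ‖z.2‖ ≤ ρ → ‖k z - k' z‖ ≤ κ)
    {φ : PhaseSpace d → ℝ} (hφ : IsTestFunction φ) :
    ‖(∫ z, φ z • transportOp p q k b z) - ∫ z, φ z • transportOp p' q' k' b z‖ ≤
      (d * (P + Q) * ‖b‖ + κ * ‖b.toL2‖) * l2norm φ := by
  rw [← integral_sub (integrable_smul_transportOp hp hq hk b hφ)
    (integrable_smul_transportOp hp' hq' hk' b hφ)]
  have i1 := fun i => integrable_abs_mul_norm hφ.memLp (b.dx i)
  have i2 := fun i => integrable_abs_mul_norm hφ.memLp (b.dv i)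
  have i3 := integrable_abs_mul_norm hφ.memLp b.toL2
  have j1 := fun i => integral_abs_mul_norm_le hφ.memLp (b.dx i)
  have j2 := fun i => integral_abs_mul_norm_le hφ.memLp (b.dv i)
  have j3 := integral_abs_mul_norm_le hφ.memLp b.toL2
  have hl := l2norm_nonneg φ
  have i12 : ∀ i, Integrable fun z => P * (|φ z| * ‖b.dx i z‖) + Q * (|φ z| * ‖b.dv i z‖) :=
    fun i => ((i1 i).const_mul P).add ((i2 i).const_mul Q)
  have hI : Integrable fun z => ∑ i, (P * (|φ z| * ‖b.dx i z‖) + Q * (|φ z| * ‖b.dv i z‖))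
      + κ * (|φ z| * ‖b.toL2 z‖) :=
    (integrable_finsetSum _ fun i _ => i12 i).add (i3.const_mul κ)
  have hvx : ∀ᵐ z : PhaseSpace d, ∀ j, ρ < ‖z.2‖ → b.deriv j z = 0 :=
    ae_all_iff.2 fun j => hb.deriv j
  refine (norm_integral_le_of_norm_le hI ?_).trans ?_
  · filter_upwards [hb, hvx] with z h0 hd
    by_cases hz : ρ < ‖z.2‖
    · have hdx : ∀ i, b.dx i z = 0 := fun i => hd (Sum.inl i) hz
      have hdv : ∀ i, b.dv i z = 0 := fun i => hd (Sum.inr i) hz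
      simp [transportOp, h0 hz, hdx, hdv]
    · have hz := not_lt.1 hz
      have e : φ z • transportOp p q k b z - φ z • transportOp p' q' k' b z =
          φ z • (∑ i, (((p i z - p' i z : ℝ) : ℂ) * b.dx i z + ((q i z - q' i z : ℝ) : ℂ) * b.dv i z)
            - (k z - k' z) * b.toL2 z) := by
        rw [← smul_sub]
        congr 1
        simp only [transportOp]
        rw [sub_sub_sub_comm, ← Finset.sum_sub_distrib]
        congr 1
        · exact Finset.sum_congr rfl fun i _ => by push_cast; ring
        · ring
      rw [e, norm_smul, Real.norm_eq_abs]
      have hs : ‖∑ i, (((p i z - p' i z : ℝ) : ℂ) * b.dx i z +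
          ((q i z - q' i z : ℝ) : ℂ) * b.dv i z)‖ ≤
          ∑ i, (P * ‖b.dx i z‖ + Q * ‖b.dv i z‖) := by
        refine (norm_sum_le _ _).trans (Finset.sum_le_sum fun i _ => (norm_add_le _ _).trans ?_)
        rw [norm_mul, norm_mul, Complex.norm_real, Complex.norm_real]
        exact add_le_add (mul_le_mul_of_nonneg_right (hP i z hz) (norm_nonneg _))
          (mul_le_mul_of_nonneg_right (hQ i z hz) (norm_nonneg _))
      have hs' : ‖(k z - k' z) * b.toL2 z‖ ≤ κ * ‖b.toL2 z‖ := by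
        rw [norm_mul]; exact mul_le_mul_of_nonneg_right (hκ z hz) (norm_nonneg _)
      refine (mul_le_mul_of_nonneg_left ((norm_sub_le _ _).trans (add_le_add hs hs'))
        (abs_nonneg _)).trans_eq ?_
      rw [mul_add, Finset.mul_sum]
      congr 1
      · exact Finset.sum_congr rfl fun i _ => by ring
      · ring
  · rw [integral_add (integrable_finsetSum _ fun i _ => i12 i) (i3.const_mul κ),
      integral_finsetSum _ fun i _ => i12 i, integral_const_mul]
    have hs : ∑ i, ∫ z, (P * (|φ z| * ‖b.dx i z‖) + Q * (|φ z| * ‖b.dv i z‖)) ≤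
        d * ((P + Q) * (l2norm φ * ‖b‖)) := by
      refine sum_fin_le fun i => ?_
      rw [integral_add ((i1 i).const_mul P) ((i2 i).const_mul Q), integral_const_mul,
        integral_const_mul, add_mul]
      refine add_le_add (mul_le_mul_of_nonneg_left ((j1 i).trans ?_) hP0)
        (mul_le_mul_of_nonneg_left ((j2 i).trans ?_) hQ0)
      · exact mul_le_mul_of_nonneg_left (b.norm_dx_le i) hl
      · exact mul_le_mul_of_nonneg_left (b.norm_dv_le i) hl
    have hs' := mul_le_mul_of_nonneg_left j3 hκ0
    calc _ ≤ d * ((P + Q) * (l2norm φ * ‖b‖)) + κ * (l2norm φ * ‖b.toL2‖) := add_le_add hs hs'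
      _ = _ := by ring

/-- Integration by parts for the generator of the splitting step. -/
theorem integral_splitAdjoint_mul (h : PotentialBound Γ C) (a b : W12 d) (s : ℝ)
    {φ : PhaseSpace d → ℝ} (hφ : IsTestFunction φ) :
    ∫ z, splitAdjoint Γ a s φ z * b.toL2 z =
      ∫ z, φ z • transportOp (fun i z => -z.2 i + s * fieldConv Γ a i (driftMap s z).1)
        (fun i z => fieldConv Γ a i (driftMap s z).1)
        (fun z => bracketConv Γ a (driftMap s z).1) b z := by
  have hc := hφ.smooth.continuous
  have hφ1 : ContDiff ℝ 1 φ := hφ.smooth.of_le (by exact_mod_cast le_top)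
  have hd1 : ContDiff ℝ 1 fun z : PhaseSpace d => (driftMap s z).1 :=
    contDiff_fst.comp (contDiff_driftMap s)
  have hE1 : ∀ i, ContDiff ℝ 1 fun z : PhaseSpace d => fieldConv Γ a i (driftMap s z).1 := fun i =>
    ((contDiff_fieldConv h a i).of_le one_le_two).comp hd1
  have hKc : Continuous fun z : PhaseSpace d => bracketConv Γ a (driftMap s z).1 :=
    (contDiff_bracketConv h a).continuous.comp hd1.continuous
  have hω : ∀ i, ContDiff ℝ 1 fun z : PhaseSpace d => z.2 i := fun i =>
    (EuclideanSpace.proj (𝕜 := ℝ) i).contDiff.comp contDiff_snd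
  -- The position x − s v is constant along this direction. Hence the field evaluated there is
  -- constant too, and integration by parts along u i creates no zeroth order term.
  set u : Fin d → PhaseSpace d := fun i => s • coordDir d (Sum.inl i) + coordDir d (Sum.inr i)
    with hu
  have hD1 : ∀ i z, fderiv ℝ (fun z => φ z * z.2 i) z (coordDir d (Sum.inl i)) =
      z.2 i * fderiv ℝ φ z (coordDir d (Sum.inl i)) := by
    intro i z
    have e := ((hφ1.differentiable one_ne_zero z).hasFDerivAt.mul
      ((hω i).differentiable one_ne_zero z).hasFDerivAt).fderiv
    have e' : fderiv ℝ (fun z : PhaseSpace d => z.2 i) z (coordDir d (Sum.inl i)) = 0 := by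
      have := ((EuclideanSpace.proj (𝕜 := ℝ) i).hasFDerivAt.comp z
        (hasFDerivAt_snd (𝕜 := ℝ) (p := z))).fderiv
      refine (congrArg (fun L => L (coordDir d (Sum.inl i))) this).trans ?_
      simp [coordDir]
    refine (congrArg (fun L => L (coordDir d (Sum.inl i))) e).trans ?_
    simp [e']
  have hD2 : ∀ i z, fderiv ℝ (fun z => φ z * fieldConv Γ a i (driftMap s z).1) z (u i) =
      fieldConv Γ a i (driftMap s z).1 * fderiv ℝ φ z (u i) := by
    intro i z
    have e := ((hφ1.differentiable one_ne_zero z).hasFDerivAt.mul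
      ((hE1 i).differentiable one_ne_zero z).hasFDerivAt).fderiv
    have e' : fderiv ℝ (fun z : PhaseSpace d => fieldConv Γ a i (driftMap s z).1) z (u i) = 0 := by
      have h1 := (((contDiff_fieldConv h a i).differentiable two_ne_zero
        (driftMap s z).1).hasFDerivAt.comp z
        (hd1.differentiable one_ne_zero z).hasFDerivAt).fderiv
      refine (congrArg (fun L => L (u i)) h1).trans ?_
      have h2 : fderiv ℝ (fun z : PhaseSpace d => (driftMap s z).1) z (u i) = 0 := by
        have h3 := ((hasFDerivAt_fst (𝕜 := ℝ) (p := z)).sub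
          ((hasFDerivAt_snd (𝕜 := ℝ) (p := z)).const_smul s)).fderiv
        refine (congrArg (fun L => L (u i)) h3).trans ?_
        simp [hu, coordDir]
      change fderiv ℝ (fieldConv Γ a i) _ (fderiv ℝ (fun z : PhaseSpace d => (driftMap s z).1) z
        (u i)) = 0
      rw [h2, map_zero]
    refine (congrArg (fun L => L (u i)) e).trans ?_
    simp [e']
  have hW : ∀ i, HasWeakDeriv (u i) b.toL2 (s • b.dx i + b.dv i) := fun i =>
    ((b.hasWeakDeriv (Sum.inl i)).smul_dir s).add_dir (b.hasWeakDeriv (Sum.inr i))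
  have t1 : ∀ i, ∫ z, (z.2 i * fderiv ℝ φ z (coordDir d (Sum.inl i))) • b.toL2 z =
      ∫ z, (φ z * -z.2 i) • b.dx i z := by
    intro i
    have := (b.hasWeakDeriv (Sum.inl i)).integral_C1_real (hφ1.mul (hω i)) hφ.compact.mul_right
    simp only [hD1] at this
    rw [this, ← integral_neg]
    simp only [mul_neg, neg_smul]
    rfl
  have hsplit : ∀ (i : Fin d) (ψ : PhaseSpace d → ℝ) (_ : Continuous ψ) (_ : HasCompactSupport ψ),
      ∫ z, ψ z • (s • b.dx i + b.dv i) z =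
        (∫ z, (s * ψ z) • b.dx i z) + ∫ z, ψ z • b.dv i z := by
    intro i ψ hψ hψc
    have n1 : Integrable fun z => (s * ψ z) • b.dx i z :=
      integrable_smul_L2 (continuous_const.mul hψ) hψc.mul_left _
    have n2 : Integrable fun z => ψ z • b.dv i z := integrable_smul_L2 hψ hψc _
    rw [← integral_add n1 n2]
    refine integral_congr_ae ?_
    filter_upwards [Lp.coeFn_add (s • b.dx i) (b.dv i), Lp.coeFn_smul s (b.dx i)] with z h1 h2
    rw [h1, Pi.add_apply, h2, Pi.smul_apply, smul_add, smul_smul, mul_comm]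
  have hcE : ∀ i, Continuous fun z => φ z * fieldConv Γ a i (driftMap s z).1 := fun i =>
    hc.mul (hE1 i).continuous
  have t2 : ∀ i, ∫ z, (-(fieldConv Γ a i (driftMap s z).1 * fderiv ℝ φ z (u i))) • b.toL2 z =
      (∫ z, (φ z * (s * fieldConv Γ a i (driftMap s z).1)) • b.dx i z) +
      ∫ z, (φ z * fieldConv Γ a i (driftMap s z).1) • b.dv i z := by
    intro i
    have := (hW i).integral_C1_real (hφ1.mul (hE1 i)) hφ.compact.mul_right
    simp only [hD2] at this
    simp only [neg_smul]
    rw [integral_neg, this, neg_neg, hsplit i _ (hcE i) hφ.compact.mul_right]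
    simp only [mul_left_comm]
  have hfd : Continuous (fderiv ℝ φ) := hφ.smooth.continuous_fderiv (by simp)
  have hfc : HasCompactSupport (fderiv ℝ φ) := hφ.compact.fderiv ℝ
  have k1 : ∀ i, Integrable fun z =>
      (z.2 i * fderiv ℝ φ z (coordDir d (Sum.inl i))) • b.toL2 z := fun i =>
    integrable_smul_L2 ((hω i).continuous.mul (hfd.clm_apply continuous_const))
      (hφ.compact.fderiv_apply (𝕜 := ℝ) _).mul_left _
  have k2 : ∀ i, Integrable fun z =>
      (-(fieldConv Γ a i (driftMap s z).1 * fderiv ℝ φ z (u i))) • b.toL2 z := fun i =>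
    integrable_smul_L2 ((hE1 i).continuous.mul (hfd.clm_apply continuous_const)).neg
      (hφ.compact.fderiv_apply (𝕜 := ℝ) _).mul_left.neg _
  have k3 : Integrable fun z =>
      ((φ z : ℂ) * bracketConv Γ a (driftMap s z).1) * b.toL2 z :=
    integrable_mul_L2 ((Complex.continuous_ofReal.comp hc).mul hKc)
      (hφ.compact.comp_left (g := Complex.ofReal) rfl).mul_right _
  have hp : ∀ i, Continuous fun z : PhaseSpace d =>
      -z.2 i + s * fieldConv Γ a i (driftMap s z).1 := fun i =>
    (hω i).continuous.neg.add (continuous_const.mul (hE1 i).continuous)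
  rw [integral_smul_transportOp hp (fun i => (hE1 i).continuous) hKc b hφ]
  have e1 : ∀ i, ∫ z, (φ z * (-z.2 i + s * fieldConv Γ a i (driftMap s z).1)) • b.dx i z =
      (∫ z, (φ z * -z.2 i) • b.dx i z) +
      ∫ z, (φ z * (s * fieldConv Γ a i (driftMap s z).1)) • b.dx i z := by
    intro i
    have n1 : Integrable fun z => (φ z * -z.2 i) • b.dx i z :=
      integrable_smul_L2 (hc.mul (hω i).continuous.neg) hφ.compact.mul_right _
    have n2 : Integrable fun z => (φ z * (s * fieldConv Γ a i (driftMap s z).1)) • b.dx i z :=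
      integrable_smul_L2 (hc.mul (continuous_const.mul (hE1 i).continuous))
        hφ.compact.mul_right _
    rw [← integral_add n1 n2]
    simp only [mul_add, add_smul]
  simp_rw [e1, add_assoc, ← t2, ← t1]
  have k12 : ∀ i, Integrable fun z =>
      (z.2 i * fderiv ℝ φ z (coordDir d (Sum.inl i))) • b.toL2 z +
      (-(fieldConv Γ a i (driftMap s z).1 * fderiv ℝ φ z (u i))) • b.toL2 z := fun i =>
    (k1 i).add (k2 i)
  simp_rw [← integral_add (k1 _) (k2 _)]
  rw [← integral_finsetSum _ fun i _ => k12 i,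
    ← integral_sub (integrable_finsetSum _ fun i _ => k12 i) k3]
  refine integral_congr_ae (Eventually.of_forall fun z => ?_)
  simp only [splitAdjoint, sub_mul]
  congr 1
  -- The direction of differentiation in the adjoint decomposes along the directions for which
  -- integration by parts was prepared.
  have hdec : (z.2 - s • fieldVec Γ a (driftMap s z).1, -fieldVec Γ a (driftMap s z).1) =
      ∑ i, (z.2 i • coordDir d (Sum.inl i) -
        fieldConv Γ a i (driftMap s z).1 • u i) := by
    have h1 := inl_eq_sum (z.2 - s • fieldVec Γ a (driftMap s z).1)
    have h2 := inr_eq_sum (-fieldVec Γ a (driftMap s z).1)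
    have h3 : (z.2 - s • fieldVec Γ a (driftMap s z).1, -fieldVec Γ a (driftMap s z).1) =
      ((z.2 - s • fieldVec Γ a (driftMap s z).1, 0) : PhaseSpace d) +
      (0, -fieldVec Γ a (driftMap s z).1) := by simp
    rw [h3, h1, h2, ← Finset.sum_add_distrib]
    refine Finset.sum_congr rfl fun i _ => ?_
    simp only [hu, PiLp.sub_apply, PiLp.smul_apply, PiLp.neg_apply, fieldVec, smul_eq_mul]
    module
  rw [hdec, map_sum, Complex.ofReal_sum, Finset.sum_mul]
  refine Finset.sum_congr rfl fun i _ => ?_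
  simp only [map_sub, map_smul, smul_eq_mul, Complex.real_smul]
  push_cast
  ring

theorem norm_fieldVec_sub_le (h : PotentialBound Γ C) (a b : W12 d) (x) :
    ‖fieldVec Γ a x - fieldVec Γ b x‖ ≤
      d * (C * (‖a.toL2 - b.toL2‖ * (‖a.toL2‖ + ‖b.toL2‖))) := by
  rw [euclidean_eq_sum (fieldVec Γ a x - fieldVec Γ b x)]
  refine (norm_sum_le _ _).trans (sum_fin_le fun i => ?_)
  rw [norm_smul, PiLp.norm_single, norm_one, mul_one]
  exact abs_fieldConv_sub_le h a b i x

/-- The generator of the splitting step at s = 0 is the true right-hand side. In adjoint form the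
local derivatives fall on φ, so a enters through its L² function and its mean fields only. -/
theorem integral_smul_hvlRHS (h : PotentialBound Γ C) (a : W12 d) {φ : PhaseSpace d → ℝ}
    (hφ : IsTestFunction φ) :
    ∫ z, φ z • hvlRHS Γ a z = ∫ z, splitAdjoint Γ a 0 φ z * a.toL2 z := by
  rw [integral_splitAdjoint_mul h a a 0 hφ, hvlRHS_eq_transportOp]
  simp [driftMap]

/-- On bounded subsets of `W^{1,2}`, the right-hand side is Lipschitz continuous with respect to
the `L²` norm when tested against a fixed function. -/
theorem exists_norm_integral_hvlRHS_sub_le (h : PotentialBound Γ C) {φ : PhaseSpace d → ℝ}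
    (hφ : IsTestFunction φ) {M : ℝ} (hM : 0 ≤ M) : ∃ A : ℝ, 0 ≤ A ∧ ∀ a b : W12 d, ‖a‖ ≤ M →
      ‖b‖ ≤ M → ‖(∫ z, φ z • hvlRHS Γ a z) - ∫ z, φ z • hvlRHS Γ b z‖ ≤
        A * ‖a.toL2 - b.toL2‖ := by
  have hC := h.nonneg
  -- A compactly supported majorant of the adjoint: up to constants it dominates both the adjoint
  -- and its variation, for all a in the ball of radius M.
  set Θ : PhaseSpace d → ℝ := fun z => ‖fderiv ℝ φ z‖ * (‖z.2‖ + 1) + |φ z| with hΘ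
  have hfd : Continuous (fderiv ℝ φ) := hφ.smooth.continuous_fderiv (by simp)
  have hΘc : Continuous Θ := (hfd.norm.mul (continuous_snd.norm.add continuous_const)).add
    hφ.smooth.continuous.abs
  have hΘs : HasCompactSupport Θ :=
    ((hφ.compact.fderiv ℝ).norm.mul_right).add hφ.compact.norm
  have hΘ2 : MemLp Θ 2 volume := hΘc.memLp_of_hasCompactSupport hΘs
  have hΘ0 : ∀ z, 0 ≤ Θ z := fun z => by positivity
  set B : ℝ := d * (C * M ^ 2) + 1 with hB
  have hB1 : 1 ≤ B := by rw [hB]; have : 0 ≤ d * (C * M ^ 2) := by positivity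
                         linarith
  have hadj : ∀ a, Continuous (splitAdjoint Γ a 0 φ) := fun a =>
    (continuous_splitAdjoint h a hφ).comp (Continuous.prodMk_right 0)
  have hadjs : ∀ a, HasCompactSupport (splitAdjoint Γ a 0 φ) := fun a => by
    refine hΘs.mono fun z hz => ?_
    rw [Function.mem_support] at hz ⊢
    contrapose! hz
    have h1 : ‖fderiv ℝ φ z‖ * (‖z.2‖ + 1) = 0 ∧ |φ z| = 0 :=
      (add_eq_zero_iff_of_nonneg (by positivity) (abs_nonneg _)).1 hz
    have h2 : fderiv ℝ φ z = 0 := by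
      rcases mul_eq_zero.1 h1.1 with h3 | h3
      · exact norm_eq_zero.1 h3
      · have := norm_nonneg z.2; linarith
    simp [splitAdjoint, h2, abs_eq_zero.1 h1.2]
  have hb1 : ∀ a : W12 d, ‖a‖ ≤ M → ∀ z, ‖splitAdjoint Γ a 0 φ z‖ ≤ B * Θ z := by
    intro a ha z
    have ha' := a.norm_toL2_le.trans ha
    have e1 : ‖fieldVec Γ a (driftMap 0 z).1‖ ≤ d * (C * M ^ 2) :=
      (norm_fieldVec_le h a _).trans (by gcongr)
    have e2 : ‖bracketConv Γ a (driftMap 0 z).1‖ ≤ d * (C * M ^ 2) :=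
      (norm_bracketConv_le h a _).trans (by rw [sq]; gcongr)
    have e3 : ‖((z.2 - (0 : ℝ) • fieldVec Γ a (driftMap 0 z).1,
        -fieldVec Γ a (driftMap 0 z).1) : PhaseSpace d)‖ ≤ B * (‖z.2‖ + 1) := by
      have p : 0 ≤ ‖z.2‖ := norm_nonneg _
      rw [Prod.norm_def, zero_smul, sub_zero, norm_neg]
      exact max_le (by nlinarith) (by nlinarith)
    rw [splitAdjoint]
    refine (norm_sub_le _ _).trans ?_
    rw [Complex.norm_real, norm_mul, Complex.norm_real, Real.norm_eq_abs (φ z)]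
    have e4 := (((fderiv ℝ φ z).le_opNorm _).trans
      (mul_le_mul_of_nonneg_left e3 (norm_nonneg (fderiv ℝ φ z))))
    have e5 := mul_le_mul_of_nonneg_left (e2.trans (show d * (C * M ^ 2) ≤ B by linarith))
      (abs_nonneg (φ z))
    calc _ ≤ _ := add_le_add e4 e5
      _ = _ := by simp only [hΘ]; ring
  have hb2 : ∀ a b : W12 d, ‖a‖ ≤ M → ‖b‖ ≤ M → ∀ z,
      ‖splitAdjoint Γ a 0 φ z - splitAdjoint Γ b 0 φ z‖ ≤
        d * (C * (‖a.toL2 - b.toL2‖ * (2 * M))) * Θ z := by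
    intro a b ha hb z
    have hab : ‖a.toL2‖ + ‖b.toL2‖ ≤ 2 * M := by
      linarith [a.norm_toL2_le.trans ha, b.norm_toL2_le.trans hb]
    have hab' : ‖a‖ + ‖b‖ ≤ 2 * M := by linarith
    have e1 : ‖fieldVec Γ a (driftMap 0 z).1 - fieldVec Γ b (driftMap 0 z).1‖ ≤
        d * (C * (‖a.toL2 - b.toL2‖ * (2 * M))) :=
      (norm_fieldVec_sub_le h a b _).trans (by gcongr)
    have e2 : ‖bracketConv Γ a (driftMap 0 z).1 - bracketConv Γ b (driftMap 0 z).1‖ ≤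
        d * (C * (‖a.toL2 - b.toL2‖ * (2 * M))) :=
      (norm_bracketConv_sub_le h a b _).trans (by gcongr)
    set S := d * (C * (‖a.toL2 - b.toL2‖ * (2 * M))) with hS
    have hS0 : 0 ≤ S := by positivity
    have e : splitAdjoint Γ a 0 φ z - splitAdjoint Γ b 0 φ z =
        ((fderiv ℝ φ z (0, fieldVec Γ b (driftMap 0 z).1 - fieldVec Γ a (driftMap 0 z).1) : ℝ) : ℂ)
        - (φ z : ℂ) * (bracketConv Γ a (driftMap 0 z).1 - bracketConv Γ b (driftMap 0 z).1) := by
      have hv : ((0, fieldVec Γ b (driftMap 0 z).1 - fieldVec Γ a (driftMap 0 z).1) :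
          PhaseSpace d) = (z.2 - (0 : ℝ) • fieldVec Γ a (driftMap 0 z).1,
            -fieldVec Γ a (driftMap 0 z).1) - (z.2 - (0 : ℝ) • fieldVec Γ b (driftMap 0 z).1,
            -fieldVec Γ b (driftMap 0 z).1) := by
        simp [neg_add_eq_sub]
      rw [hv, map_sub, Complex.ofReal_sub, splitAdjoint, splitAdjoint]
      ring
    rw [e]
    refine (norm_sub_le _ _).trans ?_
    rw [Complex.norm_real, norm_mul, Complex.norm_real, Real.norm_eq_abs (φ z)]
    have e3 : ‖((0, fieldVec Γ b (driftMap 0 z).1 - fieldVec Γ a (driftMap 0 z).1) :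
        PhaseSpace d)‖ ≤ S * (‖z.2‖ + 1) := by
      have p : 0 ≤ ‖z.2‖ := norm_nonneg _
      rw [Prod.norm_def, norm_zero, norm_sub_rev]
      exact max_le (by positivity) (by nlinarith)
    have e4 := (((fderiv ℝ φ z).le_opNorm _).trans
      (mul_le_mul_of_nonneg_left e3 (norm_nonneg (fderiv ℝ φ z))))
    have e5 := mul_le_mul_of_nonneg_left e2 (abs_nonneg (φ z))
    calc _ ≤ _ := add_le_add e4 e5
      _ = _ := by simp only [hΘ]; ring
  refine ⟨B * l2norm Θ + d * (C * (2 * M)) * l2norm Θ * M, ?_, fun a b ha hb => ?_⟩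
  · have := l2norm_nonneg Θ; positivity
  rw [integral_smul_hvlRHS h a hφ, integral_smul_hvlRHS h b hφ,
    ← integral_sub (integrable_mul_L2 (hadj a) (hadjs a) _)
      (integrable_mul_L2 (hadj b) (hadjs b) _)]
  have i1 := integrable_abs_mul_norm hΘ2 (a.toL2 - b.toL2)
  have i2 := integrable_abs_mul_norm hΘ2 b.toL2
  set S := d * (C * (‖a.toL2 - b.toL2‖ * (2 * M))) with hS
  have hS0 : 0 ≤ S := by positivity
  have hI : Integrable fun z => B * (|Θ z| * ‖(a.toL2 - b.toL2) z‖) + S * (|Θ z| * ‖b.toL2 z‖) :=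
    (i1.const_mul B).add (i2.const_mul S)
  refine (norm_integral_le_of_norm_le hI ?_).trans ?_
  · filter_upwards [Lp.coeFn_sub a.toL2 b.toL2] with z hz
    have e : splitAdjoint Γ a 0 φ z * a.toL2 z - splitAdjoint Γ b 0 φ z * b.toL2 z =
        splitAdjoint Γ a 0 φ z * (a.toL2 - b.toL2) z +
        (splitAdjoint Γ a 0 φ z - splitAdjoint Γ b 0 φ z) * b.toL2 z := by
      rw [hz, Pi.sub_apply]; ring
    rw [e]
    refine (norm_add_le _ _).trans ?_
    rw [norm_mul, norm_mul, abs_of_nonneg (hΘ0 z)]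
    calc _ ≤ B * Θ z * ‖(a.toL2 - b.toL2) z‖ + S * Θ z * ‖b.toL2 z‖ :=
          add_le_add (mul_le_mul_of_nonneg_right (hb1 a ha z) (norm_nonneg _))
            (mul_le_mul_of_nonneg_right (hb2 a b ha hb z) (norm_nonneg _))
      _ = _ := by ring
  · rw [integral_add (i1.const_mul B) (i2.const_mul S), integral_const_mul, integral_const_mul]
    have j1 := mul_le_mul_of_nonneg_left (integral_abs_mul_norm_le hΘ2 (a.toL2 - b.toL2))
      (zero_le_one.trans hB1)
    have j2 := mul_le_mul_of_nonneg_left ((integral_abs_mul_norm_le hΘ2 b.toL2).trans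
      (mul_le_mul_of_nonneg_left (b.norm_toL2_le.trans hb) (l2norm_nonneg Θ))) hS0
    calc _ ≤ _ := add_le_add j1 j2
      _ = _ := by rw [hS]; ring

/-! ### Estimates for the splitting step -/

theorem HasVelocityBound.mono {a : W12 d} {ρ ρ' : ℝ} (h : HasVelocityBound a ρ) (hρ : ρ ≤ ρ') :
    HasVelocityBound a ρ' := by
  filter_upwards [h] with z hz hlt using hz (hρ.trans_lt hlt)

/-- Velocities change only in the kick, by at most s times the supremum of the field. -/
theorem HasVelocityBound.splitStep (h : PotentialBound Γ C) {a : W12 d} {ρ : ℝ}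
    (ha : HasVelocityBound a ρ) {s : ℝ} (hs : 0 ≤ s) :
    HasVelocityBound (splitStep h a s) (ρ + s * (d * (C * ‖a.toL2‖ ^ 2))) := by
  have hmp : MeasurePreserving (fun z : PhaseSpace d => kickMap (fun x => s • fieldVec Γ a x)
      (driftMap s z)) volume volume :=
    (measurePreserving_kickMap ((contDiff_fieldVec h a).continuous.const_smul s)).comp
      (measurePreserving_driftMap s)
  filter_upwards [coeFn_splitStep h a s, hmp.quasiMeasurePreserving.ae ha] with z h1 h2 hz
  rw [h1, h2, mul_zero]
  have e : (kickMap (fun x => s • fieldVec Γ a x) (driftMap s z)).2 =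
      z.2 + s • fieldVec Γ a (driftMap s z).1 := rfl
  have h3 : ‖s • fieldVec Γ a (driftMap s z).1‖ ≤ s * (d * (C * ‖a.toL2‖ ^ 2)) := by
    rw [norm_smul, Real.norm_of_nonneg hs]
    exact mul_le_mul_of_nonneg_left (norm_fieldVec_le h a _) hs
  have h4 := norm_sub_le (z.2 + s • fieldVec Γ a (driftMap s z).1)
    (s • fieldVec Γ a (driftMap s z).1)
  rw [add_sub_cancel_right] at h4
  rw [e]
  linarith

theorem abs_fieldConv_sub_translate_le (h : PotentialBound Γ C) (a : W12 d) (i : Fin d)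
    (x y : EuclideanSpace ℝ (Fin d)) :
    |fieldConv Γ a i x - fieldConv Γ a i y| ≤ C * ‖a.toL2‖ ^ 2 * ‖x - y‖ :=
  Convex.norm_image_sub_le_of_norm_fderiv_le (𝕜 := ℝ) (s := Set.univ)
    (fun z _ => (contDiff_fieldConv h a i).differentiable two_ne_zero z)
    (fun z _ => norm_fderiv_fieldConv_le h a i z) convex_univ (Set.mem_univ y) (Set.mem_univ x)

theorem norm_bracketConv_sub_translate_le (h : PotentialBound Γ C) (a : W12 d)
    (x y : EuclideanSpace ℝ (Fin d)) :
    ‖bracketConv Γ a x - bracketConv Γ a y‖ ≤ d * (C * (‖a.toL2‖ * ‖a‖)) * ‖x - y‖ :=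
  Convex.norm_image_sub_le_of_norm_fderiv_le (𝕜 := ℝ) (s := Set.univ)
    (fun z _ => (contDiff_bracketConv h a).differentiable one_ne_zero z)
    (fun z _ => norm_fderiv_bracketConv_le h a z) convex_univ (Set.mem_univ y) (Set.mem_univ x)

theorem transportOp_zero (b : W12 d) :
    transportOp (fun _ _ => 0) (fun _ _ => 0) (fun _ => 0) b = fun _ => 0 := by
  ext z; simp [transportOp]

theorem norm_integral_transportOp_le {p q : Fin d → PhaseSpace d → ℝ} {k : PhaseSpace d → ℂ}
    (hp : ∀ i, Continuous (p i)) (hq : ∀ i, Continuous (q i)) (hk : Continuous k)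
    {b : W12 d} {ρ P Q κ : ℝ} (hb : HasVelocityBound b ρ) (hP0 : 0 ≤ P) (hQ0 : 0 ≤ Q) (hκ0 : 0 ≤ κ)
    (hP : ∀ i z, ‖z.2‖ ≤ ρ → |p i z| ≤ P) (hQ : ∀ i z, ‖z.2‖ ≤ ρ → |q i z| ≤ Q)
    (hκ : ∀ z, ‖z.2‖ ≤ ρ → ‖k z‖ ≤ κ) {φ : PhaseSpace d → ℝ} (hφ : IsTestFunction φ) :
    ‖∫ z, φ z • transportOp p q k b z‖ ≤ (d * (P + Q) * ‖b‖ + κ * ‖b.toL2‖) * l2norm φ := by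
  have := norm_integral_transportOp_sub_le hp hq hk (p' := fun _ _ => 0) (q' := fun _ _ => 0)
    (k' := fun _ => 0) (fun _ => continuous_const) (fun _ => continuous_const) continuous_const
    hb hP0 hQ0 hκ0 (by simpa using hP) (by simpa using hQ) (by simpa using hκ) hφ
  simpa [transportOp_zero] using this

/-- For functions with bounded velocity support, the localized right-hand sides are bounded
uniformly in the localization. -/
theorem exists_norm_cutRHS_le_of_velocity (h : PotentialBound Γ C) {ρ M : ℝ} (hρ : 0 ≤ ρ)
    (hM : 0 ≤ M) : ∃ B : ℝ, 0 ≤ B ∧ ∀ a : W12 d, ‖a‖ ≤ M → HasVelocityBound a ρ →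
      ∀ R : ℝ, 0 < R → ‖cutRHS Γ R a‖ ≤ B := by
  have hC := h.nonneg
  set B : ℝ := d * (ρ + C * M ^ 2) * M + d * (C * (M * M)) * M with hB
  have hB0 : 0 ≤ B := by positivity
  refine ⟨2 * B, by positivity, fun a ha haρ R hR => norm_le_of_test hB0 fun φ hφ => ?_⟩
  have ha' := a.norm_toL2_le.trans ha
  rw [integral_smul_cutRHS h φ hR, hvlRHS_eq_transportOp]
  refine (norm_integral_transportOp_le (P := ρ) (Q := C * M ^ 2) (κ := d * (C * (M * M)))
    (fun i => by fun_prop)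
    (fun i => (contDiff_fieldConv h a i).continuous.comp continuous_fst)
    ((contDiff_bracketConv h a).continuous.comp continuous_fst) haρ hρ (by positivity)
    (by positivity) (fun i z hz => ?_) (fun i z _ => ?_) (fun z _ => ?_)
    (hφ.mul_velCutoff R)).trans ?_
  · rw [abs_neg]; exact (PiLp.norm_apply_le z.2 i).trans hz
  · exact (abs_fieldConv_le h a i _).trans (by gcongr)
  · exact (norm_bracketConv_le h a _).trans (by gcongr)
  · refine mul_le_mul ?_ (l2norm_mono hφ.memLp (Eventually.of_forall fun z => ?_))
      (l2norm_nonneg _) hB0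
    · rw [hB]; gcongr
    · rw [abs_mul]
      exact mul_le_of_le_one_right (abs_nonneg _) (abs_velCutoff_le_one R z)

/-- Consistency of the splitting step. -/
theorem exists_splitStep_bounds (h : PotentialBound Γ C) {ρ M : ℝ} (hρ : 0 ≤ ρ) (hM : 0 ≤ M) :
    ∃ N : ℝ, 0 ≤ N ∧ ∀ a : W12 d, ‖a‖ ≤ M → HasVelocityBound a ρ →
      (∀ s ∈ Set.Icc (0 : ℝ) 1, ∀ t ∈ Set.Icc (0 : ℝ) 1,
        ‖(splitStep h a t).toL2 - (splitStep h a s).toL2‖ ≤ N * |t - s|) ∧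
      ∀ φ : PhaseSpace d → ℝ, IsTestFunction φ → ∀ s ∈ Set.Icc (0 : ℝ) 1,
        ‖(∫ z, splitAdjoint Γ a s φ z * (splitStep h a s).toL2 z) -
          ∫ z, φ z • hvlRHS Γ (splitStep h a s) z‖ ≤ N * s * l2norm φ := by
  have hC := h.nonneg
  -- Over a step of length at most 1, M₁ bounds the Sobolev norm and ρ₁ the velocities. L bounds the
  -- time derivative tested with φ, whence the Lipschitz constant 2 L in L². N₂ collects the
  -- consistency errors below.
  set M₁ : ℝ := Real.exp (growthRate d C M) * M with hM₁
  have hM₁0 : 0 ≤ M₁ := by positivity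
  have hMM₁ : M ≤ M₁ := le_mul_of_one_le_left hM (Real.one_le_exp (growthRate_nonneg hC M))
  set ρ₁ : ℝ := ρ + d * (C * M ^ 2) with hρ₁
  have hρ₁0 : 0 ≤ ρ₁ := by positivity
  set L : ℝ := d * (ρ₁ + 1 * (C * M ^ 2) + C * M ^ 2) * M₁ + d * (C * (M * M)) * M₁ with hL
  have hL0 : 0 ≤ L := by positivity
  set N₂ : ℝ := d * (C * M ^ 2 + (C * M ^ 2 * ρ₁ + C * (2 * L * (M + M₁)))) * M₁ +
    (d * (C * (M * M)) * ρ₁ + d * (C * (2 * L * (M + M₁)))) * M₁ with hN₂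
  have hN₂0 : 0 ≤ N₂ := by positivity
  refine ⟨max (2 * L) N₂, by positivity, fun a ha haρ => ?_⟩
  have ha2 := a.norm_toL2_le.trans ha
  have hb : ∀ s ∈ Set.Icc (0 : ℝ) 1, ‖splitStep h a s‖ ≤ M₁ := fun s hs => by
    refine (norm_splitStep_le h a s).trans (mul_le_mul (Real.exp_le_exp.2 ?_) ha (norm_nonneg _)
      (Real.exp_nonneg _))
    rw [abs_of_nonneg hs.1]
    have := growthRate_mono (d := d) hC (norm_nonneg _) ha2
    exact (mul_le_of_le_one_right (growthRate_nonneg hC _) hs.2).trans this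
  have hbv : ∀ s ∈ Set.Icc (0 : ℝ) 1, HasVelocityBound (splitStep h a s) ρ₁ := fun s hs => by
    refine (haρ.splitStep h hs.1).mono ?_
    have : s * (d * (C * ‖a.toL2‖ ^ 2)) ≤ 1 * (d * (C * M ^ 2)) := by
      have := hs.2
      gcongr
    rw [hρ₁]; linarith
  have hd : ∀ s : ℝ, Continuous fun z : PhaseSpace d => (driftMap s z).1 := fun s =>
    continuous_fst.comp (contDiff_driftMap (n := 1) s).continuous
  have hcE : ∀ (s : ℝ) i, Continuous fun z : PhaseSpace d => fieldConv Γ a i (driftMap s z).1 :=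
    fun s i => (contDiff_fieldConv h a i).continuous.comp (hd s)
  have hcK : ∀ s : ℝ, Continuous fun z : PhaseSpace d => bracketConv Γ a (driftMap s z).1 :=
    fun s => (contDiff_bracketConv h a).continuous.comp (hd s)
  have hcP : ∀ (s : ℝ) (i : Fin d), Continuous fun z : PhaseSpace d =>
      -z.2 i + s * fieldConv Γ a i (driftMap s z).1 := fun s i => by
    have := hcE s i
    fun_prop
  have hE : ∀ i x, |fieldConv Γ a i x| ≤ C * M ^ 2 := fun i x =>
    (abs_fieldConv_le h a i x).trans (by gcongr)
  have speed : ∀ φ : PhaseSpace d → ℝ, IsTestFunction φ → ∀ s ∈ Set.Icc (0 : ℝ) 1,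
      ‖∫ z, splitAdjoint Γ a s φ z * (splitStep h a s).toL2 z‖ ≤ L * l2norm φ := by
    intro φ hφ s hs
    rw [integral_splitAdjoint_mul h a _ s hφ]
    refine (norm_integral_transportOp_le (P := ρ₁ + 1 * (C * M ^ 2)) (Q := C * M ^ 2)
      (κ := d * (C * (M * M))) (hcP s) (hcE s) (hcK s) (hbv s hs) (by positivity) (by positivity)
      (by positivity) (fun i z hz => ?_) (fun i z _ => hE i _) (fun z _ => ?_) hφ).trans ?_
    · refine (abs_add_le _ _).trans (add_le_add ?_ ?_)
      · rw [abs_neg]; exact (PiLp.norm_apply_le z.2 i).trans hz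
      · rw [abs_mul, abs_of_nonneg hs.1]
        exact mul_le_mul hs.2 (hE i _) (abs_nonneg _) zero_le_one
    · exact (norm_bracketConv_le h a _).trans (by gcongr)
    · refine mul_le_mul_of_nonneg_right ?_ (l2norm_nonneg φ)
      have h1 := hb s hs
      have h2 := (W12.norm_toL2_le _).trans h1
      rw [hL]; gcongr
  have lip : ∀ s ∈ Set.Icc (0 : ℝ) 1, ∀ t ∈ Set.Icc (0 : ℝ) 1,
      ‖(splitStep h a t).toL2 - (splitStep h a s).toL2‖ ≤ 2 * L * |t - s| := by
    intro s hs t ht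
    rw [mul_assoc]
    refine norm_le_of_test (by positivity) fun φ hφ => ?_
    rw [integral_smul_sub hφ.smooth.continuous hφ.compact]
    have := Convex.norm_image_sub_le_of_norm_hasDerivWithin_le (s := Set.Icc (0 : ℝ) 1)
      (fun r _ => (hasDerivAt_integral_splitStep h a hφ r).hasDerivWithinAt)
      (fun r hr => speed φ hφ r hr) (convex_Icc 0 1) hs ht
    refine this.trans_eq ?_
    rw [Real.norm_eq_abs]; ring
  refine ⟨fun s hs t ht => (lip s hs t ht).trans
    (mul_le_mul_of_nonneg_right (le_max_left _ _) (abs_nonneg _)), fun φ hφ s hs => ?_⟩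
  have hdist : ‖a.toL2 - (splitStep h a s).toL2‖ ≤ 2 * L * s := by
    have := lip s hs 0 ⟨le_rfl, zero_le_one⟩
    rwa [splitStep_zero, zero_sub, abs_neg, abs_of_nonneg hs.1] at this
  set b := splitStep h a s with hb_def
  have hbM := hb s hs
  have hbM2 : ‖b.toL2‖ ≤ M₁ := b.norm_toL2_le.trans hbM
  have hs0 := hs.1
  have hdr : ∀ z : PhaseSpace d, ‖z.2‖ ≤ ρ₁ → ‖(driftMap s z).1 - z.1‖ ≤ s * ρ₁ := fun z hz => by
    simp only [driftMap, sub_sub_cancel_left, norm_neg, norm_smul, Real.norm_of_nonneg hs0]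
    exact mul_le_mul_of_nonneg_left hz hs0
  rw [integral_splitAdjoint_mul h a _ s hφ, hvlRHS_eq_transportOp]
  -- Three coefficient errors, each O(s): the extra s E in front of ∇_x, the mean fields taken at x
  -- − s v instead of x, and the mean fields of the frozen a instead of the current function.
  refine (norm_integral_transportOp_sub_le (P := s * (C * M ^ 2))
    (Q := s * (C * M ^ 2 * ρ₁ + C * (2 * L * (M + M₁))))
    (κ := s * (d * (C * (M * M)) * ρ₁ + d * (C * (2 * L * (M + M₁)))))
    (hcP s) (hcE s) (hcK s) (fun i => by fun_prop)
    (fun i => (contDiff_fieldConv h b i).continuous.comp continuous_fst)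
    ((contDiff_bracketConv h b).continuous.comp continuous_fst) (hbv s hs) (by positivity)
    (by positivity) (by positivity) (fun i z hz => ?_) (fun i z hz => ?_) (fun z hz => ?_)
    hφ).trans ?_
  · rw [add_sub_cancel_left, abs_mul, abs_of_nonneg hs0]
    exact mul_le_mul_of_nonneg_left (hE i _) hs0
  · have e1 := abs_fieldConv_sub_translate_le h a i (driftMap s z).1 z.1
    have e2 := abs_fieldConv_sub_le h a b i z.1
    have e3 : C * ‖a.toL2‖ ^ 2 * ‖(driftMap s z).1 - z.1‖ ≤ C * M ^ 2 * (s * ρ₁) := by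
      have := hdr z hz
      gcongr
    have e4 : C * (‖a.toL2 - b.toL2‖ * (‖a.toL2‖ + ‖b.toL2‖)) ≤ C * (2 * L * s * (M + M₁)) := by
      gcongr
    calc _ ≤ _ := abs_sub_le _ (fieldConv Γ a i z.1) _
      _ ≤ C * M ^ 2 * (s * ρ₁) + C * (2 * L * s * (M + M₁)) :=
        add_le_add (e1.trans e3) (e2.trans e4)
      _ = _ := by ring
  · have e1 := norm_bracketConv_sub_translate_le h a (driftMap s z).1 z.1
    have e2 := norm_bracketConv_sub_le h a b z.1
    have e3 : d * (C * (‖a.toL2‖ * ‖a‖)) * ‖(driftMap s z).1 - z.1‖ ≤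
        d * (C * (M * M)) * (s * ρ₁) := by
      have := hdr z hz
      gcongr
    have e4 : d * (C * (‖a.toL2 - b.toL2‖ * (‖a‖ + ‖b‖))) ≤ d * (C * (2 * L * s * (M + M₁))) := by
      gcongr
    calc _ ≤ _ := norm_sub_le_norm_sub_add_norm_sub _ (bracketConv Γ a z.1) _
      _ ≤ d * (C * (M * M)) * (s * ρ₁) + d * (C * (2 * L * s * (M + M₁))) :=
        add_le_add (e1.trans e3) (e2.trans e4)
      _ = _ := by ring
  · refine mul_le_mul_of_nonneg_right ?_ (l2norm_nonneg φ)
    calc _ ≤ d * (s * (C * M ^ 2) + s * (C * M ^ 2 * ρ₁ + C * (2 * L * (M + M₁)))) * M₁ +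
          s * (d * (C * (M * M)) * ρ₁ + d * (C * (2 * L * (M + M₁)))) * M₁ := by gcongr
      _ = N₂ * s := by rw [hN₂]; ring
      _ ≤ _ := mul_le_mul_of_nonneg_right (le_max_right _ _) hs0

/-- The tested right-hand side is continuous along curves that are continuous in `L²` and bounded
in `W^{1,2}`. -/
theorem continuousOn_integral_hvlRHS (h : PotentialBound Γ C) {α : ℝ → W12 d} {s : Set ℝ} {M : ℝ}
    (hα : ContinuousOn (fun t => (α t).toL2) s) (hM0 : 0 ≤ M) (hM : ∀ t ∈ s, ‖α t‖ ≤ M)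
    {φ : PhaseSpace d → ℝ} (hφ : IsTestFunction φ) :
    ContinuousOn (fun t => ∫ z, φ z • hvlRHS Γ (α t) z) s := by
  obtain ⟨A, hA, hlip⟩ := exists_norm_integral_hvlRHS_sub_le h hφ hM0
  intro t ht
  refine tendsto_iff_norm_sub_tendsto_zero.2 ?_
  have h1 := (tendsto_iff_norm_sub_tendsto_zero.1 (hα t ht)).const_mul A
  rw [mul_zero] at h1
  refine squeeze_zero' (Eventually.of_forall fun _ => norm_nonneg _) ?_ h1
  filter_upwards [self_mem_nhdsWithin] with r hr using hlip _ _ (hM r hr) (hM t ht)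

/-- Continuity into L² already gives strong measurability into W^{1,2}, by the Borel embedding; the
bound does the rest. -/
theorem integrableOn_of_continuousOn_toL2 {α : ℝ → W12 d} {T M : ℝ}
    (hα : ContinuousOn (fun t => (α t).toL2) (Set.Icc 0 T)) (hM : ∀ t ∈ Set.Icc 0 T, ‖α t‖ ≤ M) :
    IntegrableOn α (Set.Icc 0 T) :=
  ⟨W12.aestronglyMeasurable_of_toL2 (hα.aestronglyMeasurable measurableSet_Icc),
    .restrict_of_bounded (C := M) (by simp)
      ((ae_restrict_iff' measurableSet_Icc).2 (Eventually.of_forall hM))⟩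

/-! ### The splitting scheme -/

/-- The values of the splitting scheme with time step `τ` at the grid points. -/
def schemeIter (h : PotentialBound Γ C) (a : W12 d) (τ : ℝ) (n : ℕ) : W12 d :=
  (fun b => splitStep h b τ)^[n] a

/-- The splitting scheme with time step `τ`, interpolated by partial steps. -/
def schemeCurve (h : PotentialBound Γ C) (a : W12 d) (τ t : ℝ) : W12 d :=
  splitStep h (schemeIter h a τ ⌊t / τ⌋₊) (t - ⌊t / τ⌋₊ * τ)

theorem schemeIter_succ (h : PotentialBound Γ C) (a : W12 d) (τ : ℝ) (n : ℕ) :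
    schemeIter h a τ (n + 1) = splitStep h (schemeIter h a τ n) τ :=
  Function.iterate_succ_apply' _ _ _

theorem norm_toL2_schemeIter_le (h : PotentialBound Γ C) (a : W12 d) (τ : ℝ) (n : ℕ) :
    ‖(schemeIter h a τ n).toL2‖ ≤ ‖a.toL2‖ := by
  induction n with
  | zero => exact le_rfl
  | succ n ih => rw [schemeIter_succ]; exact (norm_toL2_splitStep_le h _ τ).trans ih

/-- The rate is monotone in the L² norm, which never increases, so the rate of the initial datum
serves at every step. -/
theorem norm_splitStep_le_of_le (h : PotentialBound Γ C) {a b : W12 d} {s t : ℝ} (hs : 0 ≤ s)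
    (hba : ‖b.toL2‖ ≤ ‖a.toL2‖) (hb : ‖b‖ ≤ Real.exp (growthRate d C ‖a.toL2‖ * t) * ‖a‖) :
    ‖splitStep h b s‖ ≤ Real.exp (growthRate d C ‖a.toL2‖ * (t + s)) * ‖a‖ := by
  refine (norm_splitStep_le h b s).trans ?_
  rw [abs_of_nonneg hs]
  have h1 : Real.exp (growthRate d C ‖b.toL2‖ * s) ≤ Real.exp (growthRate d C ‖a.toL2‖ * s) :=
    Real.exp_le_exp.2 (mul_le_mul_of_nonneg_right
      (growthRate_mono h.nonneg (norm_nonneg _) hba) hs)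
  calc _ ≤ Real.exp (growthRate d C ‖a.toL2‖ * s) *
        (Real.exp (growthRate d C ‖a.toL2‖ * t) * ‖a‖) :=
      mul_le_mul h1 hb (norm_nonneg _) (Real.exp_nonneg _)
    _ = _ := by rw [← mul_assoc, ← Real.exp_add]; ring_nf

theorem norm_schemeIter_le (h : PotentialBound Γ C) (a : W12 d) {τ : ℝ} (hτ : 0 ≤ τ) (n : ℕ) :
    ‖schemeIter h a τ n‖ ≤ Real.exp (growthRate d C ‖a.toL2‖ * (n * τ)) * ‖a‖ := by
  induction n with
  | zero => simp [schemeIter]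
  | succ n ih =>
    rw [schemeIter_succ]
    have := norm_splitStep_le_of_le h hτ (norm_toL2_schemeIter_le h a τ n) ih
    refine this.trans_eq ?_
    push_cast
    ring_nf

theorem HasVelocityBound.splitStep_of_le (h : PotentialBound Γ C) {a b : W12 d} {ρ s t : ℝ}
    (hs : 0 ≤ s) (hba : ‖b.toL2‖ ≤ ‖a.toL2‖)
    (hb : HasVelocityBound b (ρ + t * (d * (C * ‖a.toL2‖ ^ 2)))) :
    HasVelocityBound (_root_.splitStep h b s) (ρ + (t + s) * (d * (C * ‖a.toL2‖ ^ 2))) := by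
  refine (hb.splitStep h hs).mono ?_
  have hC := h.nonneg
  have : s * (d * (C * ‖b.toL2‖ ^ 2)) ≤ s * (d * (C * ‖a.toL2‖ ^ 2)) := by gcongr
  linarith

theorem HasVelocityBound.schemeIter (h : PotentialBound Γ C) {a : W12 d} {ρ τ : ℝ}
    (ha : HasVelocityBound a ρ) (hτ : 0 ≤ τ) (n : ℕ) :
    HasVelocityBound (_root_.schemeIter h a τ n) (ρ + n * τ * (d * (C * ‖a.toL2‖ ^ 2))) := by
  induction n with
  | zero => simpa [_root_.schemeIter] using ha
  | succ n ih =>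
    rw [schemeIter_succ]
    refine (HasVelocityBound.splitStep_of_le h hτ (norm_toL2_schemeIter_le h a τ n) ih).mono
      (le_of_eq ?_)
    push_cast
    ring

/-- The formula extends to the closed interval: at the right end the floor jumps, but a full step
equals the next iterate followed by a step of length zero. This makes the pieces glue continuously.
-/
theorem schemeCurve_eq (h : PotentialBound Γ C) (a : W12 d) {τ : ℝ} (hτ : 0 < τ) (n : ℕ) {t : ℝ}
    (ht : t ∈ Set.Icc (n * τ) ((n + 1) * τ)) :
    schemeCurve h a τ t = splitStep h (schemeIter h a τ n) (t - n * τ) := by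
  have h0 : 0 ≤ t / τ := div_nonneg ((by positivity : (0 : ℝ) ≤ n * τ).trans ht.1) hτ.le
  rcases ht.2.lt_or_eq with hlt | heq
  · have : ⌊t / τ⌋₊ = n :=
      (Nat.floor_eq_iff h0).2 ⟨(le_div_iff₀ hτ).2 ht.1, (div_lt_iff₀ hτ).2 hlt⟩
    rw [schemeCurve, this]
  · have h1 : t / τ = ((n + 1 : ℕ) : ℝ) := by
      rw [heq, mul_div_assoc, div_self hτ.ne', mul_one]; push_cast; rfl
    rw [schemeCurve, h1, Nat.floor_natCast, schemeIter_succ]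
    have e1 : t - ((n + 1 : ℕ) : ℝ) * τ = 0 := by rw [heq]; push_cast; ring
    have e2 : t - n * τ = τ := by rw [heq]; ring
    rw [e1, e2, splitStep_zero]

theorem floor_grid {τ t : ℝ} (hτ : 0 < τ) (ht : 0 ≤ t) :
    ⌊t / τ⌋₊ * τ ≤ t ∧ t < (⌊t / τ⌋₊ + 1) * τ :=
  ⟨(le_div_iff₀ hτ).1 (Nat.floor_le (div_nonneg ht hτ.le)),
    (div_lt_iff₀ hτ).1 (Nat.lt_floor_add_one _)⟩

theorem schemeCurve_zero (h : PotentialBound Γ C) (a : W12 d) (τ : ℝ) :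
    schemeCurve h a τ 0 = a := by
  simp [schemeCurve, splitStep_zero, schemeIter]

theorem norm_toL2_schemeCurve_le (h : PotentialBound Γ C) (a : W12 d) (τ t : ℝ) :
    ‖(schemeCurve h a τ t).toL2‖ ≤ ‖a.toL2‖ :=
  (norm_toL2_splitStep_le h _ _).trans (norm_toL2_schemeIter_le h a τ _)

theorem norm_schemeCurve_le (h : PotentialBound Γ C) (a : W12 d) {τ t : ℝ} (hτ : 0 < τ)
    (ht : 0 ≤ t) :
    ‖schemeCurve h a τ t‖ ≤ Real.exp (growthRate d C ‖a.toL2‖ * t) * ‖a‖ := by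
  have := norm_splitStep_le_of_le h (sub_nonneg.2 (floor_grid hτ ht).1)
    (norm_toL2_schemeIter_le h a τ _) (norm_schemeIter_le h a hτ.le ⌊t / τ⌋₊)
  rwa [add_sub_cancel] at this

theorem HasVelocityBound.schemeCurve (h : PotentialBound Γ C) {a : W12 d} {ρ τ t : ℝ}
    (ha : HasVelocityBound a ρ) (hτ : 0 < τ) (ht : 0 ≤ t) :
    HasVelocityBound (_root_.schemeCurve h a τ t) (ρ + t * (d * (C * ‖a.toL2‖ ^ 2))) := by
  have := HasVelocityBound.splitStep_of_le h (sub_nonneg.2 (floor_grid hτ ht).1)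
    (norm_toL2_schemeIter_le h a τ _) (ha.schemeIter h hτ.le ⌊t / τ⌋₊)
  rwa [add_sub_cancel] at this

/-- The splitting scheme is consistent of first order. -/
theorem exists_schemeCurve_isApproxSolution (h : PotentialBound Γ C) {a : W12 d} {ρ T : ℝ}
    (hρ : 0 ≤ ρ) (ha : HasVelocityBound a ρ) (hT : 0 ≤ T) : ∃ N : ℝ, 0 ≤ N ∧
    ∀ τ : ℝ, 0 < τ → τ ≤ 1 → IsApproxSolution Γ (schemeCurve h a τ) T (N * τ) := by
  have hC := h.nonneg
  -- The bounds are taken up to T + 1 because the last grid cell may extend past T by one step τ ≤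
  -- 1.
  set M : ℝ := Real.exp (growthRate d C ‖a.toL2‖ * (T + 1)) * ‖a‖ with hM
  have hM0 : 0 ≤ M := by positivity
  set ρ' : ℝ := ρ + (T + 1) * (d * (C * ‖a.toL2‖ ^ 2)) with hρ'
  obtain ⟨N, hN, hstep⟩ := exists_splitStep_bounds h (ρ := ρ') (M := M) (by positivity) hM0
  refine ⟨N * T, by positivity, fun τ hτ hτ1 => ?_⟩
  have hg := growthRate_nonneg (d := d) hC ‖a.toL2‖
  have hiter : ∀ n : ℕ, n * τ ≤ T + 1 → ‖schemeIter h a τ n‖ ≤ M ∧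
      HasVelocityBound (schemeIter h a τ n) ρ' := fun n hn =>
    ⟨(norm_schemeIter_le h a hτ.le n).trans (mul_le_mul_of_nonneg_right
      (Real.exp_le_exp.2 (mul_le_mul_of_nonneg_left hn hg)) (norm_nonneg _)),
    (ha.schemeIter h hτ.le n).mono (by rw [hρ']; gcongr)⟩
  have hcurve : ∀ t ∈ Set.Icc 0 T, ‖schemeCurve h a τ t‖ ≤ M := fun t ht =>
    (norm_schemeCurve_le h a hτ ht.1).trans (mul_le_mul_of_nonneg_right
      (Real.exp_le_exp.2 (mul_le_mul_of_nonneg_left (by linarith [ht.2]) hg)) (norm_nonneg _))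
  have hcont : ∀ n : ℕ, n * τ ≤ T + 1 →
      ContinuousOn (fun t => (schemeCurve h a τ t).toL2) (Set.Icc 0 (n * τ)) := by
    intro n
    induction n with
    | zero => intro _; simp
    | succ n ih =>
      intro hn
      push_cast at hn ⊢
      have hn' : n * τ ≤ T + 1 := by linarith
      rw [← Set.Icc_union_Icc_eq_Icc (b := n * τ) (by positivity) (by linarith)]
      refine (ih hn').union_of_isClosed ?_ isClosed_Icc isClosed_Icc
      have hlip : LipschitzOnWith N.toNNReal (fun t => (schemeCurve h a τ t).toL2)
          (Set.Icc (n * τ) ((n + 1) * τ)) := by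
        refine LipschitzOnWith.of_dist_le_mul fun t ht s hs => ?_
        rw [schemeCurve_eq h a hτ n ht, schemeCurve_eq h a hτ n hs, dist_eq_norm, dist_eq_norm,
          Real.coe_toNNReal _ hN, Real.norm_eq_abs]
        have := (hstep _ (hiter n hn').1 (hiter n hn').2).1 (s - n * τ)
          ⟨by linarith [hs.1], by linarith [hs.2]⟩ (t - n * τ)
          ⟨by linarith [ht.1], by linarith [ht.2]⟩
        rwa [sub_sub_sub_cancel_right] at this
      exact hlip.continuousOn
  have hcT : ContinuousOn (fun t => (schemeCurve h a τ t).toL2) (Set.Icc 0 T) := by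
    have h1 := (div_le_iff₀ hτ).1 (Nat.le_ceil (T / τ))
    have h2 := (lt_div_iff₀ hτ).1 (sub_lt_iff_lt_add.2 (Nat.ceil_lt_add_one (div_nonneg hT hτ.le)))
    exact (hcont ⌈T / τ⌉₊ (by linarith)).mono (Set.Icc_subset_Icc_right h1)
  refine ⟨hcT, integrableOn_of_continuousOn_toL2 hcT hcurve, fun φ hφ t ht => ?_⟩
  set p : ℝ → ℂ := fun s => ∫ z, φ z • hvlRHS Γ (schemeCurve h a τ s) z with hp
  have hpc : ContinuousOn p (Set.Icc 0 T) := continuousOn_integral_hvlRHS h hcT hM0 hcurve hφ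
  set v : ℝ → ℂ := Set.IccExtend hT ((Set.Icc 0 T).domRestrict p) with hv
  have hvc : Continuous v := (continuousOn_iff_continuous_domRestrict.1 hpc).Icc_extend'
  have hvp : ∀ s ∈ Set.Icc 0 T, v s = p s := fun s hs => by
    rw [hv, Set.IccExtend_of_mem hT _ hs]; rfl
  set f : ℝ → ℂ := fun s => (∫ z, φ z • (schemeCurve h a τ s).toL2 z) -
    ∫ r in (0 : ℝ)..s, v r with hf
  have hVd : ∀ s, HasDerivAt (fun s => ∫ r in (0 : ℝ)..s, v r) (v s) s := fun s =>
    (hvc.integral_hasStrictDerivAt 0 s).hasDerivAt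
  have hfc : ContinuousOn f (Set.Icc 0 T) :=
    ((testPairing hφ).continuous.comp_continuousOn hcT).sub
      fun s _ => (hVd s).continuousAt.continuousWithinAt
  set D : ℝ → ℂ := fun s => ∫ z, splitAdjoint Γ (schemeIter h a τ ⌊s / τ⌋₊)
    (s - ⌊s / τ⌋₊ * τ) φ z * (schemeCurve h a τ s).toL2 z with hD
  -- At grid points the frozen coefficients change, so only right derivatives are claimed; these
  -- suffice for the mean value inequality.
  have hfd : ∀ s ∈ Set.Ico 0 T, HasDerivWithinAt f (D s - v s) (Set.Ici s) s := by
    intro s hs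
    have hfl := floor_grid hτ hs.1
    refine HasDerivWithinAt.sub ?_ (hVd s).hasDerivWithinAt
    have h1 := (hasDerivAt_integral_splitStep h (schemeIter h a τ ⌊s / τ⌋₊) hφ
      (s - ⌊s / τ⌋₊ * τ)).comp_sub_const s (⌊s / τ⌋₊ * τ)
    refine h1.hasDerivWithinAt.congr_of_eventuallyEq ?_ rfl
    filter_upwards [Icc_mem_nhdsGE hfl.2] with r hr
    rw [schemeCurve_eq h a hτ ⌊s / τ⌋₊ ⟨hfl.1.trans hr.1, hr.2⟩]
  have hbd : ∀ s ∈ Set.Ico 0 T, ‖D s - v s‖ ≤ N * τ * l2norm φ := by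
    intro s hs
    have hfl := floor_grid hτ hs.1
    have hit := hiter ⌊s / τ⌋₊ (by linarith [hs.2])
    rw [hvp s ⟨hs.1, hs.2.le⟩]
    refine ((hstep _ hit.1 hit.2).2 φ hφ (s - ⌊s / τ⌋₊ * τ)
      ⟨by linarith, by linarith⟩).trans ?_
    refine mul_le_mul_of_nonneg_right (mul_le_mul_of_nonneg_left ?_ hN) (l2norm_nonneg φ)
    linarith
  have key := norm_image_sub_le_of_norm_deriv_right_le_segment hfc hfd hbd t ht
  have e1 : ∫ r in (0 : ℝ)..t, v r = ∫ r in (0 : ℝ)..t, p r := by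
    refine intervalIntegral.integral_congr fun r hr => ?_
    rw [Set.uIcc_of_le ht.1] at hr
    exact hvp r ⟨hr.1, hr.2.trans ht.2⟩
  have e2 : f t - f 0 = (∫ z, φ z • (schemeCurve h a τ t).toL2 z) -
      (∫ z, φ z • (schemeCurve h a τ 0).toL2 z) - ∫ r in (0 : ℝ)..t, p r := by
    simp only [hf, e1, intervalIntegral.integral_same, sub_zero]
    ring
  rw [e2] at key
  refine key.trans ?_
  have hl := l2norm_nonneg φ
  calc N * τ * l2norm φ * (t - 0) ≤ N * τ * l2norm φ * T := by
        rw [sub_zero]; exact mul_le_mul_of_nonneg_left ht.2 (by positivity)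
    _ = _ := by ring

/-! ### Passage to the limit -/

/-- Limits of approximate solutions with vanishing defects are solutions. -/
theorem exists_isHVlSolution_of_approx (h : PotentialBound Γ C) {α : ℕ → ℝ → W12 d} {a : W12 d}
    {M : ℝ → ℝ} {ε : ℕ → ℝ → ℝ}
    (hα : ∀ n T, 0 ≤ T → IsApproxSolution Γ (α n) T (ε n T))
    (hε : ∀ T, 0 ≤ T → Tendsto (fun n => ε n T) atTop (𝓝 0))
    (h0 : Tendsto (fun n => (α n 0).toL2) atTop (𝓝 a.toL2))
    (hM : ∀ n t, 0 ≤ t → ‖α n t‖ ≤ M t) (hMm : Monotone M)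
    (hcau : ∀ T, 0 ≤ T → UniformCauchySeqOn (fun n t => (α n t).toL2) atTop (Set.Icc 0 T)) :
    ∃ β : ℝ → W12 d, IsHVlSolution Γ a β ∧
      (∀ t, 0 ≤ t → Tendsto (fun n => (α n t).toL2) atTop (𝓝 (β t).toL2)) ∧
      ∀ t, 0 ≤ t → ‖β t‖ ≤ M t := by
  -- The L² limit at each time lies in W^{1,2} with the same bound, by weak compactness. Negative
  -- times receive an arbitrary value.
  have hex : ∀ t : ℝ, ∃ b : W12 d, 0 ≤ t →
      Tendsto (fun n => (α n t).toL2) atTop (𝓝 b.toL2) ∧ ‖b‖ ≤ M t := by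
    intro t
    by_cases ht : 0 ≤ t
    · obtain ⟨f, hf⟩ := cauchySeq_tendsto_of_complete
        ((hcau t ht).cauchySeq (x := t) ⟨ht, le_rfl⟩)
      obtain ⟨b, hb, hbM⟩ := W12.exists_of_tendsto (fun n => hM n t ht) hf
      exact ⟨b, fun _ => ⟨hb ▸ hf, hbM⟩⟩
    · exact ⟨a, fun h => absurd h ht⟩
  choose β hβ using hex
  have hunif : ∀ T, 0 ≤ T → TendstoUniformlyOn (fun n t => (α n t).toL2) (fun t => (β t).toL2)
      atTop (Set.Icc 0 T) := fun T hT =>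
    (hcau T hT).tendstoUniformlyOn_of_tendsto fun t ht => (hβ t ht.1).1
  have hcT : ∀ T, 0 ≤ T → ContinuousOn (fun t => (β t).toL2) (Set.Icc 0 T) := fun T hT =>
    (hunif T hT).continuousOn (Frequently.of_forall fun n => (hα n T hT).continuous_L2)
  have hMT : ∀ T, ∀ t ∈ Set.Icc 0 T, ‖β t‖ ≤ M T := fun T t ht =>
    (hβ t ht.1).2.trans (hMm ht.2)
  have hβ0 : β 0 = a := W12.toL2_injective (tendsto_nhds_unique (hβ 0 le_rfl).1 h0)
  refine ⟨β, ⟨hβ0, fun t ht => ?_, fun T => ?_, fun φ hφ t ht => ?_⟩, fun t ht => (hβ t ht).1,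
    fun t ht => (hβ t ht).2⟩
  · have ht0 : (0 : ℝ) ≤ t := ht
    refine (hcT (t + 1) (by linarith) t ⟨ht0, by linarith⟩).mono_of_mem_nhdsWithin ?_
    rw [← Set.Ici_inter_Iic]
    exact inter_mem_nhdsWithin _ (Iic_mem_nhds (by linarith))
  · by_cases hT : 0 ≤ T
    · exact integrableOn_of_continuousOn_toL2 (hcT T hT) (hMT T)
    · rw [Set.Icc_eq_empty hT]; exact integrableOn_empty
  · have hM0 : 0 ≤ M t := (norm_nonneg _).trans (hβ t ht).2
    obtain ⟨A, hA, hlip⟩ := exists_norm_integral_hvlRHS_sub_le h hφ hM0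
    set p : ℝ → ℂ := fun s => ∫ z, φ z • hvlRHS Γ (β s) z with hp
    set pn : ℕ → ℝ → ℂ := fun n s => ∫ z, φ z • hvlRHS Γ (α n s) z with hpn
    have hMn : ∀ n, ∀ s ∈ Set.Icc 0 t, ‖α n s‖ ≤ M t := fun n s hs =>
      (hM n s hs.1).trans (hMm hs.2)
    have hpi : IntervalIntegrable p volume 0 t :=
      (continuousOn_integral_hvlRHS h (hcT t ht) hM0 (hMT t) hφ).intervalIntegrable_of_Icc ht
    have hpni : ∀ n, IntervalIntegrable (pn n) volume 0 t := fun n =>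
      (continuousOn_integral_hvlRHS h (hα n t ht).continuous_L2 hM0
        (hMn n) hφ).intervalIntegrable_of_Icc ht
    have hint : Tendsto (fun n => ∫ s in (0 : ℝ)..t, pn n s) atTop
        (𝓝 (∫ s in (0 : ℝ)..t, p s)) := by
      rw [Metric.tendsto_atTop]
      intro δ hδ
      -- Uniform L² convergence passes through the L²-Lipschitz bound for the tested right-hand
      -- side; the 1 in A t + 1 avoids division by zero.
      obtain ⟨n₀, hn₀⟩ := eventually_atTop.1 (Metric.tendstoUniformlyOn_iff.1 (hunif t ht)
        (δ / (A * t + 1)) (by positivity))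
      refine ⟨n₀, fun n hn => ?_⟩
      rw [dist_eq_norm, ← intervalIntegral.integral_sub (hpni n) hpi]
      have hb : ‖∫ s in (0 : ℝ)..t, (pn n s - p s)‖ ≤ A * (δ / (A * t + 1)) * |t - 0| := by
        refine intervalIntegral.norm_integral_le_of_norm_le_const fun s hs => ?_
        rw [Set.uIoc_of_le ht] at hs
        have hs' : s ∈ Set.Icc 0 t := ⟨hs.1.le, hs.2⟩
        refine (hlip _ _ (hMn n s hs') (hMT t s hs')).trans (mul_le_mul_of_nonneg_left ?_ hA)
        have := hn₀ n hn s hs'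
        rw [dist_comm, dist_eq_norm] at this
        exact this.le
      refine hb.trans_lt ?_
      rw [sub_zero, abs_of_nonneg ht]
      have : A * (δ / (A * t + 1)) * t = δ * (A * t / (A * t + 1)) := by ring
      rw [this]
      have : A * t / (A * t + 1) < 1 := (div_lt_one (by positivity)).2 (by linarith)
      exact mul_lt_of_lt_one_right hδ this
    have hpair : ∀ s, 0 ≤ s → Tendsto (fun n => ∫ z, φ z • (α n s).toL2 z) atTop
        (𝓝 (∫ z, φ z • (β s).toL2 z)) := fun s hs =>
      ((testPairing hφ).continuous.tendsto _).comp (hβ s hs).1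
    have hlim := (((hpair t ht).sub (hpair 0 le_rfl)).sub hint).norm
    have hz : ‖(∫ z, φ z • (β t).toL2 z) - (∫ z, φ z • (β 0).toL2 z) -
        ∫ s in (0 : ℝ)..t, p s‖ ≤ 0 := by
      have h1 := (hε t ht).mul_const (l2norm φ)
      rw [zero_mul] at h1
      exact le_of_tendsto_of_tendsto' hlim h1 fun n =>
        (hα n t ht).equation φ hφ t ⟨ht, le_rfl⟩
    have := norm_le_zero_iff.1 hz
    rw [hβ0, sub_sub, sub_eq_zero] at this
    exact this

/-- Existence of solutions for data with bounded velocity support. -/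
theorem exists_isHVlSolution_of_velocity (h : PotentialBound Γ C) {a : W12 d} {ρ : ℝ}
    (hρ : 0 ≤ ρ) (ha : HasVelocityBound a ρ) : ∃ β : ℝ → W12 d, IsHVlSolution Γ a β ∧
      (∀ t, 0 ≤ t → ‖(β t).toL2‖ ≤ ‖a.toL2‖) ∧
      ∀ t, 0 ≤ t → ‖β t‖ ≤ Real.exp (growthRate d C ‖a.toL2‖ * t) * ‖a‖ := by
  have hC := h.nonneg
  set τ : ℕ → ℝ := fun n => 1 / ((n : ℝ) + 1) with hτ
  have hτ0 : ∀ n, 0 < τ n := fun n => by positivity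
  have hτ1 : ∀ n, τ n ≤ 1 := fun n => by
    rw [hτ]; exact (div_le_one (by positivity)).2 (by linarith [n.cast_nonneg (α := ℝ)])
  have hτlim : Tendsto τ atTop (𝓝 0) := tendsto_one_div_add_atTop_nhds_zero_nat
  have hτanti : Antitone τ := fun m n hmn => by
    have : (m : ℝ) ≤ n := by exact_mod_cast hmn
    simp only [hτ]; gcongr
  have hg := growthRate_nonneg (d := d) hC ‖a.toL2‖
  have hex : ∀ T : ℝ, ∃ N : ℝ, 0 ≤ T → 0 ≤ N ∧
      ∀ n, IsApproxSolution Γ (schemeCurve h a (τ n)) T (N * τ n) := fun T => by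
    by_cases hT : 0 ≤ T
    · obtain ⟨N, hN, hap⟩ := exists_schemeCurve_isApproxSolution h hρ ha hT
      exact ⟨N, fun _ => ⟨hN, fun n => hap _ (hτ0 n) (hτ1 n)⟩⟩
    · exact ⟨0, fun h => absurd h hT⟩
  choose N hN using hex
  have hMm : Monotone fun t => Real.exp (growthRate d C ‖a.toL2‖ * t) * ‖a‖ := fun s t hst =>
    mul_le_mul_of_nonneg_right (Real.exp_le_exp.2 (mul_le_mul_of_nonneg_left hst hg))
      (norm_nonneg _)
  obtain ⟨A, hA, hstab⟩ := exists_stability_of_bounded h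
  have hcau : ∀ T, 0 ≤ T → UniformCauchySeqOn (fun n t => (schemeCurve h a (τ n) t).toL2) atTop
      (Set.Icc 0 T) := by
    intro T hT
    obtain ⟨hN0, hap⟩ := hN T hT
    set M := Real.exp (growthRate d C ‖a.toL2‖ * T) * ‖a‖ with hM
    have hcM : ∀ n, ∀ t ∈ Set.Icc 0 T, ‖schemeCurve h a (τ n) t‖ ≤ M := fun n t ht =>
      (norm_schemeCurve_le h a (hτ0 n) ht.1).trans (hMm ht.2)
    -- Here the bounded velocity support is used: B does not depend on R, so η = ε B is admissible
    -- in the stability estimate and tends to 0 with ε.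
    obtain ⟨B, hB, hcut⟩ := exists_norm_cutRHS_le_of_velocity h
      (ρ := ρ + T * (d * (C * ‖a.toL2‖ ^ 2))) (M := M) (by positivity) (by positivity)
    have hcB : ∀ n, ∀ t ∈ Set.Icc 0 T, ∀ R : ℝ, 0 < R →
        ‖cutRHS Γ R (schemeCurve h a (τ n) t)‖ ≤ B := fun n t ht R hR =>
      hcut _ (hcM n t ht) ((ha.schemeCurve h (hτ0 n) ht.1).mono (by
        have := ht.2
        gcongr)) R hR
    -- Both curves start at a, so only the defects enter, and both are dominated by the defect for
    -- the coarser step τ k.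
    have hest : ∀ k m n : ℕ, k ≤ m → k ≤ n → ∀ t ∈ Set.Icc 0 T,
        ‖(schemeCurve h a (τ m) t).toL2 - (schemeCurve h a (τ n) t).toL2‖ ^ 2 ≤
          32 * (N T * τ k * B * T + (N T * τ k) ^ 2) * Real.exp (A * M ^ 2 * T) := by
      intro k m n hkm hkn t ht
      have hε : 0 ≤ N T * τ k := mul_nonneg hN0 (hτ0 k).le
      have := hstab T (N T * τ k) (N T * τ k * B) M _ _ hε
        ((hap m).mono (mul_le_mul_of_nonneg_left (hτanti hkm) hN0))
        ((hap n).mono (mul_le_mul_of_nonneg_left (hτanti hkn) hN0)) (hcM m) (hcM n)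
        (fun s hs R hR => mul_le_mul_of_nonneg_left (hcB m s hs R hR) hε)
        (fun s hs R hR => mul_le_mul_of_nonneg_left (hcB n s hs R hR) hε) t ht
      simpa [schemeCurve_zero] using this
    have hz : Tendsto (fun k => 32 * (N T * τ k * B * T + (N T * τ k) ^ 2) *
        Real.exp (A * M ^ 2 * T)) atTop (𝓝 0) := by
      have h1 := hτlim.const_mul (N T)
      have h2 := ((((h1.mul_const B).mul_const T).add (h1.pow 2)).const_mul 32).mul_const
        (Real.exp (A * M ^ 2 * T))
      simpa using h2
    rw [Metric.uniformCauchySeqOn_iff]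
    intro δ hδ
    obtain ⟨k, hk⟩ := (hz.eventually (gt_mem_nhds (pow_pos hδ 2))).exists
    refine ⟨k, fun m hm n hn t ht => ?_⟩
    rw [dist_eq_norm]
    exact lt_of_pow_lt_pow_left₀ 2 hδ.le ((hest k m n hm hn t ht).trans_lt hk)
  obtain ⟨β, hβ, hlim, hβM⟩ := exists_isHVlSolution_of_approx h
    (α := fun n => schemeCurve h a (τ n)) (a := a) (ε := fun n T => N T * τ n)
    (fun n T hT => (hN T hT).2 n) (fun T _ => by simpa using hτlim.const_mul (N T))
    (by simp only [schemeCurve_zero]; exact tendsto_const_nhds)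
    (fun n t ht => norm_schemeCurve_le h a (hτ0 n) ht) hMm hcau
  exact ⟨β, hβ, fun t ht => le_of_tendsto (hlim t ht).norm
    (Eventually.of_forall fun n => norm_toL2_schemeCurve_le h a _ t), hβM⟩

/-- Stability of exact solutions that are bounded in `W^{1,2}`. -/
theorem IsHVlSolution.exists_stability (h : PotentialBound Γ C) : ∃ A : ℝ, 0 ≤ A ∧
    ∀ (T M : ℝ) (a b : W12 d) (α β : ℝ → W12 d), IsHVlSolution Γ a α → IsHVlSolution Γ b β →
    (∀ t ∈ Set.Icc 0 T, ‖α t‖ ≤ M) → (∀ t ∈ Set.Icc 0 T, ‖β t‖ ≤ M) →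
    ∀ t ∈ Set.Icc 0 T, ‖(α t).toL2 - (β t).toL2‖ ≤
      Real.sqrt (2 * Real.exp (A * M ^ 2 * T)) * ‖a.toL2 - b.toL2‖ := by
  obtain ⟨A, hA, hst⟩ := exists_stability_of_bounded h
  refine ⟨A, hA, fun T M a b α β hα hβ hαM hβM t ht => ?_⟩
  have := hst T 0 0 M α β le_rfl (hα.isApproxSolution T) (hβ.isApproxSolution T) hαM hβM
    (fun s _ R _ => by rw [zero_mul]) (fun s _ R _ => by rw [zero_mul]) t ht
  rw [hα.initial, hβ.initial] at this
  refine le_of_sq_le_sq ?_ (by positivity)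
  rw [mul_pow, Real.sq_sqrt (by positivity)]
  linarith

/-- Cutting off large velocities. -/
theorem exists_velocity_cutoff (d : ℕ) : ∃ c : ℝ, 1 ≤ c ∧ ∀ a : W12 d, ∃ b : ℕ → W12 d,
    Tendsto (fun n => (b n).toL2) atTop (𝓝 a.toL2) ∧
    (∀ n, ‖(b n).toL2‖ ≤ ‖a.toL2‖) ∧ (∀ n, ‖b n‖ ≤ c * ‖a‖) ∧
    ∀ n : ℕ, HasVelocityBound (b n) (2 * (n + 1)) := by
  obtain ⟨A, hA, hgrad⟩ := exists_fderiv_velCutoff_le d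
  refine ⟨1 + (2 * d + 1) * A, by nlinarith [(d.cast_nonneg : (0 : ℝ) ≤ d)], fun a => ?_⟩
  have hχ : ∀ n : ℕ, ContDiff ℝ 1 (velCutoff (d := d) ((n : ℝ) + 1)) := fun n =>
    (contDiff_velCutoff _).of_le (by exact_mod_cast le_top)
  have hex : ∀ n : ℕ, ∃ b : W12 d,
      (b.toL2 =ᵐ[volume] fun z => (velCutoff ((n : ℝ) + 1) z : ℂ) * a.toL2 z) ∧
      ‖b.toL2‖ ≤ ‖a.toL2‖ ∧ ∀ j, ‖b.deriv j‖ ≤ ‖a.deriv j‖ + A * ‖a.toL2‖ := fun n => by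
    refine a.exists_mul (m := fun z => (velCutoff ((n : ℝ) + 1) z : ℂ))
      (Complex.ofRealCLM.contDiff.comp (hχ n))
      (fun z => (Complex.norm_real _).trans_le (abs_velCutoff_le_one _ z)) fun j z => ?_
    rw [fderiv_ofReal_apply ((hχ n).differentiable one_ne_zero z), Complex.norm_real]
    -- As n + 1 ≥ 1, the gradient of the cutoff is bounded by A for every n, which gives one
    -- constant c for all cutoffs.
    refine (hgrad _ (by positivity) z j).trans (div_le_self hA ?_)
    linarith [n.cast_nonneg (α := ℝ)]
  choose b hb hb2 hbd using hex
  refine ⟨b, ?_, hb2, fun n => W12.norm_le_of_components hA (hb2 n) fun j =>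
    (hbd n j).trans (add_le_add_right (mul_le_mul_of_nonneg_left a.norm_toL2_le hA) _),
    fun n => ?_⟩
  · have := tendsto_mulR (fun n => (hχ n).continuous) (fun n => abs_velCutoff_le_one _)
      tendsto_velCutoff a.toL2
    refine this.congr fun n => Lp.ext ?_
    filter_upwards [hb n, coeFn_mulR (hχ n).continuous (abs_velCutoff_le_one _) a.toL2]
      with z h1 h2
    rw [h1, h2]
  · filter_upwards [hb n] with z hz hlt
    rw [hz, velCutoff_eq_zero (by positivity) hlt.le, Complex.ofReal_zero, zero_mul]

/-- Existence of global solutions, with bounds. -/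
theorem exists_isHVlSolution (h : PotentialBound Γ C) : ∃ c : ℝ, 1 ≤ c ∧ ∀ a : W12 d,
    ∃ β : ℝ → W12 d, IsHVlSolution Γ a β ∧ (∀ t, 0 ≤ t → ‖(β t).toL2‖ ≤ ‖a.toL2‖) ∧
      ∀ t, 0 ≤ t → ‖β t‖ ≤ Real.exp (growthRate d C ‖a.toL2‖ * t) * (c * ‖a‖) := by
  obtain ⟨c, hc, hcut⟩ := exists_velocity_cutoff d
  refine ⟨c, hc, fun a => ?_⟩
  have hC := h.nonneg
  obtain ⟨b, hblim, hb2, hbn, hbv⟩ := hcut a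
  choose α hα hα2 hαM using fun n => exists_isHVlSolution_of_velocity h (by positivity) (hbv n)
  obtain ⟨A, hA, hstab⟩ := IsHVlSolution.exists_stability h
  have hg := growthRate_nonneg (d := d) hC ‖a.toL2‖
  have hMm : Monotone fun t => Real.exp (growthRate d C ‖a.toL2‖ * t) * (c * ‖a‖) := fun s t hst =>
    mul_le_mul_of_nonneg_right (Real.exp_le_exp.2 (mul_le_mul_of_nonneg_left hst hg))
      (by positivity)
  have hαM' : ∀ n t, 0 ≤ t →
      ‖α n t‖ ≤ Real.exp (growthRate d C ‖a.toL2‖ * t) * (c * ‖a‖) := fun n t ht =>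
    (hαM n t ht).trans (mul_le_mul (Real.exp_le_exp.2 (mul_le_mul_of_nonneg_right
      (growthRate_mono hC (norm_nonneg _) (hb2 n)) ht)) (hbn n) (norm_nonneg _)
      (Real.exp_nonneg _))
  -- The Sobolev bound is the same for all n, so a single Lipschitz constant transfers the Cauchy
  -- property from the data to the solutions.
  have hcau : ∀ T, 0 ≤ T → UniformCauchySeqOn (fun n t => (α n t).toL2) atTop (Set.Icc 0 T) := by
    intro T hT
    set M := Real.exp (growthRate d C ‖a.toL2‖ * T) * (c * ‖a‖) with hM
    set K := Real.sqrt (2 * Real.exp (A * M ^ 2 * T)) with hK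
    have hK0 : 0 ≤ K := Real.sqrt_nonneg _
    rw [Metric.uniformCauchySeqOn_iff]
    intro δ hδ
    obtain ⟨k, hk⟩ := Metric.cauchySeq_iff.1 hblim.cauchySeq (δ / (K + 1)) (by positivity)
    refine ⟨k, fun m hm n hn t ht => ?_⟩
    have h1 := hk m hm n hn
    rw [dist_eq_norm] at h1 ⊢
    have hMt : ∀ n, ∀ t ∈ Set.Icc 0 T, ‖α n t‖ ≤ M := fun n t ht =>
      (hαM' n t ht.1).trans (hMm ht.2)
    refine (hstab T M _ _ _ _ (hα m) (hα n) (hMt m) (hMt n) t ht).trans_lt ?_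
    calc K * ‖(b m).toL2 - (b n).toL2‖ ≤ K * (δ / (K + 1)) := mul_le_mul_of_nonneg_left h1.le hK0
      _ < (K + 1) * (δ / (K + 1)) := by
        refine mul_lt_mul_of_pos_right (by linarith) (by positivity)
      _ = δ := by field_simp
  obtain ⟨β, hβ, hlim, hβM⟩ := exists_isHVlSolution_of_approx h (α := α) (a := a)
    (ε := fun _ _ => 0) (fun n T _ => (hα n).isApproxSolution T)
    (fun T _ => tendsto_const_nhds)
    (by simpa only [(hα _).initial] using hblim) hαM' hMm hcau
  exact ⟨β, hβ, fun t ht => le_of_tendsto (hlim t ht).norm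
    (Eventually.of_forall fun n => (hα2 n t ht).trans (hb2 n)), hβM⟩

end

/-! ### Well-posedness. -/

theorem theorem3p5 (d : ℕ) (Γ : EuclideanSpace ℝ (Fin d) → ℝ) (hΓ : IsRegularPotential Γ) :
    ∃ S : W12 d → ℝ → W12 d,
      -- existence: `S a` is a global solution with initial datum `a`
      (∀ a, IsHVlSolution Γ a (S a)) ∧
      -- uniqueness
      (∀ a α, IsHVlSolution Γ a α → Set.EqOn α (S a) (Set.Ici 0)) ∧
      -- local Lipschitz continuity of the solution map into `L^∞([0,T]; L²)`
      (∀ T : ℝ, 0 < T →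
        ∃ h : ∀ a, MemLp (fun t => (S a t).toL2) ⊤ (volume.restrict (Set.Icc 0 T)),
          LocallyLipschitz fun a => (h a).toLp) ∧
      -- solutions lie in `L^∞([0,∞); L²)` and in `L^∞([0,T]; W^{1,2})` for all `T`
      (∀ a, MemLp (fun t => (S a t).toL2) ⊤ (volume.restrict (Set.Ici 0)) ∧
        ∀ T : ℝ, 0 < T → MemLp (S a) ⊤ (volume.restrict (Set.Icc 0 T))) := by
  obtain ⟨C, h⟩ := hΓ.exists_bound
  have hC := h.nonneg
  obtain ⟨c, hc, hex⟩ := exists_isHVlSolution h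
  choose S hS hS2 hSM using hex
  have hmem : ∀ a, MemLp (fun t => (S a t).toL2) ⊤ (volume.restrict (Set.Ici 0)) := fun a =>
    memLp_top_of_bound ((hS a).continuous_L2.aestronglyMeasurable measurableSet_Ici) ‖a.toL2‖
      ((ae_restrict_iff' measurableSet_Ici).2 (Filter.Eventually.of_forall (hS2 a)))
  have hmemT : ∀ a (T : ℝ), MemLp (fun t => (S a t).toL2) ⊤ (volume.restrict (Set.Icc 0 T)) :=
    fun a T => (hmem a).mono_measure (Measure.restrict_mono Set.Icc_subset_Ici_self le_rfl)
  have hbound : ∀ (a : W12 d) (T m M : ℝ), ‖a.toL2‖ ≤ m → ‖a‖ ≤ M → ∀ t ∈ Set.Icc 0 T,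
      ‖S a t‖ ≤ Real.exp (growthRate d C m * T) * (c * M) := fun a T m M hm hM t ht => by
    have hg := growthRate_mono (d := d) hC (norm_nonneg _) hm
    refine (hSM a t ht.1).trans (mul_le_mul (Real.exp_le_exp.2 ?_) (by gcongr) (by positivity)
      (Real.exp_nonneg _))
    exact mul_le_mul hg ht.2 ht.1 (growthRate_nonneg hC _)
  refine ⟨S, hS, fun a α hα => hα.eqOn h (hS a), fun T hT => ⟨fun a => hmemT a T, fun a => ?_⟩,
    fun a => ⟨hmem a, fun T hT => ?_⟩⟩
  · obtain ⟨A, hA, hstab⟩ := IsHVlSolution.exists_stability h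
    set M := Real.exp (growthRate d C (‖a‖ + 1) * T) * (c * (‖a‖ + 1)) with hM
    set K := Real.sqrt (2 * Real.exp (A * M ^ 2 * T)) with hK
    have hK0 : 0 ≤ K := Real.sqrt_nonneg _
    -- All data in the unit ball around a produce solutions with one Sobolev bound M on [0, T], so K
    -- is a common Lipschitz constant there.
    have hball : ∀ b ∈ Metric.ball a 1, ∀ t ∈ Set.Icc 0 T, ‖S b t‖ ≤ M := fun b hb => by
      have hb' : ‖b‖ ≤ ‖a‖ + 1 := by
        have h1 := norm_le_insert' b a
        rw [Metric.mem_ball, dist_eq_norm] at hb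
        linarith
      exact hbound b T _ _ (b.norm_toL2_le.trans hb') hb'
    refine ⟨K.toNNReal, Metric.ball a 1, Metric.ball_mem_nhds a one_pos,
      LipschitzOnWith.of_dist_le_mul fun b hb b' hb' => ?_⟩
    rw [dist_eq_norm, dist_eq_norm, Real.coe_toNNReal _ hK0]
    have hae : ∀ᵐ t ∂(volume.restrict (Set.Icc 0 T)),
        ‖((fun t => (S b t).toL2) - fun t => (S b' t).toL2) t‖ ≤ K * ‖b - b'‖ := by
      refine (ae_restrict_iff' measurableSet_Icc).2 (Filter.Eventually.of_forall fun t ht => ?_)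
      refine (hstab T M b b' _ _ (hS b) (hS b') (hball b hb) (hball b' hb') t ht).trans ?_
      rw [← W12.toL2_sub]
      exact mul_le_mul_of_nonneg_left (b - b').norm_toL2_le hK0
    rw [← MemLp.toLp_sub, Lp.norm_toLp, eLpNorm_exponent_top]
    exact ENNReal.toReal_le_of_le_ofReal (by positivity) (eLpNormEssSup_le_of_ae_bound hae)
  · exact memLp_top_of_bound (W12.aestronglyMeasurable_of_toL2 (hmemT a T).aestronglyMeasurable) _
      ((ae_restrict_iff' measurableSet_Icc).2 (Filter.Eventually.of_forall
        (hbound a T _ _ le_rfl le_rfl)))
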